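/- Let $\mathbb K$ be a field of characteristic zero and let $V=\bigoplus_{p\in\mathbb Z}V^p$ be a finite-dimensional $\mathbb Z$-graded vector space over $\mathbb K$. Let $\mathcal O_V=\odot^\bullet V^*$ be the free graded commutative algebra generated by the dual graded space $V^*$ (the polynomial functions on $V$), and for homogeneous $v\in V$ let $\partial_v$ be the graded derivation of $\mathcal O_V$ with $\partial_v(x)=x(v)$ for $x\in V^*$. For $k\ge 0$ let $C^k_{\mathrm{diff}}(\mathcal O_V)\subset \mathrm{Hom}_{\mathbb K}(\mathcal O_V^{\otimes k},\mathcal O_V)$ be the span of the polydifferential operators $$f_1\otimes\cdots\otimes f_k\ \longmapsto\ \pm\, g\cdot\partial_{w_1}f_1\cdots\partial_{w_k}f_k ,\qquad g\in\mathcal O_V,$$ where each $\partial_{w_i}$ is a composition $\partial_{v_1}\circ\cdots\circ\partial_{v_r}$ of some order $r\ge0$ (the identity for $r=0$) with homogeneous $v_j\in V$, and $\pm$ is the Koszul sign. Then $C^{\bullet}_{\mathrm{diff}}(\mathcal O_V)$ is a subcomplex of the standard Hochschild complex of $\mathcal O_V$ with coefficients in $\mathcal O_V$, and the cohomology of $C^{\bullet\ge1}_{\mathrm{diff}}(\mathcal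 O_V)=\bigoplus_{k\ge 1}C^k_{\mathrm{diff}}(\mathcal O_V)$ is $$H\bigl(C^{\bullet\ge 1}_{\mathrm{diff}}(\mathcal O_V)\bigr)=\wedge^{\bullet\ge1}V\otimes\odot^\bullet V^* .$$ More precisely, for every $k\ge1$ there is an isomorphism of graded vector spaces from $\wedge^kV\otimes\mathcal O_V$ (with $\wedge^kV$ the graded exterior power) onto the cohomology in arity $k$, which sends $v_1\wedge\cdots\wedge v_k\otimes f$, for homogeneous $v_i$, to the class of the cocycle $f\cdot\partial_{v_1}\otimes\cdots\otimes\partial_{v_k}$. The same holds for the normalized polydifferential operators, i.e. when all the compositions $\partial_{w_i}$ are required to have order $r\ge1$. -/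

import Mathlib

open scoped TensorProduct

noncomputable section

namespace PolyHKR

/-! ### Graded symmetric and graded exterior algebras -/

section Koszul

variable {K W : Type*} [Field K] [AddCommGroup W] [Module K W]

/-- The relations `x y = ε (-1)^{mn} y x` for `x` homogeneous of degree `m` and `y` homogeneous of
degree `n` in a graded vector space `W = ⨁ 𝒲 n`. -/
inductive KoszulRel (ε : K) (𝒲 : ℤ → Submodule K W) :
    TensorAlgebra K W → TensorAlgebra K W → Prop
  | swap {m n : ℤ} {x y : W} (hx : x ∈ 𝒲 m) (hy : y ∈ 𝒲 n) :
      KoszulRel ε 𝒲 (TensorAlgebra.ι K x * TensorAlgebra.ι K y)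
        ((ε * (-1) ^ (m * n)) • (TensorAlgebra.ι K y * TensorAlgebra.ι K x))

/-- The tensor algebra of `W` modulo the Koszul relations. Over a field of characteristic zero this
is the graded symmetric algebra `⊙W` for `ε = 1`, and the graded exterior algebra `∧W` for
`ε = -1`. -/
def KoszulAlgebra (ε : K) (𝒲 : ℤ → Submodule K W) : Type _ := RingQuot (KoszulRel ε 𝒲)

instance (ε : K) (𝒲 : ℤ → Submodule K W) : Ring (KoszulAlgebra ε 𝒲) :=
  inferInstanceAs (Ring (RingQuot (KoszulRel ε 𝒲)))

instance (ε : K) (𝒲 : ℤ → Submodule K W) : Algebra K (KoszulAlgebra ε 𝒲) :=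
  inferInstanceAs (Algebra K (RingQuot (KoszulRel ε 𝒲)))

namespace KoszulAlgebra

variable (ε : K) (𝒲 : ℤ → Submodule K W)

/-- The canonical map from `W`. -/
def ι : W →ₗ[K] KoszulAlgebra ε 𝒲 :=
  (RingQuot.mkAlgHom K (KoszulRel ε 𝒲)).toLinearMap ∘ₗ TensorAlgebra.ι K

theorem ι_mul_ι {m n : ℤ} {x y : W} (hx : x ∈ 𝒲 m) (hy : y ∈ 𝒲 n) :
    ι ε 𝒲 x * ι ε 𝒲 y = (ε * (-1) ^ (m * n)) • (ι ε 𝒲 y * ι ε 𝒲 x) := by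
  have h := RingQuot.mkAlgHom_rel K (KoszulRel.swap (ε := ε) hx hy)
  rw [map_smul, map_mul, map_mul] at h
  exact h

variable {ε 𝒲}

/-- The universal property. -/
def lift {A : Type*} [Ring A] [Algebra K A] (f : W →ₗ[K] A)
    (hf : ∀ m n : ℤ, ∀ x ∈ 𝒲 m, ∀ y ∈ 𝒲 n, f x * f y = (ε * (-1) ^ (m * n)) • (f y * f x)) :
    KoszulAlgebra ε 𝒲 →ₐ[K] A :=
  RingQuot.liftAlgHom K ⟨TensorAlgebra.lift K f, by
    rintro _ _ ⟨hx, hy⟩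
    simpa using hf _ _ _ hx _ hy⟩

@[simp]
theorem lift_ι {A : Type*} [Ring A] [Algebra K A] (f : W →ₗ[K] A)
    (hf : ∀ m n : ℤ, ∀ x ∈ 𝒲 m, ∀ y ∈ 𝒲 n, f x * f y = (ε * (-1) ^ (m * n)) • (f y * f x))
    (x : W) : lift f hf (ι ε 𝒲 x) = f x := by
  have h : lift f hf (ι ε 𝒲 x) = TensorAlgebra.lift K f (TensorAlgebra.ι K x) :=
    RingQuot.liftAlgHom_mkAlgHom_apply K _ _ _
  rw [h, TensorAlgebra.lift_ι_apply]

theorem hom_ext {A : Type*} [Ring A] [Algebra K A] {f g : KoszulAlgebra ε 𝒲 →ₐ[K] A}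
    (h : ∀ x, f (ι ε 𝒲 x) = g (ι ε 𝒲 x)) : f = g := by
  apply RingQuot.ringQuot_ext'
  apply TensorAlgebra.hom_ext
  ext x
  exact h x

theorem mem_of_ι_mem (S : Subalgebra K (KoszulAlgebra ε 𝒲)) (h : ∀ x, ι ε 𝒲 x ∈ S)
    (f : KoszulAlgebra ε 𝒲) : f ∈ S := by
  let g : KoszulAlgebra ε 𝒲 →ₐ[K] S :=
    lift ((ι ε 𝒲).codRestrict (Subalgebra.toSubmodule S) h) (by
      intro m n x hx y hy
      apply Subtype.ext
      exact ι_mul_ι ε 𝒲 hx hy)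
  have hg : S.val.comp g = AlgHom.id K _ := by
    apply hom_ext
    intro x
    rw [AlgHom.comp_apply, lift_ι]
    rfl
  have := congrArg (fun φ => φ f) hg
  simp only [AlgHom.comp_apply, AlgHom.id_apply] at this
  rw [← this]
  exact (g f).2

end KoszulAlgebra

end Koszul

/-! ### Graded exterior powers -/

section Ext

variable {K V : Type*} [Field K] [AddCommGroup V] [Module K V] (𝒱 : ℤ → Submodule K V)

/-- The graded exterior algebra `∧V`. -/
abbrev Ext : Type _ := KoszulAlgebra (-1 : K) 𝒱

/-- The graded exterior power `∧^k V`: the span of the `k`-fold products of vectors in `∧V`. -/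
abbrev ExtPower (k : ℕ) : Submodule K (Ext 𝒱) :=
  LinearMap.range (KoszulAlgebra.ι (-1 : K) 𝒱) ^ k

/-- `v₁ ∧ ⋯ ∧ v_k`. -/
def wedge {k : ℕ} (v : Fin k → V) : ExtPower 𝒱 k :=
  ⟨(List.ofFn fun i => KoszulAlgebra.ι (-1 : K) 𝒱 (v i)).prod, by
    induction k with
    | zero => rw [List.ofFn_zero, List.prod_nil, ExtPower, pow_zero]; exact Submodule.one_le.mp le_rfl
    | succ k ih =>
      rw [List.ofFn_succ, List.prod_cons, ExtPower, pow_succ']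
      exact Submodule.mul_mem_mul (LinearMap.mem_range_self _ _) (ih fun i => v i.succ)⟩

end Ext

/-! ### The algebra of polynomial functions and its derivations -/

section Poly

variable {K V : Type*} [Field K] [AddCommGroup V] [Module K V] (𝒱 : ℤ → Submodule K V)

/-- The grading of `V* = Hom(V, K)`: degree `n` consists of the functionals that vanish on every
`V^j` with `j ≠ -n`. -/
def dualGrading (n : ℤ) : Submodule K (Module.Dual K V) where
  carrier := {x | ∀ j : ℤ, j ≠ -n → ∀ v ∈ 𝒱 j, x v = 0}
  add_mem' hx hy j hj v hv := by simp [hx j hj v hv, hy j hj v hv]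
  zero_mem' _ _ _ _ := rfl
  smul_mem' c x hx j hj v hv := by simp [hx j hj v hv]

/-- `𝒪_V = ⊙V*`, the graded commutative algebra of polynomial functions on `V`. -/
abbrev Poly : Type _ := KoszulAlgebra (1 : K) (dualGrading 𝒱)

/-- A linear functional, as an element of `𝒪_V`. -/
abbrev coord : Module.Dual K V →ₗ[K] Poly 𝒱 := KoszulAlgebra.ι (1 : K) (dualGrading 𝒱)

/-- The component of `𝒪_V` of (internal) degree `n`. -/
def polyDegree (n : ℤ) : Submodule K (Poly 𝒱) :=
  Submodule.span K {f | ∃ (m : ℕ) (x : Fin m → Module.Dual K V) (e : Fin m → ℤ),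
    (∀ i, x i ∈ dualGrading 𝒱 (e i)) ∧ ∑ i, e i = n ∧ f = (List.ofFn fun i => coord 𝒱 (x i)).prod}

variable [DirectSum.Decomposition 𝒱]

/-- The map `v ↦ (-1)^{pq} v` for `v ∈ V^q`. -/
def signMap (p : ℤ) : V →ₗ[K] V :=
  DirectSum.toModule K ℤ V (fun q => ((-1 : K) ^ (p * q)) • (𝒱 q).subtype) ∘ₗ
    (DirectSum.decomposeLinearEquiv 𝒱).toLinearMap

theorem signMap_apply (p : ℤ) {q : ℤ} {v : V} (hv : v ∈ 𝒱 q) :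
    signMap 𝒱 p v = (-1 : K) ^ (p * q) • v := by
  lift v to 𝒱 q using hv
  simp [signMap]

theorem dual_ext {x y : Module.Dual K V} (h : ∀ q, ∀ v ∈ 𝒱 q, x v = y v) : x = y := by
  ext v
  induction v using DirectSum.Decomposition.inductionOn 𝒱 with
  | zero => simp
  | homogeneous v => exact h _ _ v.2
  | add v w hv hw => simp [hv, hw]

theorem comp_signMap (p : ℤ) {n : ℤ} {x : Module.Dual K V} (hx : x ∈ dualGrading 𝒱 n) :
    x ∘ₗ signMap 𝒱 p = (-1 : K) ^ (p * n) • x := by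
  apply dual_ext 𝒱
  intro q v hv
  rw [LinearMap.comp_apply, signMap_apply 𝒱 p hv, map_smul, LinearMap.smul_apply]
  by_cases hq : q = -n
  · subst hq
    rw [mul_neg, zpow_neg, ← inv_zpow, inv_neg, inv_one]
  · rw [hx q hq v hv, smul_zero, smul_zero]

/-- The algebra automorphism `f ↦ (-1)^{p|f|} f` of `𝒪_V`. -/
def polySign (p : ℤ) : Poly 𝒱 →ₐ[K] Poly 𝒱 :=
  KoszulAlgebra.lift (coord 𝒱 ∘ₗ (signMap 𝒱 p).dualMap) (by
    intro m n x hx y hy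
    have hx' : (signMap 𝒱 p).dualMap x = (-1 : K) ^ (p * m) • x := comp_signMap 𝒱 p hx
    have hy' : (signMap 𝒱 p).dualMap y = (-1 : K) ^ (p * n) • y := comp_signMap 𝒱 p hy
    simp only [LinearMap.comp_apply, hx', hy', map_smul, smul_mul_smul_comm]
    rw [KoszulAlgebra.ι_mul_ι _ _ hx hy, smul_comm, mul_comm ((-1 : K) ^ (p * m))])

theorem polySign_coord (p : ℤ) {n : ℤ} {x : Module.Dual K V} (hx : x ∈ dualGrading 𝒱 n) :
    polySign 𝒱 p (coord 𝒱 x) = (-1 : K) ^ (p * n) • coord 𝒱 x := by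
  have hx' : (signMap 𝒱 p).dualMap x = (-1 : K) ^ (p * n) • x := comp_signMap 𝒱 p hx
  rw [polySign, KoszulAlgebra.lift_ι, LinearMap.comp_apply, hx', map_smul]

/-- For `v ∈ V^p`, the algebra map `f ↦ !![(-1)^{p|f|} f, ∂_v f; 0, f]` that encodes the graded
derivation `∂_v`: on a functional `x` it is `!![(-1)^{p|x|} x, x(v); 0, x]`. -/
def derivMatrix (p : ℤ) (v : 𝒱 p) : Poly 𝒱 →ₐ[K] Matrix (Fin 2) (Fin 2) (Poly 𝒱) :=
  KoszulAlgebra.lift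
    { toFun := fun x => !![polySign 𝒱 p (coord 𝒱 x), algebraMap K _ (x v); 0, coord 𝒱 x]
      map_add' := by
        intro x y
        ext i j
        fin_cases i <;> fin_cases j <;> simp
      map_smul' := by
        intro c x
        ext i j
        fin_cases i <;> fin_cases j <;> simp [Algebra.smul_def] } (by
    intro m n x hx y hy
    have key : ∀ {q : ℤ} {z : Module.Dual K V}, z ∈ dualGrading 𝒱 q →
        ∀ l : ℤ, (-1 : K) ^ (p * l) * z v = (-1 : K) ^ (q * l) * z v := by
      intro q z hz l
      by_cases h : p = -q
      · have : q = -p := by omega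
        rw [this, neg_mul, zpow_neg, ← inv_zpow, inv_neg, inv_one]
      · rw [hz p h v v.2, mul_zero, mul_zero]
    have hsq : ((-1 : K) ^ (m * n)) * (-1) ^ (m * n) = 1 := by
      rw [← mul_zpow]; simp
    have hxy := KoszulAlgebra.ι_mul_ι (1 : K) (dualGrading 𝒱) hx hy
    rw [one_mul] at hxy
    ext i j
    fin_cases i <;> fin_cases j
    · simp only [LinearMap.coe_mk, AddHom.coe_mk, polySign_coord 𝒱 p hx, polySign_coord 𝒱 p hy]
      simp [hxy, smul_smul]
      ring_nf
    · simp only [LinearMap.coe_mk, AddHom.coe_mk, polySign_coord 𝒱 p hx, polySign_coord 𝒱 p hy]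
      simp only [Fin.zero_eta, Fin.isValue, Fin.mk_one, Matrix.mul_apply, Fin.sum_univ_two,
        Matrix.of_apply, Matrix.cons_val', Matrix.cons_val_zero, Matrix.cons_val_fin_one,
        Matrix.cons_val_one, Matrix.smul_apply, smul_add, ← Algebra.commutes,
        ← Algebra.smul_def, smul_smul, one_mul]
      rw [add_comm]
      congr 1
      · congr 1
        rw [mul_comm (x v : K), key hx, ← mul_assoc, hsq, one_mul]
      · congr 1
        rw [mul_comm, key hy, mul_comm n m]
    · simp
    · simp [hxy])

/-- The graded derivation `∂_v` of `𝒪_V`, for `v ∈ V^p`. -/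
def partialDeriv (p : ℤ) (v : 𝒱 p) : Poly 𝒱 →ₗ[K] Poly 𝒱 :=
  Matrix.entryLinearMap K (Poly 𝒱) 0 1 ∘ₗ (derivMatrix 𝒱 p v).toLinearMap

theorem derivMatrix_entries (p : ℤ) (v : 𝒱 p) (f : Poly 𝒱) :
    derivMatrix 𝒱 p v f 0 0 = polySign 𝒱 p f ∧ derivMatrix 𝒱 p v f 1 0 = 0 ∧
      derivMatrix 𝒱 p v f 1 1 = f := by
  let S : Subalgebra K (Poly 𝒱) :=
    { carrier := {f | derivMatrix 𝒱 p v f 0 0 = polySign 𝒱 p f ∧ derivMatrix 𝒱 p v f 1 0 = 0 ∧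
        derivMatrix 𝒱 p v f 1 1 = f}
      mul_mem' := by
        rintro f g ⟨h1, h2, h3⟩ ⟨h4, h5, h6⟩
        simp [Matrix.mul_apply, Fin.sum_univ_two, h1, h2, h3, h4, h5, h6]
      add_mem' := by
        rintro f g ⟨h1, h2, h3⟩ ⟨h4, h5, h6⟩
        simp [h1, h2, h3, h4, h5, h6]
      algebraMap_mem' := by
        intro c
        simp [Matrix.algebraMap_matrix_apply] }
  refine KoszulAlgebra.mem_of_ι_mem S (fun x => ?_) f
  change _ ∧ _ ∧ _
  simp [derivMatrix]

theorem partialDeriv_coord (p : ℤ) (v : 𝒱 p) (x : Module.Dual K V) :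
    partialDeriv 𝒱 p v (coord 𝒱 x) = algebraMap K _ (x v) := by
  simp [partialDeriv, derivMatrix]

/-- The graded Leibniz rule `∂_v(fg) = (∂_v f) g + (-1)^{|v||f|} f ∂_v g`. -/
theorem partialDeriv_mul (p : ℤ) (v : 𝒱 p) (f g : Poly 𝒱) :
    partialDeriv 𝒱 p v (f * g) =
      partialDeriv 𝒱 p v f * g + polySign 𝒱 p f * partialDeriv 𝒱 p v g := by
  have hf := derivMatrix_entries 𝒱 p v f
  have hg := derivMatrix_entries 𝒱 p v g
  simp [partialDeriv, Matrix.mul_apply, Fin.sum_univ_two, hf.1, hg.2.2, add_comm]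

end Poly

/-! ### Subquotients -/

section Subquotient

variable {K M : Type*} [Field K] [AddCommGroup M] [Module K M]

/-- The quotient `Z / B` of two subspaces `B ≤ Z` of `M`. -/
def Subquotient (Z B : Submodule K M) : Type _ := Z ⧸ B.submoduleOf Z

instance (Z B : Submodule K M) : AddCommGroup (Subquotient Z B) :=
  inferInstanceAs (AddCommGroup (Z ⧸ B.submoduleOf Z))

instance (Z B : Submodule K M) : Module K (Subquotient Z B) :=
  inferInstanceAs (Module K (Z ⧸ B.submoduleOf Z))

/-- The class in `Z / B` of an element of `Z`. -/
def Subquotient.mk (Z B : Submodule K M) : Z →ₗ[K] Subquotient Z B :=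
  (B.submoduleOf Z).mkQ

end Subquotient

/-! ### The Hochschild complex of a graded algebra -/

section Hochschild

variable {K A : Type*} [Field K] [Ring A] [Algebra K A]

variable (K A) in
/-- The space `Hom(A^{⊗k}, A)` of Hochschild cochains of arity `k`. -/
abbrev Cochain (k : ℕ) : Type _ := MultilinearMap K (fun _ : Fin k => A) A

variable (K) in
theorem contractNth_update {k : ℕ} (j : Fin k) (a : Fin (k + 1) → A) (i : Fin (k + 1)) :
    ∃ (m : Fin k) (L : A →ₗ[K] A), ∀ x : A,
      Fin.contractNth j.castSucc (· * ·) (Function.update a i x) =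
        Function.update (Fin.contractNth j.castSucc (· * ·) a) m (L x) := by
  obtain ⟨i, hi⟩ := i
  obtain ⟨j, hj⟩ := j
  rcases lt_trichotomy i j with h | h | h
  · refine ⟨⟨i, by omega⟩, LinearMap.id, fun x => ?_⟩
    ext ⟨l, hl⟩
    simp only [Fin.contractNth, Function.update_apply, Fin.ext_iff, LinearMap.id_apply,
      Fin.castSucc_mk, Fin.succ_mk]
    grind
  · refine ⟨⟨j, hj⟩, LinearMap.mulRight K (a ⟨j + 1, by omega⟩), fun x => ?_⟩
    ext ⟨l, hl⟩
    simp only [Fin.contractNth, Function.update_apply, Fin.ext_iff, LinearMap.mulRight_apply,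
      Fin.castSucc_mk, Fin.succ_mk]
    grind
  · by_cases h' : i = j + 1
    · refine ⟨⟨j, hj⟩, LinearMap.mulLeft K (a ⟨j, by omega⟩), fun x => ?_⟩
      ext ⟨l, hl⟩
      simp only [Fin.contractNth, Function.update_apply, Fin.ext_iff, LinearMap.mulLeft_apply,
        Fin.castSucc_mk, Fin.succ_mk]
      grind
    · refine ⟨⟨i - 1, by omega⟩, LinearMap.id, fun x => ?_⟩
      ext ⟨l, hl⟩
      simp only [Fin.contractNth, Function.update_apply, Fin.ext_iff, LinearMap.id_apply,
        Fin.castSucc_mk, Fin.succ_mk]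
      grind

/-- The term `(a₁, …, a_{k+1}) ↦ φ(a₁, …, a_j a_{j+1}, …, a_{k+1})` (with `j` counted from `0` in
the code). -/
def innerFace {k : ℕ} (j : Fin k) : Cochain K A k →ₗ[K] Cochain K A (k + 1) where
  toFun φ :=
    { toFun := fun a => φ (Fin.contractNth j.castSucc (· * ·) a)
      map_update_add' := by
        intro inst a i x y
        obtain rfl : inst = instDecidableEqFin _ := Subsingleton.elim _ _
        obtain ⟨m, L, h⟩ := contractNth_update K j a i
        simp only [h, map_add, φ.map_update_add]
      map_update_smul' := by
        intro inst a i c x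
        obtain rfl : inst = instDecidableEqFin _ := Subsingleton.elim _ _
        obtain ⟨m, L, h⟩ := contractNth_update K j a i
        simp only [h, map_smul, φ.map_update_smul] }
  map_add' _ _ := rfl
  map_smul' _ _ := rfl

/-- The term `(a₁, …, a_{k+1}) ↦ φ(a₁, …, a_k) a_{k+1}`. -/
def rightFace (k : ℕ) : Cochain K A k →ₗ[K] Cochain K A (k + 1) where
  toFun φ :=
    { toFun := fun a => φ (Fin.init a) * a (Fin.last k)
      map_update_add' := by
        intro inst a i x y
        obtain rfl : inst = instDecidableEqFin _ := Subsingleton.elim _ _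
        induction i using Fin.lastCases with
        | last => simp [mul_add]
        | cast i => simp [Fin.init_update_castSucc, add_mul, (Fin.castSucc_lt_last i).ne']
      map_update_smul' := by
        intro inst a i c x
        obtain rfl : inst = instDecidableEqFin _ := Subsingleton.elim _ _
        induction i using Fin.lastCases with
        | last => simp
        | cast i => simp [Fin.init_update_castSucc, (Fin.castSucc_lt_last i).ne'] }
  map_add' _ _ := by ext; simp [add_mul]
  map_smul' _ _ := by ext; simp

/-- Let `σ` be the parity automorphism `a ↦ (-1)^{|a|} a` of the graded algebra `A`. This is the
cochain `(-1)^{|φ|} φ`, where `|φ|` is the internal degree of `φ`. -/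
def conj (σ : A →ₐ[K] A) {k : ℕ} : Cochain K A k →ₗ[K] Cochain K A k where
  toFun φ := σ.toLinearMap.compMultilinearMap (φ.compLinearMap fun _ => σ.toLinearMap)
  map_add' _ _ := by ext; simp
  map_smul' _ _ := by ext; simp

/-- The even part of an element of `A`. -/
def evenPart (σ : A →ₐ[K] A) : A →ₗ[K] A := (2 : K)⁻¹ • (LinearMap.id + σ.toLinearMap)

/-- The odd part of an element of `A`. -/
def oddPart (σ : A →ₐ[K] A) : A →ₗ[K] A := (2 : K)⁻¹ • (LinearMap.id - σ.toLinearMap)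

/-- The term `(a₁, …, a_{k+1}) ↦ (-1)^{|φ||a₁|} a₁ φ(a₂, …, a_{k+1})`. -/
def leftFace (σ : A →ₐ[K] A) (k : ℕ) : Cochain K A k →ₗ[K] Cochain K A (k + 1) where
  toFun φ :=
    { toFun := fun a =>
        evenPart σ (a 0) * φ (Fin.tail a) + oddPart σ (a 0) * conj σ φ (Fin.tail a)
      map_update_add' := by
        intro inst a i x y
        obtain rfl : inst = instDecidableEqFin _ := Subsingleton.elim _ _
        induction i using Fin.cases with
        | zero => simp [add_mul]; abel
        | succ i => simp [Fin.tail_update_succ, mul_add, (Fin.succ_ne_zero i).symm]; abel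
      map_update_smul' := by
        intro inst a i c x
        obtain rfl : inst = instDecidableEqFin _ := Subsingleton.elim _ _
        induction i using Fin.cases with
        | zero => simp
        | succ i => simp [Fin.tail_update_succ, (Fin.succ_ne_zero i).symm] }
  map_add' _ _ := by ext; simp [mul_add]; abel
  map_smul' _ _ := by ext; simp

/-- The Hochschild differential of the graded algebra `A`,
`(dφ)(a₁, …, a_{k+1}) = (-1)^{|φ||a₁|} a₁ φ(a₂, …) + ∑_{j=1}^k (-1)^j φ(…, a_j a_{j+1}, …)
+ (-1)^{k+1} φ(a₁, …, a_k) a_{k+1}`. -/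
def hochschildD (σ : A →ₐ[K] A) (k : ℕ) : Cochain K A k →ₗ[K] Cochain K A (k + 1) :=
  leftFace σ k + ∑ j : Fin k, (-1 : K) ^ ((j : ℕ) + 1) • innerFace j + (-1 : K) ^ (k + 1) • rightFace k

end Hochschild

/-! ### The polydifferential Hochschild complex -/

section PolyDiff

variable {K V : Type*} [Field K] [AddCommGroup V] [Module K V] (𝒱 : ℤ → Submodule K V)

/-- The total degree of a word in homogeneous vectors of `V`. -/
def wordDegree (w : List (Σ p : ℤ, 𝒱 p)) : ℤ := (w.map fun v => v.1).sum

/-- The component of degree `n` of `∧^k V ⊗ 𝒪_V`. -/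
def polyvectorDegree (k : ℕ) (n : ℤ) : Submodule K (ExtPower 𝒱 k ⊗[K] Poly 𝒱) :=
  Submodule.span K {t | ∃ (v : Fin k → Σ p : ℤ, 𝒱 p) (m : ℤ) (f : Poly 𝒱), f ∈ polyDegree 𝒱 m ∧
    ∑ i, (v i).1 + m = n ∧ t = wedge 𝒱 (fun i => ((v i).2 : V)) ⊗ₜ[K] f}

variable [DirectSum.Decomposition 𝒱]

/-- The Hochschild differential of `𝒪_V`. -/
abbrev dH (k : ℕ) : Cochain K (Poly 𝒱) k →ₗ[K] Cochain K (Poly 𝒱) (k + 1) :=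
  hochschildD (polySign 𝒱 1) k

/-- The constant coefficient operator `∂_w = ∂_{v₁} ∘ ⋯ ∘ ∂_{v_r}` of a word
`w = v₁ ⋯ v_r` in homogeneous vectors. -/
def wordDeriv (w : List (Σ p : ℤ, 𝒱 p)) : Poly 𝒱 →ₗ[K] Poly 𝒱 :=
  (w.map fun v => partialDeriv 𝒱 v.1 v.2).foldr (fun D E => D ∘ₗ E) LinearMap.id

/-- The polydifferential operator `g · ∂_{w₁} ⊗ ⋯ ⊗ ∂_{w_k}`, that is
`(f₁, …, f_k) ↦ ± g · ∂_{w₁} f₁ ⋯ ∂_{w_k} f_k` with the Koszul sign `(-1)^{∑_{i<j} |f_i||w_j|}`. -/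
def polyOp {k : ℕ} (g : Poly 𝒱) (w : Fin k → List (Σ p : ℤ, 𝒱 p)) : Cochain K (Poly 𝒱) k :=
  (LinearMap.mulLeft K g).compMultilinearMap
    ((MultilinearMap.mkPiAlgebraFin K k (Poly 𝒱)).compLinearMap fun i =>
      wordDeriv 𝒱 (w i) ∘ₗ (polySign 𝒱 (∑ j with i < j, wordDegree 𝒱 (w j))).toLinearMap)

/-- The polydifferential cochains of arity `k` all of whose tensor factors `∂_w` have order at
least `r`. For `r = 0` these are all the polydifferential operators; for `r = 1` they are the
normalized ones, which involve derivatives along non-empty multi-indices only. -/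
def polyDiff (r k : ℕ) : Submodule K (Cochain K (Poly 𝒱) k) :=
  Submodule.span K
    {φ | ∃ (g : Poly 𝒱) (w : Fin k → List (Σ p : ℤ, 𝒱 p)),
      (∀ i, r ≤ (w i).length) ∧ φ = polyOp 𝒱 g w}

/-- The cocycles of arity `k`. -/
def cocycles (r k : ℕ) : Submodule K (Cochain K (Poly 𝒱) k) :=
  polyDiff 𝒱 r k ⊓ LinearMap.ker (dH 𝒱 k)

/-- The coboundaries of arity `k` in the complex of cochains of arity at least `1`. -/
def coboundaries (r : ℕ) : (k : ℕ) → Submodule K (Cochain K (Poly 𝒱) k)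
  | 0 => ⊥
  | 1 => ⊥
  | k + 2 => (polyDiff 𝒱 r (k + 1)).map (dH 𝒱 (k + 1))

/-- The cohomology in arity `k ≥ 1` of the polydifferential Hochschild complex of cochains of arity
at least `1`. -/
abbrev Cohomology (r k : ℕ) : Type _ :=
  Subquotient (cocycles 𝒱 r k) (coboundaries 𝒱 r k)

/-- The cohomology class of a cocycle. -/
abbrev cohomologyClass (r k : ℕ) : cocycles 𝒱 r k →ₗ[K] Cohomology 𝒱 r k :=
  Subquotient.mk (cocycles 𝒱 r k) (coboundaries 𝒱 r k)

/-- The cochains of internal degree `n`. -/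
def cochainDegree (k : ℕ) (n : ℤ) : Submodule K (Cochain K (Poly 𝒱) k) where
  carrier := {φ | ∀ (e : Fin k → ℤ) (f : Fin k → Poly 𝒱), (∀ i, f i ∈ polyDegree 𝒱 (e i)) →
    φ f ∈ polyDegree 𝒱 (n + ∑ i, e i)}
  add_mem' h h' e f hf := Submodule.add_mem _ (h e f hf) (h' e f hf)
  zero_mem' _ _ _ := Submodule.zero_mem _
  smul_mem' c _ h e f hf := Submodule.smul_mem _ c (h e f hf)

/-- The classes of the cocycles of internal degree `n`. -/
def cohomologyDegree (r k : ℕ) (n : ℤ) : Submodule K (Cohomology 𝒱 r k) :=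
  ((cochainDegree 𝒱 k n).submoduleOf (cocycles 𝒱 r k)).map (cohomologyClass 𝒱 r k)

end PolyDiff

end PolyHKR

end

/-! The Hochschild differential splits as `leftFace + barD`. The summand `barD`, which omits the
left multiplication, squares to zero by itself and is contracted, up to sign, by evaluation at `1`
in the first argument (`evalHead_one_barD`). On left faces the full differential reduces to `barD`
(`hochschildD_leftFace`), so left faces contribute no cohomology. What matters is the failure of a
cocycle to be a left face, that is, to have order zero in its first argument.

This failure is measured by the graded commutators `commHead` with multiplication by the coordinates
`x_i`. They commute with `barD`, and they all vanish exactly on left faces (`commHead_leftFace`,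
`eq_leftFace_of_commHead_eq_zero`). Tensoring cochains with `∧V` assembles them into the Koszul
differential `κ = ∑ [·, x_i] ⊗ e_i ∧` (`koszulD`). The first word of a polydifferential operator
behaves like a polynomial in the `∂_i`, and `κ` acts on it like the de Rham differential. The
Laplacian of `κ` has eigenvalue (order of the first word) + (exterior degree), so in characteristic
zero `κ` is exact in positive exterior degree: this is the polynomial Poincaré lemma
`exists_koszulD_eq`. Cochains with values in `∧V` thus form a double complex that is exact in both
directions, apart from exterior degree zero.

Iterating "apply `κ`, then evaluate at `1`" `k` times gives a symbol map from arity `k` to `∧^k V ⊗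
𝒪_V`. It kills coboundaries (`symbol_dH`) and takes `f ∂_{v₁} ⊗ ⋯ ⊗ ∂_{v_k}` to `v₁ ∧ ⋯ ∧ v_k ⊗ f`
up to a sign depending only on `k` (`symbol_polyOp`). Conversely, a zigzag through the double
complex (`exists_primitive`) shows that a cocycle with zero symbol is a coboundary
(`exists_dH_eq_of_symbol_eq_zero`). The isomorphism of the theorem is the inverse of the map that
the symbol induces on cohomology, so injectivity and surjectivity of the
Hochschild–Kostant–Rosenberg map need no separate proof.

The subcomplex property is the iterated Leibniz rule. The normalized case runs in parallel: `κ`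
lowers the order of the first factor, possibly to zero, so the double complex uses `headDiff`, where
that factor is unrestricted. The excess part of order zero is removed at the end. -/

noncomputable section

namespace PolyHKR

/-! ### The bar part of the Hochschild differential and its contraction -/

section Bar

variable {K A : Type*} [Field K] [Ring A] [Algebra K A]

/-- Evaluation of a cochain at a fixed first argument. -/
def evalHead {n : ℕ} (a : A) : Cochain K A (n + 1) →ₗ[K] Cochain K A n where
  toFun φ := φ.curryLeft a
  map_add' _ _ := rfl
  map_smul' _ _ := rfl

@[simp]
theorem evalHead_apply {n : ℕ} (a : A) (φ : Cochain K A (n + 1)) (x : Fin n → A) :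
    evalHead a φ x = φ (Fin.cons a x) := rfl

theorem cochain_ext {n : ℕ} {φ ψ : Cochain K A (n + 1)}
    (h : ∀ a, evalHead a φ = evalHead a ψ) : φ = ψ := by
  ext x
  rw [← Fin.cons_self_tail x]
  exact congrArg (fun χ => χ (Fin.tail x)) (h (x 0))

theorem evalHead_add {n : ℕ} (a b : A) (φ : Cochain K A (n + 1)) :
    evalHead (a + b) φ = evalHead a φ + evalHead b φ := by
  change φ.curryLeft (a + b) = φ.curryLeft a + φ.curryLeft b
  exact map_add _ _ _

theorem evalHead_smul {n : ℕ} (c : K) (a : A) (φ : Cochain K A (n + 1)) :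
    evalHead (c • a) φ = c • evalHead a φ := by
  change φ.curryLeft (c • a) = c • φ.curryLeft a
  exact map_smul _ _ _

/-- Precomposition of a cochain with a linear map in the first argument. -/
def preHead {n : ℕ} (L : A →ₗ[K] A) : Cochain K A (n + 1) →ₗ[K] Cochain K A (n + 1) where
  toFun φ := (φ.curryLeft ∘ₗ L).uncurryLeft
  map_add' _ _ := rfl
  map_smul' _ _ := rfl

theorem preHead_apply {n : ℕ} (L : A →ₗ[K] A) (φ : Cochain K A (n + 1)) (x : Fin (n + 1) → A) :
    preHead L φ x = φ (Fin.cons (L (x 0)) (Fin.tail x)) := rfl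

@[simp]
theorem evalHead_preHead {n : ℕ} (a : A) (L : A →ₗ[K] A) (φ : Cochain K A (n + 1)) :
    evalHead a (preHead L φ) = evalHead (L a) φ := by
  ext x
  simp [preHead_apply]

@[simp]
theorem evalHead_smul_apply {n : ℕ} (a g : A) (φ : Cochain K A (n + 1)) :
    evalHead a (g • φ) = g • evalHead a φ := rfl

/-- The part `∑_j (-1)^j φ(…, a_j a_{j+1}, …) + (-1)^{k+1} φ(a₁, …, a_k) a_{k+1}` of the
Hochschild differential. -/
def barD (n : ℕ) : Cochain K A n →ₗ[K] Cochain K A (n + 1) :=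
  ∑ j : Fin n, (-1 : K) ^ ((j : ℕ) + 1) • innerFace j + (-1 : K) ^ (n + 1) • rightFace n

theorem hochschildD_eq (σ : A →ₐ[K] A) (n : ℕ) :
    hochschildD (K := K) σ n = leftFace σ n + barD n := by
  rw [hochschildD, barD, add_assoc]

theorem barD_zero_apply (φ : Cochain K A 0) (x : Fin 1 → A) :
    barD 0 φ x = -(φ ![] * x 0) := by
  have : Fin.init x = ![] := Subsingleton.elim _ _
  simp [barD, rightFace, this]

/-- Fixing the first argument singles out the face that multiplies the first two arguments. All
other faces act on the remaining arguments with index shifted by one, which flips the sign. This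
recursion replaces the simplicial identities: facts about `barD` follow from it by induction on the
arity. -/
theorem evalHead_barD {n : ℕ} (a : A) (φ : Cochain K A (n + 1)) :
    evalHead a (barD (n + 1) φ) = -preHead (LinearMap.mulLeft K a) φ - barD n (evalHead a φ) := by
  ext x
  have h0 : Fin.contractNth (0 : Fin (n + 2)) (· * ·) (Fin.cons a x) =
      Fin.cons (a * x 0) (Fin.tail x) := by
    ext i
    induction i using Fin.cases with
    | zero => simp [Fin.contractNth]
    | succ i => simp [Fin.contractNth, Fin.tail]
  have hs : ∀ j : Fin n, Fin.contractNth j.succ.castSucc (· * ·)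
      (Fin.cons a x : Fin (n + 2) → A) = Fin.cons a (Fin.contractNth j.castSucc (· * ·) x) := by
    intro j
    ext i
    induction i using Fin.cases with
    | zero => simp [Fin.contractNth]
    | succ i =>
      simp only [Fin.contractNth, Fin.cons_succ]
      rcases lt_trichotomy (i : ℕ) j with h | h | h
      · simp [h]
      · simp [h]
      · have h1 : ¬ (i : ℕ) < j := by omega
        have h2 : (i : ℕ) ≠ j := by omega
        simp [h1, h2]
  have hi : Fin.init (Fin.cons a x : Fin (n + 2) → A) = Fin.cons a (Fin.init x) := by
    ext i
    induction i using Fin.cases with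
    | zero => simp [Fin.init]
    | succ i => simp [Fin.init]
  have hp : preHead (LinearMap.mulLeft K a) φ x = φ (Fin.cons (a * x 0) (Fin.tail x)) := by
    simp [preHead_apply]
  have hl : (Fin.cons a x : Fin (n + 2) → A) (Fin.last (n + 1)) = x (Fin.last n) := by
    rw [← Fin.succ_last, Fin.cons_succ]
  simp only [barD, evalHead_apply, LinearMap.add_apply, LinearMap.sum_apply, LinearMap.smul_apply,
    _root_.add_apply, _root_.sum_apply, _root_.smul_apply,
    _root_.sub_apply, _root_.neg_apply, Fin.sum_univ_succ, hp]
  have e1 : ∀ j : Fin n, innerFace (K := K) j.succ φ (Fin.cons a x) =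
      innerFace j (evalHead a φ) x := by
    intro j
    simp only [innerFace, LinearMap.coe_mk, AddHom.coe_mk, MultilinearMap.coe_mk, evalHead_apply]
    rw [← hs j]
  have e0 : innerFace (K := K) 0 φ (Fin.cons a x) = φ (Fin.cons (a * x 0) (Fin.tail x)) := by
    rw [← h0]; rfl
  have e2 : rightFace (K := K) (n + 1) φ (Fin.cons a x) = rightFace n (evalHead a φ) x := by
    simp only [rightFace, LinearMap.coe_mk, AddHom.coe_mk, MultilinearMap.coe_mk, evalHead_apply]
    rw [hi, hl]
  simp only [e0, e1, e2, Fin.val_succ, Fin.val_zero]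
  simp only [zero_add, pow_one, neg_smul, one_smul, neg_add_rev, sub_eq_add_neg,
    pow_succ (-1 : K) (_ + 1), mul_neg, mul_one, Finset.sum_neg_distrib]
  abel

theorem evalHead_barD_zero (a : A) (φ : Cochain K A 0) (x : Fin 0 → A) :
    evalHead a (barD 0 φ) x = -(φ ![] * a) := by
  simp [barD_zero_apply]

/-- Multiplication by `1` is trivial in the recursion, so evaluation at `1` contracts `barD` up to
sign. -/
theorem evalHead_one_barD {n : ℕ} (φ : Cochain K A (n + 1)) :
    evalHead 1 (barD (n + 1) φ) = -φ - barD n (evalHead 1 φ) := by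
  rw [evalHead_barD]
  congr 2
  apply cochain_ext
  simp

theorem evalHead_one_barD_zero (φ : Cochain K A 0) : evalHead 1 (barD 0 φ) = -φ := by
  ext x
  rw [evalHead_barD_zero, Subsingleton.elim x ![]]
  simp

theorem preHead_barD {n : ℕ} (a : A) (φ : Cochain K A (n + 1)) :
    preHead (LinearMap.mulLeft K a) (barD (n + 1) φ) =
      barD (n + 1) (preHead (LinearMap.mulLeft K a) φ) := by
  apply cochain_ext
  intro b
  simp only [evalHead_preHead, evalHead_barD]
  congr 2
  apply cochain_ext
  intro c
  simp

/-- The two terms that multiply the fixed argument into the next one cancel, because `barD` commutes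
with that multiplication; the rest is the induction hypothesis. Arity zero is associativity. -/
theorem barD_barD (n : ℕ) (φ : Cochain K A n) : barD (n + 1) (barD n φ) = 0 := by
  induction n with
  | zero =>
    apply cochain_ext
    intro a
    ext x
    rw [evalHead_barD]
    simp [preHead_apply, barD_zero_apply, mul_assoc]
  | succ n ih =>
    apply cochain_ext
    intro a
    rw [evalHead_barD, evalHead_barD, preHead_barD, map_sub, map_neg, ih, map_zero]
    simp

theorem barD_smul (n : ℕ) (g : A) (φ : Cochain K A n) : barD n (g • φ) = g • barD n φ := by
  induction n with
  | zero => ext x; simp [barD_zero_apply, mul_assoc]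
  | succ n ih =>
    apply cochain_ext
    intro a
    rw [evalHead_barD, evalHead_smul_apply, ih, evalHead_smul_apply, evalHead_barD, smul_sub,
      smul_neg]
    rfl

variable (σ : A →ₐ[K] A)

theorem conj_apply {n : ℕ} (φ : Cochain K A n) (x : Fin n → A) :
    conj σ φ x = σ (φ fun i => σ (x i)) := rfl

theorem evalHead_conj {n : ℕ} (a : A) (φ : Cochain K A (n + 1)) :
    evalHead a (conj σ φ) = conj σ (evalHead (σ a) φ) := by
  ext x
  simp only [evalHead_apply, conj_apply]
  congr 2
  ext i
  induction i using Fin.cases <;> simp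

theorem conj_smul {n : ℕ} (g : A) (φ : Cochain K A n) : conj σ (g • φ) = σ g • conj σ φ := by
  ext x
  simp [conj_apply]

/-- For `φ` and `f` homogeneous, `(-1)^{|φ||f|} f φ`. -/
def koszulMul {n : ℕ} (f : A) (φ : Cochain K A n) : Cochain K A n :=
  evenPart σ f • φ + oddPart σ f • conj σ φ

theorem evalHead_leftFace {n : ℕ} (a : A) (φ : Cochain K A n) :
    evalHead a (leftFace σ n φ) = koszulMul σ a φ := by
  ext x
  simp [leftFace, koszulMul]

variable {σ}

theorem evenPart_add_oddPart [CharZero K] (a : A) : evenPart σ a + oddPart σ a = a := by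
  simp only [evenPart, oddPart, LinearMap.smul_apply, LinearMap.add_apply, LinearMap.sub_apply,
    LinearMap.id_apply, AlgHom.toLinearMap_apply, ← smul_add]
  rw [show a + σ a + (a - σ a) = (2 : K) • a by rw [two_smul]; abel, smul_smul]
  simp

theorem evenPart_one [CharZero K] : evenPart σ 1 = 1 := by
  simp only [evenPart, LinearMap.smul_apply, LinearMap.add_apply,
    LinearMap.id_apply, AlgHom.toLinearMap_apply, map_one]
  rw [← two_smul K (1 : A), smul_smul]
  simp

theorem oddPart_one : oddPart σ 1 = 0 := by
  simp [oddPart]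

theorem koszulMul_one [CharZero K] {n : ℕ} (φ : Cochain K A n) : koszulMul σ 1 φ = φ := by
  simp [koszulMul, evenPart_one, oddPart_one]

theorem evalHead_one_leftFace [CharZero K] {n : ℕ} (φ : Cochain K A n) :
    evalHead 1 (leftFace σ n φ) = φ := by
  rw [evalHead_leftFace, koszulMul_one]

theorem map_eq_evenPart_sub_oddPart [CharZero K] (a : A) :
    σ a = evenPart σ a - oddPart σ a := by
  simp only [evenPart, oddPart, LinearMap.smul_apply, LinearMap.add_apply, LinearMap.sub_apply,
    LinearMap.id_apply, AlgHom.toLinearMap_apply, ← smul_sub]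
  rw [show a + σ a - (a - σ a) = (2 : K) • σ a by rw [two_smul]; abel, smul_smul]
  simp

theorem evenPart_mul [CharZero K] (a b : A) :
    evenPart σ (a * b) = evenPart σ a * evenPart σ b + oddPart σ a * oddPart σ b := by
  have h : evenPart σ (a * b) = (2 : K)⁻¹ • (a * b + σ a * σ b) := by simp [evenPart]
  have ha := evenPart_add_oddPart (σ := σ) a
  have hb := evenPart_add_oddPart (σ := σ) b
  rw [h, map_eq_evenPart_sub_oddPart a, map_eq_evenPart_sub_oddPart b,
    inv_smul_eq_iff₀ two_ne_zero, two_smul]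
  generalize evenPart σ a = e at *
  generalize oddPart σ a = o at *
  generalize evenPart σ b = e' at *
  generalize oddPart σ b = o' at *
  subst ha hb
  noncomm_ring

theorem oddPart_mul [CharZero K] (a b : A) :
    oddPart σ (a * b) = evenPart σ a * oddPart σ b + oddPart σ a * evenPart σ b := by
  have h : oddPart σ (a * b) = (2 : K)⁻¹ • (a * b - σ a * σ b) := by simp [oddPart]
  have ha := evenPart_add_oddPart (σ := σ) a
  have hb := evenPart_add_oddPart (σ := σ) b
  rw [h, map_eq_evenPart_sub_oddPart a, map_eq_evenPart_sub_oddPart b,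
    inv_smul_eq_iff₀ two_ne_zero, two_smul]
  generalize evenPart σ a = e at *
  generalize oddPart σ a = o at *
  generalize evenPart σ b = e' at *
  generalize oddPart σ b = o' at *
  subst ha hb
  noncomm_ring

variable (hσ : ∀ a, σ (σ a) = a)
include hσ

theorem conj_conj {n : ℕ} (φ : Cochain K A n) : conj σ (conj σ φ) = φ := by
  ext x
  simp [conj_apply, hσ]

theorem evenPart_apply_map (a : A) : evenPart σ (σ a) = evenPart σ a := by
  simp [evenPart, hσ, add_comm]

theorem oddPart_apply_map (a : A) : oddPart σ (σ a) = -oddPart σ a := by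
  simp [oddPart, hσ, ← smul_neg]

theorem map_evenPart (a : A) : σ (evenPart σ a) = evenPart σ a := by
  simp [evenPart, hσ, add_comm]

theorem map_oddPart (a : A) : σ (oddPart σ a) = -oddPart σ a := by
  simp [oddPart, hσ, ← smul_neg]

theorem conj_koszulMul_map {n : ℕ} (f : A) (φ : Cochain K A n) :
    conj σ (koszulMul σ (σ f) φ) = koszulMul σ f (conj σ φ) := by
  simp only [koszulMul, map_add, conj_smul, evenPart_apply_map hσ, oddPart_apply_map hσ,
    map_neg, map_evenPart hσ, map_oddPart hσ, neg_neg]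

theorem barD_conj (n : ℕ) (φ : Cochain K A n) : barD n (conj σ φ) = conj σ (barD n φ) := by
  induction n with
  | zero =>
    ext x
    have : (fun i => σ ((![] : Fin 0 → A) i)) = ![] := Subsingleton.elim _ _
    simp [barD_zero_apply, conj_apply, this, hσ]
  | succ n ih =>
    apply cochain_ext
    intro a
    rw [evalHead_barD, evalHead_conj, evalHead_conj, ih, evalHead_barD, map_sub, map_neg]
    congr 2
    apply cochain_ext
    intro b
    simp [evalHead_conj]

theorem barD_koszulMul (n : ℕ) (f : A) (φ : Cochain K A n) :
    barD n (koszulMul σ f φ) = koszulMul σ f (barD n φ) := by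
  simp only [koszulMul, map_add, barD_smul, barD_conj hσ]

/-- `(-1)^{|φ||fg|} fg φ` expressed through `(-1)^{|φ||g|} g φ`. -/
theorem koszulMul_mul [CharZero K] {n : ℕ} (f g : A) (φ : Cochain K A n) :
    koszulMul σ (f * g) φ =
      evenPart σ f • koszulMul σ g φ + oddPart σ f • koszulMul σ g (conj σ φ) := by
  simp only [koszulMul, evenPart_mul, oddPart_mul, conj_conj hσ, smul_add, smul_smul,
    add_smul]
  abel

/-- By associativity, multiplying the first two arguments of `leftFace φ` amounts to two successive
left faces. The remaining faces commute with left multiplication. -/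
theorem barD_leftFace [CharZero K] (n : ℕ) (φ : Cochain K A n) :
    barD (n + 1) (leftFace σ n φ) =
      -leftFace σ (n + 1) (leftFace σ n φ) - leftFace σ (n + 1) (barD n φ) := by
  apply cochain_ext
  intro a
  rw [evalHead_barD, map_sub, map_neg]
  simp only [evalHead_leftFace, barD_koszulMul hσ]
  congr 2
  apply cochain_ext
  intro b
  rw [evalHead_preHead, evalHead_leftFace, LinearMap.mulLeft_apply, koszulMul_mul hσ]
  rw [koszulMul.eq_1 σ a, map_add, evalHead_smul_apply, evalHead_smul_apply, evalHead_leftFace,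
    evalHead_conj, evalHead_leftFace, conj_koszulMul_map hσ]

/-- The iterated left faces cancel, so on left faces the Hochschild differential is `-barD`, to
which the contraction applies. -/
theorem hochschildD_leftFace [CharZero K] (n : ℕ) (φ : Cochain K A n) :
    hochschildD σ (n + 1) (leftFace σ n φ) = -leftFace σ (n + 1) (barD n φ) := by
  rw [hochschildD_eq, LinearMap.add_apply, barD_leftFace hσ]
  abel

theorem hochschildD_hochschildD [CharZero K] (n : ℕ) :
    hochschildD (K := K) σ (n + 1) ∘ₗ hochschildD σ n = 0 := by
  ext1 φ
  rw [LinearMap.comp_apply, hochschildD_eq σ n, LinearMap.add_apply, map_add,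
    hochschildD_leftFace hσ, hochschildD_eq, LinearMap.add_apply, barD_barD]
  simp

end Bar

/-! ### Signs -/

section Signs

variable {K : Type*} [Field K]

theorem neg_one_zpow_mul_self (n : ℤ) : (-1 : K) ^ n * (-1) ^ n = 1 := by
  rw [← mul_zpow]; simp

theorem neg_one_zpow_neg (n : ℤ) : (-1 : K) ^ (-n) = (-1) ^ n := by
  rw [zpow_neg, ← inv_zpow, inv_neg, inv_one]

end Signs

/-! ### Homogeneous bases and their duals -/

section Basis

variable {K V : Type*} [Field K] [AddCommGroup V] [Module K V] (𝒱 : ℤ → Submodule K V)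
  [DirectSum.Decomposition 𝒱]

theorem exists_homogeneous_basis [FiniteDimensional K V] :
    ∃ (n : ℕ) (b : Module.Basis (Fin n) K V) (d : Fin n → ℤ), ∀ i, b i ∈ 𝒱 (d i) := by
  have hI : DirectSum.IsInternal 𝒱 := DirectSum.Decomposition.isInternal 𝒱
  let b := hI.collectedBasis fun n => Module.Basis.ofVectorSpace K (𝒱 n)
  have := Module.Finite.finite_basis b
  have := Fintype.ofFinite (Σ n : ℤ, Module.Basis.ofVectorSpaceIndex K (𝒱 n))
  let e := Fintype.equivFin (Σ n : ℤ, Module.Basis.ofVectorSpaceIndex K (𝒱 n))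
  refine ⟨_, b.reindex e, fun i => (e.symm i).1, fun i => ?_⟩
  rw [Module.Basis.reindex_apply]
  exact hI.collectedBasis_mem _ _

variable {𝒱}
variable {ι : Type*} (b : Module.Basis ι K V) {d : ι → ℤ} (hb : ∀ i, b i ∈ 𝒱 (d i))

include hb in
theorem coord_mem_dualGrading (i : ι) : b.coord i ∈ dualGrading 𝒱 (-d i) := by
  classical
  intro j hj v hv
  rw [neg_neg] at hj
  -- The projection onto `V^j`. Followed by the `i`-th coordinate it vanishes on the basis because
  -- `j ≠ d i`, and it fixes `v`.
  let π : V →ₗ[K] V := (𝒱 j).subtype ∘ₗ DirectSum.component K ℤ (fun n => 𝒱 n) j ∘ₗ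
    (DirectSum.decomposeLinearEquiv 𝒱).toLinearMap
  have hπ : ∀ v, π v = DirectSum.decompose 𝒱 v j := fun v => rfl
  have h : b.coord i ∘ₗ π = 0 := by
    apply b.ext
    intro l
    rw [LinearMap.comp_apply, hπ, LinearMap.zero_apply]
    by_cases hl : d l = j
    · rw [DirectSum.decompose_of_mem_same 𝒱 (hl ▸ hb l), Module.Basis.coord_apply,
        Module.Basis.repr_self, Finsupp.single_eq_of_ne]
      rintro rfl
      exact hj hl.symm
    · rw [DirectSum.decompose_of_mem_ne 𝒱 (hb l) hl, map_zero]
  have := congrArg (fun L => L v) h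
  rwa [LinearMap.comp_apply, hπ, DirectSum.decompose_of_mem_same 𝒱 hv] at this

variable (𝒱) in
-- Finite dimension enters here: each functional is a finite combination of homogeneous dual basis
-- vectors. Hence `𝒪_V` is generated by homogeneous coordinates, and identities between (twisted)
-- derivations or automorphisms can be checked on these.
theorem iSup_dualGrading [FiniteDimensional K V] : ⨆ n, dualGrading 𝒱 n = ⊤ := by
  obtain ⟨n, b, d, hb⟩ := exists_homogeneous_basis 𝒱
  rw [eq_top_iff]
  intro x _
  have : x = ∑ i, x (b i) • b.coord i := by
    apply b.ext
    intro l
    simp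
  rw [this]
  exact Submodule.sum_mem _ fun i _ => Submodule.smul_mem _ _
    (Submodule.mem_iSup_of_mem _ (coord_mem_dualGrading b hb i))

end Basis

/-! ### Graded commutativity of polynomial functions and calculus of partial derivatives -/

section Poly

variable {K V : Type*} [Field K] [AddCommGroup V] [Module K V] (𝒱 : ℤ → Submodule K V)
variable [FiniteDimensional K V] [DirectSum.Decomposition 𝒱]

variable {𝒱} in
theorem mem_of_coord_mem (S : Subalgebra K (Poly 𝒱))
    (h : ∀ n, ∀ x ∈ dualGrading 𝒱 n, coord 𝒱 x ∈ S) (f : Poly 𝒱) : f ∈ S := by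
  refine KoszulAlgebra.mem_of_ι_mem S (fun x => ?_) f
  have hx : x ∈ ⨆ n, dualGrading 𝒱 n := by rw [iSup_dualGrading]; trivial
  induction hx using Submodule.iSup_induction' with
  | mem n x hx => exact h n x hx
  | zero => rw [map_zero]; exact S.zero_mem
  | add x y _ _ hx hy => rw [map_add]; exact S.add_mem hx hy

variable {𝒱} in
theorem poly_hom_ext {A : Type*} [Ring A] [Algebra K A] {f g : Poly 𝒱 →ₐ[K] A}
    (h : ∀ n, ∀ x ∈ dualGrading 𝒱 n, f (coord 𝒱 x) = g (coord 𝒱 x)) : f = g := by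
  ext a
  exact mem_of_coord_mem (AlgHom.equalizer f g) h a

theorem polySign_polySign (p q : ℤ) (f : Poly 𝒱) :
    polySign 𝒱 p (polySign 𝒱 q f) = polySign 𝒱 (p + q) f := by
  have : (polySign 𝒱 p).comp (polySign 𝒱 q) = polySign 𝒱 (p + q) := by
    apply poly_hom_ext
    intro n x hx
    rw [AlgHom.comp_apply, polySign_coord 𝒱 q hx, map_smul, polySign_coord 𝒱 p hx,
      polySign_coord 𝒱 _ hx, smul_smul, add_mul, zpow_add₀ (by simp), mul_comm]
  exact congrArg (fun φ => φ f) this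

theorem polySign_of_even {p : ℤ} (hp : Even p) (f : Poly 𝒱) : polySign 𝒱 p f = f := by
  have : polySign 𝒱 p = AlgHom.id K _ := by
    apply poly_hom_ext
    intro n x hx
    rw [polySign_coord 𝒱 p hx, Even.neg_one_zpow (hp.mul_right n), one_smul, AlgHom.id_apply]
  exact congrArg (fun φ => φ f) this

theorem polySign_of_odd {p : ℤ} (hp : Odd p) (f : Poly 𝒱) :
    polySign 𝒱 p f = polySign 𝒱 1 f := by
  obtain ⟨m, rfl⟩ := hp
  rw [← polySign_polySign, polySign_of_even 𝒱 (even_two_mul m)]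

theorem polySign_one_polySign_one (f : Poly 𝒱) : polySign 𝒱 1 (polySign 𝒱 1 f) = f := by
  rw [polySign_polySign, polySign_of_even 𝒱 (by decide)]

theorem polySign_comm (p q : ℤ) (f : Poly 𝒱) :
    polySign 𝒱 p (polySign 𝒱 q f) = polySign 𝒱 q (polySign 𝒱 p f) := by
  rw [polySign_polySign, polySign_polySign, add_comm]

theorem coord_mul_polySign {n : ℤ} {x : Module.Dual K V} (hx : x ∈ dualGrading 𝒱 n)
    (f : Poly 𝒱) : coord 𝒱 x * polySign 𝒱 n f = f * coord 𝒱 x := by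
  let S : Subalgebra K (Poly 𝒱) :=
    { carrier := {f | coord 𝒱 x * polySign 𝒱 n f = f * coord 𝒱 x}
      mul_mem' := by
        intro f g (hf : _ = _) (hg : _ = _)
        change _ = _
        rw [map_mul, ← mul_assoc, hf, mul_assoc, hg, mul_assoc]
      add_mem' := by
        intro f g (hf : _ = _) (hg : _ = _)
        change _ = _
        rw [map_add, mul_add, hf, hg, add_mul]
      algebraMap_mem' := by
        intro c
        change _ = _
        rw [AlgHom.commutes, Algebra.commutes] }
  refine mem_of_coord_mem S (fun m y hy => ?_) f
  change _ = _
  rw [polySign_coord 𝒱 n hy, KoszulAlgebra.ι_mul_ι 1 (dualGrading 𝒱) hy hx, one_mul, mul_comm,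
    mul_smul_comm]

variable [CharZero K]

section Parity

variable {A : Type*} [Ring A] [Algebra K A] {σ : A →ₐ[K] A}

theorem parts_of_even {n : ℤ} (hn : Even n) {a : A} (ha : σ a = (-1 : K) ^ n • a) :
    evenPart σ a = a ∧ oddPart σ a = 0 := by
  have h1 := evenPart_add_oddPart (σ := σ) a
  have h2 := map_eq_evenPart_sub_oddPart (σ := σ) a
  rw [hn.neg_one_zpow, one_smul] at ha
  have h3 : oddPart σ a = 0 := by simp [oddPart, ha]
  exact ⟨by rw [h3, add_zero] at h1; exact h1, h3⟩

theorem parts_of_odd {n : ℤ} (hn : Odd n) {a : A} (ha : σ a = (-1 : K) ^ n • a) :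
    evenPart σ a = 0 ∧ oddPart σ a = a := by
  have h1 := evenPart_add_oddPart (σ := σ) a
  rw [hn.neg_one_zpow, neg_smul, one_smul] at ha
  have h3 : evenPart σ a = 0 := by simp [evenPart, ha]
  exact ⟨h3, by rw [h3, zero_add] at h1; exact h1⟩

end Parity

omit [FiniteDimensional K V] [CharZero K] in
theorem polySign_one_coord {n : ℤ} {x : Module.Dual K V} (hx : x ∈ dualGrading 𝒱 n) :
    polySign 𝒱 1 (coord 𝒱 x) = (-1 : K) ^ n • coord 𝒱 x := by
  rw [polySign_coord 𝒱 1 hx, one_mul]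

/-- Graded commutativity of `𝒪_V`. -/
theorem parts_comm (a g : Poly 𝒱) :
    evenPart (polySign 𝒱 1) a * g = g * evenPart (polySign 𝒱 1) a ∧
      oddPart (polySign 𝒱 1) a * polySign 𝒱 1 g = g * oddPart (polySign 𝒱 1) a := by
  let S : Subalgebra K (Poly 𝒱) :=
    { carrier := {a | ∀ g, evenPart (polySign 𝒱 1) a * g = g * evenPart (polySign 𝒱 1) a ∧
        oddPart (polySign 𝒱 1) a * polySign 𝒱 1 g = g * oddPart (polySign 𝒱 1) a}
      mul_mem' := by
        intro a b ha hb g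
        have hb' : oddPart (polySign 𝒱 1) b * g = polySign 𝒱 1 g * oddPart (polySign 𝒱 1) b := by
          rw [← (hb _).2, polySign_one_polySign_one]
        rw [evenPart_mul, oddPart_mul]
        constructor
        · rw [add_mul, mul_add, mul_assoc, (hb g).1, ← mul_assoc, (ha g).1, mul_assoc, mul_assoc,
            hb', ← mul_assoc _ (polySign 𝒱 1 g), (ha g).2, mul_assoc]
        · rw [add_mul, mul_add, mul_assoc, (hb g).2, ← mul_assoc, (ha g).1, mul_assoc, mul_assoc,
            (hb _).1, ← mul_assoc _ (polySign 𝒱 1 g), (ha g).2, mul_assoc]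
      add_mem' := by
        intro a b ha hb g
        rw [map_add, map_add, add_mul, mul_add, (ha g).1, (hb g).1, add_mul, mul_add, (ha g).2,
          (hb g).2]
        exact ⟨rfl, rfl⟩
      algebraMap_mem' := by
        intro c g
        have h : polySign 𝒱 1 (algebraMap K _ c) = (-1 : K) ^ (0 : ℤ) • algebraMap K _ c := by
          simp
        rw [(parts_of_even Even.zero h).1, (parts_of_even Even.zero h).2, Algebra.commutes]
        simp }
  refine mem_of_coord_mem S (fun n x hx g => ?_) a g
  have h := polySign_one_coord 𝒱 hx
  have hc := coord_mul_polySign 𝒱 hx g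
  rcases Int.even_or_odd n with hn | hn
  · rw [(parts_of_even hn h).1, (parts_of_even hn h).2]
    rw [polySign_of_even 𝒱 hn] at hc
    simp [hc]
  · rw [(parts_of_odd hn h).1, (parts_of_odd hn h).2]
    rw [polySign_of_odd 𝒱 hn] at hc
    simp [hc]

omit [CharZero K]

omit [FiniteDimensional K V] in
theorem partialDeriv_algebraMap (p : ℤ) (v : 𝒱 p) (c : K) :
    partialDeriv 𝒱 p v (algebraMap K _ c) = 0 := by
  simp [partialDeriv, Matrix.algebraMap_matrix_apply]

omit [FiniteDimensional K V] in
theorem partialDeriv_one (p : ℤ) (v : 𝒱 p) : partialDeriv 𝒱 p v 1 = 0 := by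
  rw [← map_one (algebraMap K (Poly 𝒱)), partialDeriv_algebraMap]

theorem partialDeriv_polySign (p : ℤ) (v : 𝒱 p) (q : ℤ) (f : Poly 𝒱) :
    partialDeriv 𝒱 p v (polySign 𝒱 q f) =
      (-1 : K) ^ (q * p) • polySign 𝒱 q (partialDeriv 𝒱 p v f) := by
  let S : Subalgebra K (Poly 𝒱) :=
    { carrier := {f | partialDeriv 𝒱 p v (polySign 𝒱 q f) =
        (-1 : K) ^ (q * p) • polySign 𝒱 q (partialDeriv 𝒱 p v f)}
      mul_mem' := by
        intro f g (hf : _ = _) (hg : _ = _)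
        change _ = _
        rw [map_mul, partialDeriv_mul, partialDeriv_mul, hf, hg, map_add, map_mul, map_mul,
          smul_add, polySign_comm, smul_mul_assoc, mul_smul_comm]
      add_mem' := by
        intro f g (hf : _ = _) (hg : _ = _)
        change _ = _
        rw [map_add, map_add, map_add, map_add, hf, hg, smul_add]
      algebraMap_mem' := by
        intro c
        change _ = _
        rw [AlgHom.commutes, partialDeriv_algebraMap, map_zero, smul_zero] }
  refine mem_of_coord_mem S (fun n x hx => ?_) f
  change _ = _
  rw [polySign_coord 𝒱 q hx, map_smul, partialDeriv_coord, AlgHom.commutes]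
  -- The constant `x(v)` vanishes unless `x` has degree `-p`, in which case the two signs agree.
  by_cases h : p = -n
  · rw [show (-1 : K) ^ (q * n) = (-1) ^ (q * p) by rw [h, mul_neg, neg_one_zpow_neg]]
  · rw [hx p h v v.2, map_zero, smul_zero, smul_zero]

/-- The graded commutator of two graded derivations is a graded derivation, and it vanishes on
coordinates, whose derivatives are constants. -/
theorem partialDeriv_comm {p q : ℤ} (v : 𝒱 p) (u : 𝒱 q) (f : Poly 𝒱) :
    partialDeriv 𝒱 p v (partialDeriv 𝒱 q u f) =
      (-1 : K) ^ (p * q) • partialDeriv 𝒱 q u (partialDeriv 𝒱 p v f) := by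
  let S : Subalgebra K (Poly 𝒱) :=
    { carrier := {f | partialDeriv 𝒱 p v (partialDeriv 𝒱 q u f) =
      (-1 : K) ^ (p * q) • partialDeriv 𝒱 q u (partialDeriv 𝒱 p v f)}
      mul_mem' := by
        intro f g (hf : _ = _) (hg : _ = _)
        change _ = _
        rw [partialDeriv_mul, partialDeriv_mul, map_add, map_add, partialDeriv_mul,
          partialDeriv_mul, partialDeriv_mul, partialDeriv_mul, partialDeriv_polySign,
          partialDeriv_polySign, hf, hg, polySign_comm 𝒱 q p]
        simp only [smul_add, smul_mul_assoc, mul_smul_comm, smul_smul, mul_comm q p,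
          neg_one_zpow_mul_self, one_smul]
        abel
      add_mem' := by
        intro f g (hf : _ = _) (hg : _ = _)
        change _ = _
        rw [map_add, map_add, map_add, map_add, hf, hg, smul_add]
      algebraMap_mem' := by
        intro c
        change _ = _
        rw [partialDeriv_algebraMap, partialDeriv_algebraMap, map_zero, map_zero, smul_zero] }
  refine mem_of_coord_mem S (fun n x hx => ?_) f
  change _ = _
  simp only [partialDeriv_coord, partialDeriv_algebraMap, smul_zero]

theorem sum_smul_partialDeriv {ι : Type*} [Fintype ι] (b : Module.Basis ι K V) {d : ι → ℤ}
    (hb : ∀ i, b i ∈ 𝒱 (d i)) {p : ℤ} (v : 𝒱 p) (f : Poly 𝒱) :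
    ∑ i, b.coord i v • partialDeriv 𝒱 (d i) ⟨b i, hb i⟩ f = partialDeriv 𝒱 p v f := by
  let S : Subalgebra K (Poly 𝒱) :=
    { carrier := {f | ∑ i, b.coord i v • partialDeriv 𝒱 (d i) ⟨b i, hb i⟩ f =
        partialDeriv 𝒱 p v f}
      mul_mem' := by
        intro f g (hf : _ = _) (hg : _ = _)
        change _ = _
        rw [partialDeriv_mul, ← hf, ← hg, Finset.sum_mul, Finset.mul_sum,
          ← Finset.sum_add_distrib]
        refine Finset.sum_congr rfl fun i _ => ?_
        rw [partialDeriv_mul, smul_add, smul_mul_assoc, mul_smul_comm]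
        -- The sign twist in the Leibniz rule depends on `d i`, but basis vectors of degree other
        -- than `p` have coefficient zero in `v`.
        by_cases h : p = d i
        · rw [show polySign 𝒱 (d i) f = polySign 𝒱 p f by rw [h]]
        · rw [coord_mem_dualGrading b hb i p (by rwa [neg_neg]) v v.2, zero_smul, zero_smul,
            zero_smul]
      add_mem' := by
        intro f g (hf : _ = _) (hg : _ = _)
        change _ = _
        simp only [map_add, smul_add, Finset.sum_add_distrib, hf, hg]
      algebraMap_mem' := by
        intro c
        change _ = _
        simp [partialDeriv_algebraMap] }
  refine mem_of_coord_mem S (fun n x hx => ?_) f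
  change _ = _
  simp only [partialDeriv_coord]
  conv_rhs => rw [← b.sum_repr (v : V), map_sum]
  simp [Algebra.smul_def]

end Poly

/-! ### Contractions of the graded exterior algebra -/

section Contraction

variable {K V : Type*} [Field K] [AddCommGroup V] [Module K V] (𝒱 : ℤ → Submodule K V)

/-- A vector, as an element of the graded exterior algebra. -/
abbrev extι : V →ₗ[K] Ext 𝒱 := KoszulAlgebra.ι (-1 : K) 𝒱

variable [DirectSum.Decomposition 𝒱]

/-- The algebra automorphism `v ↦ -(-1)^{pq} v`, `v ∈ V^q`, of the graded exterior algebra. -/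
def extSign (p : ℤ) : Ext 𝒱 →ₐ[K] Ext 𝒱 :=
  KoszulAlgebra.lift (-(extι 𝒱 ∘ₗ signMap 𝒱 p)) (by
    intro m n x hx y hy
    simp only [LinearMap.neg_apply, LinearMap.comp_apply, signMap_apply 𝒱 p hx,
      signMap_apply 𝒱 p hy, map_smul, neg_mul_neg, smul_mul_smul_comm]
    rw [KoszulAlgebra.ι_mul_ι _ _ hx hy, smul_comm, mul_comm ((-1 : K) ^ (p * m))])

theorem extSign_ι (p : ℤ) {q : ℤ} {v : V} (hv : v ∈ 𝒱 q) :
    extSign 𝒱 p (extι 𝒱 v) = -((-1 : K) ^ (p * q) • extι 𝒱 v) := by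
  rw [extSign, KoszulAlgebra.lift_ι, LinearMap.neg_apply, LinearMap.comp_apply,
    signMap_apply 𝒱 p hv, map_smul]

/-- The algebra map that encodes the contraction of the graded exterior algebra with a functional
of degree `p`. -/
def contractMatrix (p : ℤ) (x : dualGrading 𝒱 p) :
    Ext 𝒱 →ₐ[K] Matrix (Fin 2) (Fin 2) (Ext 𝒱) :=
  KoszulAlgebra.lift
    { toFun := fun v => !![extSign 𝒱 p (extι 𝒱 v), algebraMap K _ (x.1 v); 0, extι 𝒱 v]
      map_add' := by
        intro x y
        ext i j
        fin_cases i <;> fin_cases j <;> simp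
      map_smul' := by
        intro c x
        ext i j
        fin_cases i <;> fin_cases j <;> simp [Algebra.smul_def] } (by
    intro m n v hv w hw
    -- A vector `u` with `x(u) ≠ 0` has degree `-p`, so `p` may replace its degree in signs.
    have key : ∀ {q : ℤ} {u : V}, u ∈ 𝒱 q → ∀ l : ℤ, (-1 : K) ^ (q * l) * x.1 u =
        (-1 : K) ^ (p * l) * x.1 u := by
      intro q u hu l
      by_cases h : q = -p
      · rw [h, neg_mul, neg_one_zpow_neg]
      · rw [x.2 q h u hu, mul_zero, mul_zero]
    have hvw := KoszulAlgebra.ι_mul_ι (-1 : K) 𝒱 hv hw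
    ext i j
    fin_cases i <;> fin_cases j
    · simp only [LinearMap.coe_mk, AddHom.coe_mk, extSign_ι 𝒱 p hv, extSign_ι 𝒱 p hw]
      simp [hvw, smul_smul]
      ring_nf
    · simp only [LinearMap.coe_mk, AddHom.coe_mk, extSign_ι 𝒱 p hv, extSign_ι 𝒱 p hw]
      simp only [Fin.zero_eta, Fin.isValue, Fin.mk_one, Matrix.mul_apply, Fin.sum_univ_two,
        Matrix.of_apply, Matrix.cons_val', Matrix.cons_val_zero, Matrix.cons_val_fin_one,
        Matrix.cons_val_one, Matrix.smul_apply, smul_add, ← Algebra.commutes,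
        ← Algebra.smul_def, smul_smul, smul_neg, neg_one_mul]
      rw [add_comm]
      have e1 : -(-1 : K) ^ (m * n) * (x.1 v * (-1) ^ (p * n)) = -x.1 v := by
        rw [mul_comm (x.1 v), ← key hv n, neg_mul, ← mul_assoc, neg_one_zpow_mul_self, one_mul]
      have e2 : x.1 w * (-1 : K) ^ (p * m) = (-1) ^ (m * n) * x.1 w := by
        rw [mul_comm (x.1 w), ← key hw m, mul_comm n m]
      rw [e1, e2, neg_smul, neg_neg, neg_mul, neg_smul]
    · simp
    · simp [hvw])

/-- The contraction of the graded exterior algebra with a homogeneous functional. -/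
def contract (p : ℤ) (x : dualGrading 𝒱 p) : Ext 𝒱 →ₗ[K] Ext 𝒱 :=
  Matrix.entryLinearMap K (Ext 𝒱) 0 1 ∘ₗ (contractMatrix 𝒱 p x).toLinearMap

theorem contractMatrix_entries (p : ℤ) (x : dualGrading 𝒱 p) (f : Ext 𝒱) :
    contractMatrix 𝒱 p x f 1 0 = 0 ∧ contractMatrix 𝒱 p x f 1 1 = f := by
  let S : Subalgebra K (Ext 𝒱) :=
    { carrier := {f | contractMatrix 𝒱 p x f 1 0 = 0 ∧ contractMatrix 𝒱 p x f 1 1 = f}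
      mul_mem' := by
        rintro f g ⟨h2, h3⟩ ⟨h5, h6⟩
        simp [Matrix.mul_apply, Fin.sum_univ_two, h2, h3, h5, h6]
      add_mem' := by
        rintro f g ⟨h2, h3⟩ ⟨h5, h6⟩
        simp [h2, h3, h5, h6]
      algebraMap_mem' := by
        intro c
        simp [Matrix.algebraMap_matrix_apply] }
  refine KoszulAlgebra.mem_of_ι_mem S (fun v => ?_) f
  change _ ∧ _
  simp [contractMatrix]

/-- The corner entry of a product of upper triangular matrices obeys a twisted Leibniz rule. -/
theorem contract_ι_mul (p : ℤ) (x : dualGrading 𝒱 p) (v : V) (ω : Ext 𝒱) :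
    contract 𝒱 p x (extι 𝒱 v * ω) = x.1 v • ω + extSign 𝒱 p (extι 𝒱 v) * contract 𝒱 p x ω := by
  have h := contractMatrix_entries 𝒱 p x ω
  have h1 : contractMatrix 𝒱 p x (extι 𝒱 v) =
      !![extSign 𝒱 p (extι 𝒱 v), algebraMap K _ (x.1 v); 0, extι 𝒱 v] :=
    KoszulAlgebra.lift_ι _ _ _
  simp only [contract, LinearMap.comp_apply, AlgHom.toLinearMap_apply, map_mul, h1,
    Matrix.entryLinearMap_apply, Matrix.mul_apply, Fin.sum_univ_two, h.2]
  simp [Algebra.smul_def, add_comm]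

theorem contract_ι_mul_of_mem (p : ℤ) (x : dualGrading 𝒱 p) {q : ℤ} {v : V} (hv : v ∈ 𝒱 q)
    (ω : Ext 𝒱) : contract 𝒱 p x (extι 𝒱 v * ω) =
      x.1 v • ω - (-1 : K) ^ (p * q) • (extι 𝒱 v * contract 𝒱 p x ω) := by
  rw [contract_ι_mul, extSign_ι 𝒱 p hv, neg_mul, smul_mul_assoc, sub_eq_add_neg]

theorem contract_one (p : ℤ) (x : dualGrading 𝒱 p) : contract 𝒱 p x 1 = 0 := by
  simp [contract]

omit [DirectSum.Decomposition 𝒱] in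
theorem extPower_induction {j : ℕ} {p : Ext 𝒱 → Prop} (hadd : ∀ a b, p a → p b → p (a + b))
    (hmul : ∀ v : V, ∀ ω ∈ ExtPower 𝒱 j, p (extι 𝒱 v * ω)) {ω : Ext 𝒱}
    (hω : ω ∈ ExtPower 𝒱 (j + 1)) : p ω := by
  rw [ExtPower, pow_succ'] at hω
  induction hω using Submodule.mul_induction_on' with
  | mem_mul_mem m hm n hn =>
    obtain ⟨v, rfl⟩ := hm
    exact hmul v n hn
  | add a _ b _ ha hb => exact hadd a b ha hb

omit [DirectSum.Decomposition 𝒱] in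
theorem ι_mul_mem_extPower {j : ℕ} (v : V) {ω : Ext 𝒱} (hω : ω ∈ ExtPower 𝒱 j) :
    extι 𝒱 v * ω ∈ ExtPower 𝒱 (j + 1) := by
  rw [ExtPower, pow_succ']
  exact Submodule.mul_mem_mul (LinearMap.mem_range_self _ _) hω

theorem contract_extPower_zero (p : ℤ) (x : dualGrading 𝒱 p) {ω : Ext 𝒱}
    (hω : ω ∈ ExtPower 𝒱 0) : contract 𝒱 p x ω = 0 := by
  rw [ExtPower, pow_zero, Submodule.mem_one] at hω
  obtain ⟨c, rfl⟩ := hω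
  rw [Algebra.algebraMap_eq_smul_one, map_smul, contract_one, smul_zero]

theorem contract_mem_extPower (p : ℤ) (x : dualGrading 𝒱 p) (j : ℕ) {ω : Ext 𝒱}
    (hω : ω ∈ ExtPower 𝒱 (j + 1)) : contract 𝒱 p x ω ∈ ExtPower 𝒱 j := by
  induction j generalizing ω with
  | zero =>
    refine extPower_induction 𝒱 (p := fun ω => contract 𝒱 p x ω ∈ ExtPower 𝒱 0)
      (fun a b ha hb => by rw [map_add]; exact add_mem ha hb) (fun v ω hω => ?_) hω
    rw [contract_ι_mul, contract_extPower_zero 𝒱 p x hω, mul_zero, add_zero]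
    exact Submodule.smul_mem _ _ hω
  | succ j ih =>
    refine extPower_induction 𝒱 (p := fun ω => contract 𝒱 p x ω ∈ ExtPower 𝒱 (j + 1))
      (fun a b ha hb => by rw [map_add]; exact add_mem ha hb) (fun v ω hω => ?_) hω
    rw [contract_ι_mul]
    refine add_mem (Submodule.smul_mem _ _ hω) ?_
    rw [extSign, KoszulAlgebra.lift_ι, LinearMap.neg_apply, LinearMap.comp_apply, ← map_neg]
    exact ι_mul_mem_extPower 𝒱 _ (ih hω)

variable {ι : Type*} [Fintype ι] (b : Module.Basis ι K V) {d : ι → ℤ} (hb : ∀ i, b i ∈ 𝒱 (d i))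

/-- The dual basis, with the degrees of its members. -/
def dualCoord (i : ι) : dualGrading 𝒱 (-d i) := ⟨b.coord i, coord_mem_dualGrading b hb i⟩

/-- The Euler operator of the graded exterior algebra is a derivation. -/
theorem sum_contract_ι_mul (v : V) (ω : Ext 𝒱) :
    ∑ i, extι 𝒱 (b i) * contract 𝒱 _ (dualCoord 𝒱 b hb i) (extι 𝒱 v * ω) =
      extι 𝒱 v * ω + extι 𝒱 v * ∑ i, extι 𝒱 (b i) * contract 𝒱 _ (dualCoord 𝒱 b hb i) ω := by
  induction v using DirectSum.Decomposition.inductionOn 𝒱 with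
  | zero => simp
  | add v w hv hw =>
    simp only [map_add, add_mul, mul_add, Finset.sum_add_distrib] at hv hw ⊢
    rw [hv, hw]
    abel
  | @homogeneous q v =>
    have h1 : ∀ i, extι 𝒱 (b i) * contract 𝒱 _ (dualCoord 𝒱 b hb i) (extι 𝒱 (v : V) * ω) =
        (extι 𝒱 (b.repr v i • b i)) * ω +
          extι 𝒱 (v : V) * (extι 𝒱 (b i) * contract 𝒱 _ (dualCoord 𝒱 b hb i) ω) := by
      intro i
      rw [contract_ι_mul_of_mem 𝒱 _ _ v.2, mul_sub, mul_smul_comm, mul_smul_comm, ← mul_assoc,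
        KoszulAlgebra.ι_mul_ι (-1 : K) 𝒱 (hb i) v.2, map_smul, smul_mul_assoc, smul_mul_assoc,
        smul_smul, neg_mul, neg_one_zpow_neg, mul_left_comm, neg_one_zpow_mul_self, mul_one,
        neg_smul, one_smul, sub_neg_eq_add, mul_assoc]
      rfl
    rw [Finset.sum_congr rfl fun i _ => h1 i, Finset.sum_add_distrib, ← Finset.sum_mul, ← map_sum,
      b.sum_repr, Finset.mul_sum]

/-- Each vector multiplied on the left raises the eigenvalue of the Euler operator by one, by
`sum_contract_ι_mul`. -/
theorem sum_contract (j : ℕ) {ω : Ext 𝒱} (hω : ω ∈ ExtPower 𝒱 j) :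
    ∑ i, extι 𝒱 (b i) * contract 𝒱 _ (dualCoord 𝒱 b hb i) ω = (j : K) • ω := by
  induction j generalizing ω with
  | zero => simp [contract_extPower_zero 𝒱 _ _ hω]
  | succ j ih =>
    refine extPower_induction 𝒱 (p := fun ω => ∑ i, extι 𝒱 (b i) *
      contract 𝒱 _ (dualCoord 𝒱 b hb i) ω = ((j + 1 : ℕ) : K) • ω) (fun a b ha hb => ?_)
      (fun v ω hω => ?_) hω
    · simp only [map_add, mul_add, Finset.sum_add_distrib, ha, hb, smul_add]
    · rw [sum_contract_ι_mul, ih hω, mul_smul_comm, Nat.cast_succ, add_smul, one_smul, add_comm]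

omit [DirectSum.Decomposition 𝒱] in
theorem extι_mul_comm {m n : ℤ} {v w : V} (hv : v ∈ 𝒱 m) (hw : w ∈ 𝒱 n) :
    extι 𝒱 v * extι 𝒱 w = -((-1 : K) ^ (m * n) • (extι 𝒱 w * extι 𝒱 v)) := by
  rw [KoszulAlgebra.ι_mul_ι _ _ hv hw, neg_one_mul, neg_smul]

end Contraction

/-! ### Graded commutators with multiplication in the first argument -/

section GradedCommutator

variable {K V : Type*} [Field K] [AddCommGroup V] [Module K V] (𝒱 : ℤ → Submodule K V)
variable [DirectSum.Decomposition 𝒱]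

theorem preHead_smul_map {A : Type*} [Ring A] [Algebra K A] {n : ℕ} (c : K) (L : A →ₗ[K] A)
    (φ : Cochain K A (n + 1)) : preHead (c • L) φ = c • preHead L φ := by
  apply cochain_ext
  intro a
  rw [evalHead_preHead, LinearMap.smul_apply, evalHead_smul, map_smul, evalHead_preHead]

theorem preHead_preHead {A : Type*} [Ring A] [Algebra K A] {n : ℕ} (L M : A →ₗ[K] A)
    (φ : Cochain K A (n + 1)) : preHead L (preHead M φ) = preHead (M ∘ₗ L) φ := by
  apply cochain_ext
  intro a
  simp

theorem preHead_smul {A : Type*} [Ring A] [Algebra K A] {n : ℕ} (L : A →ₗ[K] A) (g : A)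
    (φ : Cochain K A (n + 1)) : preHead L (g • φ) = g • preHead L φ := by
  apply cochain_ext
  intro a
  simp

theorem cochain_smul_comm {A : Type*} [Ring A] [Algebra K A] {n : ℕ} (g : A) (c : K)
    (φ : Cochain K A n) : g • c • φ = c • g • φ := by
  ext x
  simp

theorem cochain_smul_assoc {A : Type*} [Ring A] [Algebra K A] {n : ℕ} (c : K) (g : A)
    (φ : Cochain K A n) : (c • g) • φ = c • g • φ := by
  ext x
  simp

theorem cochain_sub_smul {A : Type*} [Ring A] [Algebra K A] {n : ℕ} (f g : A)
    (φ : Cochain K A n) : (f - g) • φ = f • φ - g • φ := sub_smul f g φ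

theorem cochain_smul_sub {A : Type*} [Ring A] [Algebra K A] {n : ℕ} (c : K)
    (φ ψ : Cochain K A n) : c • (φ - ψ) = c • φ - c • ψ := smul_sub c φ ψ

theorem koszulMul_smul_left {A : Type*} [Ring A] [Algebra K A] (σ : A →ₐ[K] A) {n : ℕ} (c : K)
    (f : A) (φ : Cochain K A n) : koszulMul σ (c • f) φ = c • koszulMul σ f φ := by
  simp only [koszulMul, map_smul, cochain_smul_assoc, smul_add]

/-- The graded commutator `[φ, f]` of a cochain, as an operator in its first argument, with the
multiplication by `f`. -/
def commHead {n : ℕ} (f : Poly 𝒱) :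
    Cochain K (Poly 𝒱) (n + 1) →ₗ[K] Cochain K (Poly 𝒱) (n + 1) where
  toFun φ := preHead (LinearMap.mulLeft K f) φ - koszulMul (polySign 𝒱 1) f φ
  map_add' φ ψ := by
    simp only [koszulMul, map_add, smul_add]
    abel
  map_smul' c φ := by
    simp only [koszulMul, map_smul, smul_sub, smul_add, RingHom.id_apply, cochain_smul_comm]

theorem commHead_apply {n : ℕ} (f : Poly 𝒱) (φ : Cochain K (Poly 𝒱) (n + 1)) :
    commHead 𝒱 f φ = preHead (LinearMap.mulLeft K f) φ - koszulMul (polySign 𝒱 1) f φ := rfl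

variable [FiniteDimensional K V]

/-- `barD` multiplies the first argument and the value only from the right, while the commutator
multiplies both from the left. -/
theorem barD_commHead {n : ℕ} (f : Poly 𝒱) (φ : Cochain K (Poly 𝒱) (n + 1)) :
    barD (n + 1) (commHead 𝒱 f φ) = commHead 𝒱 f (barD (n + 1) φ) := by
  rw [commHead_apply, commHead_apply, map_sub, barD_koszulMul (polySign_one_polySign_one 𝒱),
    preHead_barD]

variable [CharZero K]

/-- Graded commutativity of `𝒪_V`, as a statement about multiplication operators on cochains. -/
theorem koszulMul_smul {n : ℕ} (f g : Poly 𝒱) (φ : Cochain K (Poly 𝒱) n) :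
    koszulMul (polySign 𝒱 1) f (g • φ) = g • koszulMul (polySign 𝒱 1) f φ := by
  have h := parts_comm 𝒱 f g
  rw [koszulMul, koszulMul, conj_smul, smul_smul, smul_smul, h.1, h.2, smul_add, smul_smul,
    smul_smul]

theorem commHead_smul {n : ℕ} (f g : Poly 𝒱) (φ : Cochain K (Poly 𝒱) (n + 1)) :
    commHead 𝒱 f (g • φ) = g • commHead 𝒱 f φ := by
  rw [commHead_apply, commHead_apply, koszulMul_smul, preHead_smul, smul_sub]

theorem koszulMul_apply_nil (f : Poly 𝒱) (φ : Cochain K (Poly 𝒱) 0) (x : Fin 0 → Poly 𝒱) :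
    koszulMul (polySign 𝒱 1) f φ x = φ x * f := by
  have h := parts_comm 𝒱 f (φ x)
  have hx : (fun i => polySign 𝒱 1 (x i)) = x := Subsingleton.elim _ _
  simp only [koszulMul, _root_.add_apply, _root_.smul_apply, conj_apply, hx, smul_eq_mul]
  rw [h.1, h.2, ← mul_add, evenPart_add_oddPart]

/-- In arity zero the left and right faces agree by graded commutativity. Discarding arity zero
therefore loses no coboundaries. -/
theorem dH_zero (φ : Cochain K (Poly 𝒱) 0) : dH 𝒱 0 φ = 0 := by
  apply cochain_ext
  intro a
  ext x
  rw [dH, hochschildD_eq, LinearMap.add_apply, map_add, evalHead_leftFace, _root_.add_apply,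
    koszulMul_apply_nil, evalHead_barD_zero, Subsingleton.elim x ![], add_neg_cancel, map_zero]
  rfl

theorem barD_zero_eq (φ : Cochain K (Poly 𝒱) 0) : barD 0 φ = -leftFace (polySign 𝒱 1) 0 φ := by
  have h := dH_zero 𝒱 φ
  rw [dH, hochschildD_eq, LinearMap.add_apply] at h
  exact eq_neg_of_add_eq_zero_right h

/-- A left face acts on its first argument by multiplication, which commutes in the graded sense
with multiplication by `f`. -/
theorem commHead_leftFace {n : ℕ} (f : Poly 𝒱) (φ : Cochain K (Poly 𝒱) n) :
    commHead 𝒱 f (leftFace (polySign 𝒱 1) n φ) = 0 := by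
  rw [commHead_apply, sub_eq_zero]
  apply cochain_ext
  intro b
  have hσ := polySign_one_polySign_one 𝒱
  rw [evalHead_preHead, evalHead_leftFace, LinearMap.mulLeft_apply, koszulMul_mul hσ,
    koszulMul.eq_1 (polySign 𝒱 1) f, map_add, evalHead_smul_apply, evalHead_smul_apply,
    evalHead_leftFace, evalHead_conj, evalHead_leftFace, conj_koszulMul_map hσ]

theorem commHead_barD_zero (f : Poly 𝒱) (φ : Cochain K (Poly 𝒱) 0) :
    commHead 𝒱 f (barD 0 φ) = 0 := by
  rw [barD_zero_eq, map_neg, commHead_leftFace, neg_zero]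

theorem koszulMul_koszulMul {n : ℕ} (f g : Poly 𝒱) (φ : Cochain K (Poly 𝒱) n) :
    koszulMul (polySign 𝒱 1) f (koszulMul (polySign 𝒱 1) g φ) =
      koszulMul (polySign 𝒱 1) (g * f) φ := by
  have hσ := polySign_one_polySign_one 𝒱
  conv_lhs => rw [koszulMul.eq_1 _ g, koszulMul]
  rw [map_add, conj_smul, conj_smul, conj_conj hσ, map_evenPart hσ, map_oddPart hσ, koszulMul,
    evenPart_mul, oddPart_mul]
  have h1 := (parts_comm 𝒱 f (evenPart (polySign 𝒱 1) g)).1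
  have h2 := (parts_comm 𝒱 f (oddPart (polySign 𝒱 1) g)).1
  have h3 := (parts_comm 𝒱 f (evenPart (polySign 𝒱 1) g)).2
  have h4 := (parts_comm 𝒱 f (oddPart (polySign 𝒱 1) g)).2
  rw [map_evenPart hσ] at h3
  rw [map_oddPart hσ] at h4
  simp only [smul_add, smul_smul, h1, h2, h3, h4, add_smul]
  abel

omit [FiniteDimensional K V] in
theorem koszulMul_coord_even {n : ℕ} {m : ℤ} (hm : Even m) {x : Module.Dual K V}
    (hx : x ∈ dualGrading 𝒱 m) (φ : Cochain K (Poly 𝒱) n) :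
    koszulMul (polySign 𝒱 1) (coord 𝒱 x) φ = coord 𝒱 x • φ := by
  have h := parts_of_even hm (polySign_one_coord 𝒱 hx)
  rw [koszulMul, h.1, h.2, zero_smul, add_zero]

omit [FiniteDimensional K V] in
theorem koszulMul_coord_odd {n : ℕ} {m : ℤ} (hm : Odd m) {x : Module.Dual K V}
    (hx : x ∈ dualGrading 𝒱 m) (φ : Cochain K (Poly 𝒱) n) :
    koszulMul (polySign 𝒱 1) (coord 𝒱 x) φ = coord 𝒱 x • conj (polySign 𝒱 1) φ := by
  have h := parts_of_odd hm (polySign_one_coord 𝒱 hx)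
  rw [koszulMul, h.1, h.2, zero_smul, zero_add]

omit [FiniteDimensional K V] [CharZero K] in
theorem preHead_conj {n : ℕ} (f : Poly 𝒱) (φ : Cochain K (Poly 𝒱) (n + 1)) :
    preHead (LinearMap.mulLeft K f) (conj (polySign 𝒱 1) φ) =
      conj (polySign 𝒱 1) (preHead (LinearMap.mulLeft K (polySign 𝒱 1 f)) φ) := by
  apply cochain_ext
  intro a
  simp [evalHead_conj]

omit [FiniteDimensional K V] in
-- For `y` odd, `koszulMul` conjugates by the parity automorphism; exchanging this conjugation with
-- multiplication by `x` costs `(-1)^m`.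
theorem preHead_koszulMul {n : ℕ} {m l : ℤ} {x y : Module.Dual K V} (hx : x ∈ dualGrading 𝒱 m)
    (hy : y ∈ dualGrading 𝒱 l) (φ : Cochain K (Poly 𝒱) (n + 1)) :
    preHead (LinearMap.mulLeft K (coord 𝒱 x)) (koszulMul (polySign 𝒱 1) (coord 𝒱 y) φ) =
      (-1 : K) ^ (m * l) •
        koszulMul (polySign 𝒱 1) (coord 𝒱 y) (preHead (LinearMap.mulLeft K (coord 𝒱 x)) φ) := by
  rcases Int.even_or_odd l with hl | hl
  · rw [koszulMul_coord_even 𝒱 hl hy, koszulMul_coord_even 𝒱 hl hy,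
      (hl.mul_left m).neg_one_zpow, one_smul, preHead_smul]
  · rw [koszulMul_coord_odd 𝒱 hl hy, koszulMul_coord_odd 𝒱 hl hy, preHead_smul, preHead_conj,
      polySign_one_coord 𝒱 hx]
    have : LinearMap.mulLeft K ((-1 : K) ^ m • coord 𝒱 x) =
        (-1 : K) ^ m • LinearMap.mulLeft K (coord 𝒱 x) := by
      ext; simp
    have h2 : (-1 : K) ^ (m * l) = (-1) ^ m := by
      rw [mul_comm, zpow_mul, hl.neg_one_zpow]
    rw [this, preHead_smul_map, map_smul, h2, cochain_smul_comm]

/-- The commutators inherit graded commutativity from the multiplications in `𝒪_V`. Paired with the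
graded anticommuting vectors of `∧V`, they make the Koszul differential square to zero. -/
theorem commHead_commHead {n : ℕ} {m l : ℤ} {x y : Module.Dual K V} (hx : x ∈ dualGrading 𝒱 m)
    (hy : y ∈ dualGrading 𝒱 l) (φ : Cochain K (Poly 𝒱) (n + 1)) :
    commHead 𝒱 (coord 𝒱 x) (commHead 𝒱 (coord 𝒱 y) φ) =
      (-1 : K) ^ (m * l) • commHead 𝒱 (coord 𝒱 y) (commHead 𝒱 (coord 𝒱 x) φ) := by
  have hyx := KoszulAlgebra.ι_mul_ι 1 (dualGrading 𝒱) hy hx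
  rw [one_mul, mul_comm l m] at hyx
  have e : ∀ f g : Poly 𝒱, commHead 𝒱 f (commHead 𝒱 g φ) =
      preHead (LinearMap.mulLeft K (g * f)) φ -
        preHead (LinearMap.mulLeft K f) (koszulMul (polySign 𝒱 1) g φ) -
        koszulMul (polySign 𝒱 1) f (preHead (LinearMap.mulLeft K g) φ) +
        koszulMul (polySign 𝒱 1) (g * f) φ := by
    intro f g
    have h1 : koszulMul (polySign 𝒱 1) f (commHead 𝒱 g φ) =
        koszulMul (polySign 𝒱 1) f (preHead (LinearMap.mulLeft K g) φ) -
          koszulMul (polySign 𝒱 1) (g * f) φ := by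
      rw [← koszulMul_koszulMul, commHead_apply]
      simp only [koszulMul.eq_1 _ f, map_sub, smul_sub]
      abel
    rw [commHead_apply, h1, commHead_apply, map_sub, preHead_preHead, ← LinearMap.mulLeft_mul]
    abel
  rw [e, e, hyx, preHead_koszulMul 𝒱 hx hy, preHead_koszulMul 𝒱 hy hx, koszulMul_smul_left,
    mul_comm l m]
  have : LinearMap.mulLeft K ((-1 : K) ^ (m * l) • (coord 𝒱 x * coord 𝒱 y)) =
      (-1 : K) ^ (m * l) • LinearMap.mulLeft K (coord 𝒱 x * coord 𝒱 y) := by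
    ext; simp [mul_assoc]
  rw [this, preHead_smul_map]
  simp only [smul_add, smul_sub, smul_smul, neg_one_zpow_mul_self, one_smul]
  abel

omit [FiniteDimensional K V] [CharZero K] in
theorem commHead_add {n : ℕ} (f g : Poly 𝒱) (φ : Cochain K (Poly 𝒱) (n + 1)) :
    commHead 𝒱 (f + g) φ = commHead 𝒱 f φ + commHead 𝒱 g φ := by
  have : preHead (LinearMap.mulLeft K (f + g)) φ =
      preHead (LinearMap.mulLeft K f) φ + preHead (LinearMap.mulLeft K g) φ := by
    apply cochain_ext
    intro a
    simp [add_mul, evalHead_add]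
  simp only [commHead_apply, this, koszulMul, map_add, add_smul]
  abel

omit [FiniteDimensional K V] [CharZero K] in
theorem commHead_smul_left {n : ℕ} (c : K) (f : Poly 𝒱) (φ : Cochain K (Poly 𝒱) (n + 1)) :
    commHead 𝒱 (c • f) φ = c • commHead 𝒱 f φ := by
  have : LinearMap.mulLeft K (c • f) = c • LinearMap.mulLeft K f := by ext; simp
  rw [commHead_apply, this, preHead_smul_map, koszulMul_smul_left, commHead_apply]
  exact (cochain_smul_sub c _ _).symm

/-- An operator commuting with all multiplications is determined by its value at `1`. Commuting with
coordinates suffices, since the elements with this property generate a subalgebra. -/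
theorem eq_leftFace_of_commHead_eq_zero {n : ℕ} {φ : Cochain K (Poly 𝒱) (n + 1)}
    (h : ∀ m, ∀ x ∈ dualGrading 𝒱 m, commHead 𝒱 (coord 𝒱 x) φ = 0) :
    φ = leftFace (polySign 𝒱 1) n (evalHead 1 φ) := by
  have hσ := polySign_one_polySign_one 𝒱
  have e : ∀ f, commHead 𝒱 f φ = 0 ↔
      preHead (LinearMap.mulLeft K f) φ = koszulMul (polySign 𝒱 1) f φ := fun f => by
    rw [commHead_apply, sub_eq_zero]
  have cl : ∀ f g, commHead 𝒱 f φ = 0 → commHead 𝒱 g φ = 0 →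
      commHead 𝒱 (polySign 𝒱 1 g) φ = 0 → commHead 𝒱 (f * g) φ = 0 := by
    intro f g hf hg hg'
    rw [e] at *
    rw [LinearMap.mulLeft_mul, ← preHead_preHead, hf, koszulMul, map_add, preHead_smul,
      preHead_smul, preHead_conj, hg, hg', conj_koszulMul_map hσ, koszulMul_mul hσ]
  have one : commHead 𝒱 1 φ = 0 := by
    rw [commHead_apply, koszulMul_one, sub_eq_zero]
    apply cochain_ext
    simp
  let S : Subalgebra K (Poly 𝒱) :=
    -- The sign twist of `f` is included because the product rule `cl` passes through `conj`, which
    -- replaces the second factor by its twist.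
    { carrier := {f | commHead 𝒱 f φ = 0 ∧ commHead 𝒱 (polySign 𝒱 1 f) φ = 0}
      mul_mem' := by
        rintro f g ⟨hf, hf'⟩ ⟨hg, hg'⟩
        refine ⟨cl f g hf hg hg', ?_⟩
        rw [map_mul]
        exact cl _ _ hf' hg' (by rwa [hσ])
      add_mem' := by
        rintro f g ⟨hf, hf'⟩ ⟨hg, hg'⟩
        refine ⟨?_, ?_⟩
        · rw [commHead_add, hf, hg, add_zero]
        · rw [map_add, commHead_add, hf', hg', add_zero]
      algebraMap_mem' := by
        intro c
        have : commHead 𝒱 (algebraMap K (Poly 𝒱) c) φ = 0 := by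
          rw [Algebra.algebraMap_eq_smul_one, commHead_smul_left, one, smul_zero]
        exact ⟨this, by rwa [AlgHom.commutes]⟩ }
  have key : ∀ f, commHead 𝒱 f φ = 0 := fun f => (mem_of_coord_mem S (fun m x hx => by
    refine ⟨h m x hx, ?_⟩
    rw [polySign_one_coord 𝒱 hx, commHead_smul_left, h m x hx, smul_zero]) f).1
  apply cochain_ext
  intro f
  have := congrArg (evalHead 1) ((e f).1 (key f))
  rw [evalHead_preHead, LinearMap.mulLeft_apply, mul_one, koszulMul, map_add, evalHead_smul_apply,
    evalHead_smul_apply, evalHead_conj, map_one] at this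
  rw [this, evalHead_leftFace, koszulMul]

omit [CharZero K] in
theorem preHead_partialDeriv_comm {n : ℕ} {p q : ℤ} (v : 𝒱 p) (u : 𝒱 q)
    (φ : Cochain K (Poly 𝒱) (n + 1)) :
    preHead (partialDeriv 𝒱 p v) (preHead (partialDeriv 𝒱 q u) φ) =
      (-1 : K) ^ (p * q) • preHead (partialDeriv 𝒱 q u) (preHead (partialDeriv 𝒱 p v) φ) := by
  have : partialDeriv 𝒱 q u ∘ₗ partialDeriv 𝒱 p v =
      (-1 : K) ^ (p * q) • (partialDeriv 𝒱 p v ∘ₗ partialDeriv 𝒱 q u) := by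
    ext f
    simp only [LinearMap.comp_apply, LinearMap.smul_apply]
    rw [partialDeriv_comm, mul_comm]
  rw [preHead_preHead, this, preHead_smul_map, preHead_preHead]

/-- The canonical commutation relation between `∂_v` and the multiplication by `x`. -/
theorem commHead_preHead_partialDeriv {n : ℕ} {m p : ℤ} {x : Module.Dual K V}
    (hx : x ∈ dualGrading 𝒱 m) (v : 𝒱 p) (φ : Cochain K (Poly 𝒱) (n + 1)) :
    commHead 𝒱 (coord 𝒱 x) (preHead (partialDeriv 𝒱 p v) φ) =
      x v • φ + (-1 : K) ^ (m * p) •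
        preHead (partialDeriv 𝒱 p v) (commHead 𝒱 (coord 𝒱 x) φ) := by
  have h1 : preHead (LinearMap.mulLeft K (coord 𝒱 x)) (preHead (partialDeriv 𝒱 p v) φ) =
      x v • φ + (-1 : K) ^ (m * p) •
        preHead (partialDeriv 𝒱 p v) (preHead (LinearMap.mulLeft K (coord 𝒱 x)) φ) := by
    apply cochain_ext
    intro b
    simp only [evalHead_preHead, map_add, map_smul, LinearMap.mulLeft_apply]
    rw [partialDeriv_mul, partialDeriv_coord, polySign_coord 𝒱 p hx, ← Algebra.smul_def,
      smul_mul_assoc, evalHead_add, evalHead_smul, evalHead_smul, mul_comm p m]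
  have hc : conj (polySign 𝒱 1) (preHead (partialDeriv 𝒱 p v) φ) =
      (-1 : K) ^ p • preHead (partialDeriv 𝒱 p v) (conj (polySign 𝒱 1) φ) := by
    apply cochain_ext
    intro b
    simp only [evalHead_preHead, map_smul, evalHead_conj]
    rw [partialDeriv_polySign, one_mul, evalHead_smul, map_smul]
  have h2 : koszulMul (polySign 𝒱 1) (coord 𝒱 x) (preHead (partialDeriv 𝒱 p v) φ) =
      (-1 : K) ^ (m * p) •
        preHead (partialDeriv 𝒱 p v) (koszulMul (polySign 𝒱 1) (coord 𝒱 x) φ) := by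
    rcases Int.even_or_odd m with hm | hm
    · rw [koszulMul_coord_even 𝒱 hm hx, koszulMul_coord_even 𝒱 hm hx,
        (hm.mul_right p).neg_one_zpow, one_smul, preHead_smul]
    · rw [koszulMul_coord_odd 𝒱 hm hx, koszulMul_coord_odd 𝒱 hm hx, zpow_mul, hm.neg_one_zpow,
        preHead_smul, hc, cochain_smul_comm]
  rw [commHead_apply, commHead_apply, h1, h2, map_sub, smul_sub, add_sub_assoc]

end GradedCommutator

/-! ### Constant coefficient operators indexed by words -/

section Words

variable {K V : Type*} [Field K] [AddCommGroup V] [Module K V] (𝒱 : ℤ → Submodule K V)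
variable [DirectSum.Decomposition 𝒱]

omit [DirectSum.Decomposition 𝒱] in
@[simp]
theorem wordDegree_nil : wordDegree 𝒱 [] = 0 := rfl

omit [DirectSum.Decomposition 𝒱] in
@[simp]
theorem wordDegree_cons (v : Σ p : ℤ, 𝒱 p) (w : List (Σ p : ℤ, 𝒱 p)) :
    wordDegree 𝒱 (v :: w) = v.1 + wordDegree 𝒱 w := by
  simp [wordDegree]

/-- The total degree of a tuple of words. -/
def tupleDegree {n : ℕ} (w : Fin n → List (Σ p : ℤ, 𝒱 p)) : ℤ := ∑ i, wordDegree 𝒱 (w i)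

omit [DirectSum.Decomposition 𝒱] in
@[simp]
theorem tupleDegree_cons {n : ℕ} (w₀ : List (Σ p : ℤ, 𝒱 p))
    (w : Fin n → List (Σ p : ℤ, 𝒱 p)) :
    tupleDegree 𝒱 (Fin.cons w₀ w : Fin (n + 1) → _) = wordDegree 𝒱 w₀ + tupleDegree 𝒱 w := by
  simp [tupleDegree, Fin.sum_univ_succ]

@[simp]
theorem wordDeriv_nil (f : Poly 𝒱) : wordDeriv 𝒱 [] f = f := rfl

@[simp]
theorem wordDeriv_cons (v : Σ p : ℤ, 𝒱 p) (w : List (Σ p : ℤ, 𝒱 p)) (f : Poly 𝒱) :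
    wordDeriv 𝒱 (v :: w) f = partialDeriv 𝒱 v.1 v.2 (wordDeriv 𝒱 w f) := rfl

theorem wordDeriv_concat (v : Σ p : ℤ, 𝒱 p) (w : List (Σ p : ℤ, 𝒱 p)) (f : Poly 𝒱) :
    wordDeriv 𝒱 (w ++ [v]) f = wordDeriv 𝒱 w (partialDeriv 𝒱 v.1 v.2 f) := by
  induction w with
  | nil => rfl
  | cons u w ih => rw [List.cons_append, wordDeriv_cons, ih, wordDeriv_cons]

theorem polyOp_nil (g : Poly 𝒱) (w : Fin 0 → List (Σ p : ℤ, 𝒱 p)) (x : Fin 0 → Poly 𝒱) :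
    polyOp 𝒱 g w x = g := by
  simp [polyOp]

theorem evalHead_polyOp {n : ℕ} (g : Poly 𝒱) (w₀ : List (Σ p : ℤ, 𝒱 p))
    (w : Fin n → List (Σ p : ℤ, 𝒱 p)) (a : Poly 𝒱) :
    evalHead a (polyOp 𝒱 g (Fin.cons w₀ w : Fin (n + 1) → _)) =
      (g * wordDeriv 𝒱 w₀ (polySign 𝒱 (tupleDegree 𝒱 w) a)) • polyOp 𝒱 1 w := by
  ext x
  simp [polyOp, List.ofFn_succ, mul_assoc, tupleDegree, Finset.sum_filter, Fin.sum_univ_succ]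

theorem polyOp_eq_smul {n : ℕ} (g : Poly 𝒱) (w : Fin n → List (Σ p : ℤ, 𝒱 p)) :
    polyOp 𝒱 g w = g • polyOp 𝒱 1 w := by
  ext x
  simp [polyOp]

variable [FiniteDimensional K V]

theorem wordDeriv_polySign (w : List (Σ p : ℤ, 𝒱 p)) (q : ℤ) (f : Poly 𝒱) :
    wordDeriv 𝒱 w (polySign 𝒱 q f) =
      (-1 : K) ^ (q * wordDegree 𝒱 w) • polySign 𝒱 q (wordDeriv 𝒱 w f) := by
  induction w with
  | nil => simp
  | cons v w ih =>
    rw [wordDeriv_cons, ih, map_smul, partialDeriv_polySign, smul_smul, wordDegree_cons, mul_add,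
      zpow_add₀ (by simp), mul_comm, wordDeriv_cons]

theorem conj_polyOp {n : ℕ} (w : Fin n → List (Σ p : ℤ, 𝒱 p)) :
    conj (polySign 𝒱 1) (polyOp 𝒱 1 w) = (-1 : K) ^ tupleDegree 𝒱 w • polyOp 𝒱 1 w := by
  induction n with
  | zero =>
    ext x
    rw [conj_apply, _root_.smul_apply, polyOp_nil, polyOp_nil]
    simp [tupleDegree]
  | succ n ih =>
    obtain ⟨w₀, w, rfl⟩ : ∃ w₀ w', w = Fin.cons w₀ w' := ⟨_, _, (Fin.cons_self_tail w).symm⟩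
    apply cochain_ext
    intro a
    rw [evalHead_conj, map_smul, evalHead_polyOp, evalHead_polyOp, conj_smul, ih,
      tupleDegree_cons, cochain_smul_comm, zpow_add₀ (by simp), mul_comm, ← smul_smul,
      ← cochain_smul_assoc _ _ (polyOp 𝒱 1 w)]
    rw [one_mul, one_mul, polySign_comm, wordDeriv_polySign, map_smul, polySign_one_polySign_one,
      one_mul, cochain_smul_assoc, cochain_smul_assoc]

/-- The new letter acts first, hence joins the first word at its end; the sign moves it past the
degrees of the other words. Words in the first argument are accordingly treated by induction on
their last letter. -/
theorem preHead_polyOp {n : ℕ} (v : Σ p : ℤ, 𝒱 p) (g : Poly 𝒱) (w₀ : List (Σ p : ℤ, 𝒱 p))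
    (w : Fin n → List (Σ p : ℤ, 𝒱 p)) :
    preHead (partialDeriv 𝒱 v.1 v.2) (polyOp 𝒱 g (Fin.cons w₀ w : Fin (n + 1) → _)) =
      (-1 : K) ^ (tupleDegree 𝒱 w * v.1) •
        polyOp 𝒱 g (Fin.cons (w₀ ++ [v]) w : Fin (n + 1) → _) := by
  apply cochain_ext
  intro a
  rw [evalHead_preHead, map_smul, evalHead_polyOp, evalHead_polyOp, ← cochain_smul_assoc]
  congr 1
  rw [wordDeriv_concat, partialDeriv_polySign, map_smul, mul_smul_comm, smul_smul,
    neg_one_zpow_mul_self, one_smul]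

variable [CharZero K]

theorem evenPart_add_smul_oddPart (q : ℤ) (a : Poly 𝒱) :
    evenPart (polySign 𝒱 1) a + (-1 : K) ^ q • oddPart (polySign 𝒱 1) a = polySign 𝒱 q a := by
  rcases Int.even_or_odd q with hq | hq
  · rw [hq.neg_one_zpow, one_smul, evenPart_add_oddPart, polySign_of_even 𝒱 hq]
  · rw [hq.neg_one_zpow, neg_smul, one_smul, ← sub_eq_add_neg, ← map_eq_evenPart_sub_oddPart,
      polySign_of_odd 𝒱 hq]

theorem koszulMul_polyOp {n : ℕ} (a : Poly 𝒱) (w : Fin n → List (Σ p : ℤ, 𝒱 p)) :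
    koszulMul (polySign 𝒱 1) a (polyOp 𝒱 1 w) =
      polySign 𝒱 (tupleDegree 𝒱 w) a • polyOp 𝒱 1 w := by
  rw [koszulMul, conj_polyOp, cochain_smul_comm, ← evenPart_add_smul_oddPart, add_smul,
    cochain_smul_assoc]

theorem leftFace_polyOp {n : ℕ} (w : Fin n → List (Σ p : ℤ, 𝒱 p)) :
    leftFace (polySign 𝒱 1) n (polyOp 𝒱 1 w) =
      polyOp 𝒱 1 (Fin.cons [] w : Fin (n + 1) → _) := by
  apply cochain_ext
  intro a
  rw [evalHead_leftFace, koszulMul_polyOp, evalHead_polyOp, one_mul, wordDeriv_nil]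

theorem leftFace_smul {n : ℕ} (g : Poly 𝒱) (φ : Cochain K (Poly 𝒱) n) :
    leftFace (polySign 𝒱 1) n (g • φ) = g • leftFace (polySign 𝒱 1) n φ := by
  apply cochain_ext
  intro a
  rw [evalHead_leftFace, koszulMul_smul, evalHead_smul_apply, evalHead_leftFace]

/-- The coefficient passes the left face by graded commutativity, so differentials need only be
computed for constant coefficients. -/
theorem dH_smul {n : ℕ} (g : Poly 𝒱) (φ : Cochain K (Poly 𝒱) n) :
    dH 𝒱 n (g • φ) = g • dH 𝒱 n φ := by
  rw [dH, hochschildD_eq, LinearMap.add_apply, LinearMap.add_apply, leftFace_smul, barD_smul,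
    smul_add]

theorem commHead_polyOp_nil {n : ℕ} (f g : Poly 𝒱) (w : Fin n → List (Σ p : ℤ, 𝒱 p)) :
    commHead 𝒱 f (polyOp 𝒱 g (Fin.cons [] w : Fin (n + 1) → _)) = 0 := by
  rw [polyOp_eq_smul, commHead_smul, ← leftFace_polyOp, commHead_leftFace, smul_zero]

end Words

/-! ### The iterated Leibniz rule -/

section Leibniz

variable {K V : Type*} [Field K] [AddCommGroup V] [Module K V] (𝒱 : ℤ → Submodule K V)
variable [DirectSum.Decomposition 𝒱]

/-- The bilinear operator `(a, b) ↦ ± ∂_w a ∂_{w'} b`. -/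
def wordPair (w w' : List (Σ p : ℤ, 𝒱 p)) : Poly 𝒱 →ₗ[K] Poly 𝒱 →ₗ[K] Poly 𝒱 :=
  (LinearMap.mul K (Poly 𝒱)).compl₁₂
    (wordDeriv 𝒱 w ∘ₗ (polySign 𝒱 (wordDegree 𝒱 w')).toLinearMap) (wordDeriv 𝒱 w')

theorem wordPair_apply (w w' : List (Σ p : ℤ, 𝒱 p)) (a b : Poly 𝒱) :
    wordPair 𝒱 w w' a b =
      wordDeriv 𝒱 w (polySign 𝒱 (wordDegree 𝒱 w') a) * wordDeriv 𝒱 w' b := rfl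

/-- The span of the bilinear operators of degree `q` with both words of length at least `r`. -/
def wordPairSpan (r : ℕ) (q : ℤ) : Submodule K (Poly 𝒱 →ₗ[K] Poly 𝒱 →ₗ[K] Poly 𝒱) :=
  Submodule.span K {β | ∃ w w' : List (Σ p : ℤ, 𝒱 p), r ≤ w.length ∧ r ≤ w'.length ∧
    wordDegree 𝒱 w + wordDegree 𝒱 w' = q ∧ β = wordPair 𝒱 w w'}

/-- The failure of `∂_w` to be a derivation. -/
def leibnizDefect (w : List (Σ p : ℤ, 𝒱 p)) : Poly 𝒱 →ₗ[K] Poly 𝒱 →ₗ[K] Poly 𝒱 :=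
  (LinearMap.mul K (Poly 𝒱)).compr₂ (wordDeriv 𝒱 w) - wordPair 𝒱 w [] - wordPair 𝒱 [] w

variable [FiniteDimensional K V]

theorem leibnizDefect_apply (w : List (Σ p : ℤ, 𝒱 p)) (a b : Poly 𝒱) :
    leibnizDefect 𝒱 w a b = wordDeriv 𝒱 w (a * b) - wordDeriv 𝒱 w a * b -
      polySign 𝒱 (wordDegree 𝒱 w) a * wordDeriv 𝒱 w b := by
  simp [leibnizDefect, wordPair_apply, polySign_of_even 𝒱 Even.zero]

theorem leibnizDefect_singleton (v : Σ p : ℤ, 𝒱 p) : leibnizDefect 𝒱 [v] = 0 := by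
  ext a b
  simp [leibnizDefect_apply, partialDeriv_mul]

theorem leibnizDefect_nil : leibnizDefect 𝒱 [] = (-1 : K) • wordPair 𝒱 [] [] := by
  ext a b
  simp [leibnizDefect_apply, wordPair_apply, polySign_of_even 𝒱 Even.zero]

theorem partialDeriv_wordPair (v : Σ p : ℤ, 𝒱 p) (w w' : List (Σ p : ℤ, 𝒱 p)) :
    (wordPair 𝒱 w w').compr₂ (partialDeriv 𝒱 v.1 v.2) = wordPair 𝒱 (v :: w) w' +
      (-1 : K) ^ (v.1 * wordDegree 𝒱 w) • wordPair 𝒱 w (v :: w') := by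
  ext a b
  simp only [LinearMap.compr₂_apply, LinearMap.add_apply, LinearMap.smul_apply, wordPair_apply,
    partialDeriv_mul, wordDeriv_cons, wordDegree_cons]
  rw [← polySign_polySign, wordDeriv_polySign 𝒱 w v.1, smul_mul_assoc, smul_smul,
    neg_one_zpow_mul_self, one_smul]

/-- Differentiating the two terms subtracted in the defect of `w` yields the corresponding terms for
`v :: w` and, in addition, the two mixed pairs. -/
theorem leibnizDefect_cons (v : Σ p : ℤ, 𝒱 p) (w : List (Σ p : ℤ, 𝒱 p)) :
    leibnizDefect 𝒱 (v :: w) = (leibnizDefect 𝒱 w).compr₂ (partialDeriv 𝒱 v.1 v.2) +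
      (-1 : K) ^ (v.1 * wordDegree 𝒱 w) • wordPair 𝒱 w [v] + wordPair 𝒱 [v] w := by
  have h : leibnizDefect 𝒱 w = (LinearMap.mul K (Poly 𝒱)).compr₂ (wordDeriv 𝒱 w) -
      wordPair 𝒱 w [] - wordPair 𝒱 [] w := rfl
  have h' : (leibnizDefect 𝒱 w).compr₂ (partialDeriv 𝒱 v.1 v.2) =
      (LinearMap.mul K (Poly 𝒱)).compr₂ (wordDeriv 𝒱 (v :: w)) -
        (wordPair 𝒱 w []).compr₂ (partialDeriv 𝒱 v.1 v.2) -
        (wordPair 𝒱 [] w).compr₂ (partialDeriv 𝒱 v.1 v.2) := by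
    ext a b
    simp [h]
  rw [h', partialDeriv_wordPair, partialDeriv_wordPair, leibnizDefect]
  simp only [wordDegree_nil, mul_zero, zpow_zero, one_smul]
  abel

theorem wordPairSpan_compr₂ (r : ℕ) (q : ℤ) (v : Σ p : ℤ, 𝒱 p)
    {β : Poly 𝒱 →ₗ[K] Poly 𝒱 →ₗ[K] Poly 𝒱} (hβ : β ∈ wordPairSpan 𝒱 r q) :
    β.compr₂ (partialDeriv 𝒱 v.1 v.2) ∈ wordPairSpan 𝒱 r (v.1 + q) := by
  induction hβ using Submodule.span_induction with
  | mem β h =>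
    obtain ⟨w, w', hw, hw', rfl, rfl⟩ := h
    rw [partialDeriv_wordPair]
    refine add_mem (Submodule.subset_span ⟨_, _, ?_, hw', ?_, rfl⟩)
      (Submodule.smul_mem _ _ (Submodule.subset_span ⟨_, _, hw, ?_, ?_, rfl⟩))
    · simp; omega
    · simp; ring
    · simp; omega
    · simp; ring
  | zero =>
    have : (0 : Poly 𝒱 →ₗ[K] Poly 𝒱 →ₗ[K] Poly 𝒱).compr₂ (partialDeriv 𝒱 v.1 v.2) = 0 := by
      ext; simp
    rw [this]; exact zero_mem _
  | add β γ _ _ h h' =>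
    have : (β + γ).compr₂ (partialDeriv 𝒱 v.1 v.2) = β.compr₂ (partialDeriv 𝒱 v.1 v.2) +
        γ.compr₂ (partialDeriv 𝒱 v.1 v.2) := by
      ext; simp
    rw [this]; exact add_mem h h'
  | smul c β _ h =>
    have : (c • β).compr₂ (partialDeriv 𝒱 v.1 v.2) =
        c • β.compr₂ (partialDeriv 𝒱 v.1 v.2) := by
      ext; simp
    rw [this]; exact Submodule.smul_mem _ c h

/-- This is the reduced coproduct: the terms of the iterated Leibniz rule in which one factor stays
undifferentiated are exactly the two subtracted ones. It is the reason why normalized operators form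
a subcomplex. -/
theorem leibnizDefect_mem_one {w : List (Σ p : ℤ, 𝒱 p)} (hw : 1 ≤ w.length) :
    leibnizDefect 𝒱 w ∈ wordPairSpan 𝒱 1 (wordDegree 𝒱 w) := by
  induction w with
  | nil => simp at hw
  | cons v w ih =>
    cases w with
    | nil => rw [leibnizDefect_singleton]; exact zero_mem _
    | cons u w =>
      rw [leibnizDefect_cons, wordDegree_cons 𝒱 v]
      refine add_mem (add_mem (wordPairSpan_compr₂ 𝒱 1 _ v (ih (by simp)))
        (Submodule.smul_mem _ _ (Submodule.subset_span ⟨_, _, ?_, ?_, ?_, rfl⟩)))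
        (Submodule.subset_span ⟨_, _, ?_, ?_, ?_, rfl⟩)
      all_goals simp
      ring

theorem leibnizDefect_mem {r : ℕ} (hr : r ≤ 1) {w : List (Σ p : ℤ, 𝒱 p)} (hw : r ≤ w.length) :
    leibnizDefect 𝒱 w ∈ wordPairSpan 𝒱 r (wordDegree 𝒱 w) := by
  cases w with
  | nil =>
    rw [leibnizDefect_nil]
    exact Submodule.smul_mem _ _ (Submodule.subset_span ⟨_, _, hw, hw, by simp, rfl⟩)
  | cons v w =>
    refine Submodule.span_mono ?_ (leibnizDefect_mem_one 𝒱 (w := v :: w) (by simp))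
    rintro β ⟨w, w', h, h', hq, rfl⟩
    exact ⟨w, w', hr.trans h, hr.trans h', hq, rfl⟩

end Leibniz

/-! ### Polydifferential operators are stable under the differentials -/

section Closure

variable {K V : Type*} [Field K] [AddCommGroup V] [Module K V] (𝒱 : ℤ → Submodule K V)
variable [DirectSum.Decomposition 𝒱]

/-- The constant coefficient polydifferential operators of degree `q` whose first tensor factor
has order at least `r₀` and whose other tensor factors have order at least `r`. -/
def constDiff (r₀ r n : ℕ) (q : ℤ) : Submodule K (Cochain K (Poly 𝒱) n) :=
  Submodule.span K {φ | ∃ w : Fin n → List (Σ p : ℤ, 𝒱 p), tupleDegree 𝒱 w = q ∧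
    (∀ i : Fin n, (if (i : ℕ) = 0 then r₀ else r) ≤ (w i).length) ∧ φ = polyOp 𝒱 1 w}

theorem polyOp_cons_mem_constDiff {r₀ r n : ℕ} {q : ℤ} {w₀ : List (Σ p : ℤ, 𝒱 p)}
    {w : Fin n → List (Σ p : ℤ, 𝒱 p)} (hw₀ : r₀ ≤ w₀.length) (hw : ∀ i, r ≤ (w i).length)
    (hq : wordDegree 𝒱 w₀ + tupleDegree 𝒱 w = q) :
    polyOp 𝒱 1 (Fin.cons w₀ w : Fin (n + 1) → _) ∈ constDiff 𝒱 r₀ r (n + 1) q := by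
  refine Submodule.subset_span ⟨_, by rw [tupleDegree_cons, hq], fun i => ?_, rfl⟩
  induction i using Fin.cases with
  | zero => simpa using hw₀
  | succ i => simpa using hw i

/-- Prepends a word to a linear combination of operators. A common degree `q` is needed because the
Koszul sign on the new argument depends on it. -/
theorem exists_evalHead_eq {r₀ r n : ℕ} {q : ℤ} {w₀ : List (Σ p : ℤ, 𝒱 p)}
    (hw₀ : r₀ ≤ w₀.length) {χ : Cochain K (Poly 𝒱) n} (hχ : χ ∈ constDiff 𝒱 r r n q) :
    ∃ φ ∈ constDiff 𝒱 r₀ r (n + 1) (wordDegree 𝒱 w₀ + q),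
      ∀ a, evalHead a φ = wordDeriv 𝒱 w₀ (polySign 𝒱 q a) • χ := by
  induction hχ using Submodule.span_induction with
  | mem χ h =>
    obtain ⟨w, rfl, hw, rfl⟩ := h
    refine ⟨_, polyOp_cons_mem_constDiff 𝒱 hw₀ (fun i => by simpa using hw i) rfl, fun a => ?_⟩
    rw [evalHead_polyOp, one_mul]
  | zero => exact ⟨0, zero_mem _, fun a => by rw [map_zero, smul_zero]⟩
  | add χ χ' _ _ h h' =>
    obtain ⟨φ, hφ, e⟩ := h
    obtain ⟨φ', hφ', e'⟩ := h'
    exact ⟨φ + φ', add_mem hφ hφ', fun a => by rw [map_add, e, e', smul_add]⟩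
  | smul c χ _ h =>
    obtain ⟨φ, hφ, e⟩ := h
    exact ⟨c • φ, Submodule.smul_mem _ c hφ, fun a => by rw [map_smul, e, cochain_smul_comm]⟩

theorem exists_evalHead_evalHead_eq {r n : ℕ} {q : ℤ}
    {β : Poly 𝒱 →ₗ[K] Poly 𝒱 →ₗ[K] Poly 𝒱} (hβ : β ∈ wordPairSpan 𝒱 r q)
    {w : Fin n → List (Σ p : ℤ, 𝒱 p)} (hw : ∀ i, r ≤ (w i).length) [FiniteDimensional K V] :
    ∃ φ ∈ constDiff 𝒱 r r (n + 2) (q + tupleDegree 𝒱 w),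
      ∀ a b, evalHead b (evalHead a φ) =
        β (polySign 𝒱 (tupleDegree 𝒱 w) a) (polySign 𝒱 (tupleDegree 𝒱 w) b) •
          polyOp 𝒱 1 w := by
  induction hβ using Submodule.span_induction with
  | mem β h =>
    obtain ⟨u, u', hu, hu', rfl, rfl⟩ := h
    refine ⟨polyOp 𝒱 1 (Fin.cons u (Fin.cons u' w : Fin (n + 1) → _) : Fin (n + 2) → _),
      polyOp_cons_mem_constDiff 𝒱 hu (fun i => ?_) (by rw [tupleDegree_cons, add_assoc]),
      fun a b => ?_⟩
    · induction i using Fin.cases with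
      | zero => simpa using hu'
      | succ i => simpa using hw i
    · rw [evalHead_polyOp, evalHead_smul_apply, evalHead_polyOp, one_mul, one_mul, smul_smul,
        wordPair_apply, tupleDegree_cons, polySign_polySign]
  | zero => exact ⟨0, zero_mem _, fun a b => by simp⟩
  | add χ χ' _ _ h h' =>
    obtain ⟨φ, hφ, e⟩ := h
    obtain ⟨φ', hφ', e'⟩ := h'
    exact ⟨φ + φ', add_mem hφ hφ', fun a b => by
      rw [map_add, map_add, e, e', LinearMap.add_apply, LinearMap.add_apply, add_smul]⟩
  | smul c χ _ h =>
    obtain ⟨φ, hφ, e⟩ := h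
    exact ⟨c • φ, Submodule.smul_mem _ c hφ, fun a b => by
      rw [map_smul, map_smul, e, LinearMap.smul_apply, LinearMap.smul_apply, cochain_smul_assoc]⟩

variable [FiniteDimensional K V] [CharZero K]

/-- The faces that involve only the first word and the first two arguments assemble into the Leibniz
defect of `w₀`; what remains is the differential of the operator with `w₀` removed. This drives the
induction on the arity in `dH_polyOp_mem` and `dH_polyOp_singleton`. -/
theorem evalHead_evalHead_dH_polyOp {n : ℕ} (w₀ : List (Σ p : ℤ, 𝒱 p))
    (w : Fin n → List (Σ p : ℤ, 𝒱 p)) (a b : Poly 𝒱) :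
    evalHead b (evalHead a (dH 𝒱 (n + 1) (polyOp 𝒱 1 (Fin.cons w₀ w : Fin (n + 1) → _)))) =
      -(leibnizDefect 𝒱 w₀ (polySign 𝒱 (tupleDegree 𝒱 w) a) (polySign 𝒱 (tupleDegree 𝒱 w) b) •
          polyOp 𝒱 1 w) -
        wordDeriv 𝒱 w₀ (polySign 𝒱 (tupleDegree 𝒱 w) a) •
          evalHead b (dH 𝒱 n (polyOp 𝒱 1 w)) := by
  have h : dH 𝒱 n (polyOp 𝒱 1 w) = polyOp 𝒱 1 (Fin.cons [] w : Fin (n + 1) → _) +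
      barD n (polyOp 𝒱 1 w) := by
    rw [dH, hochschildD_eq, LinearMap.add_apply, leftFace_polyOp]
  rw [h, dH, hochschildD_eq, LinearMap.add_apply, leftFace_polyOp, map_add, evalHead_barD,
    evalHead_polyOp, evalHead_polyOp, barD_smul, one_mul, one_mul, map_add, map_sub, map_neg,
    evalHead_preHead, evalHead_smul_apply, evalHead_smul_apply, map_add, evalHead_polyOp,
    evalHead_polyOp, evalHead_polyOp, leibnizDefect_apply, one_mul, one_mul, one_mul,
    LinearMap.mulLeft_apply, map_mul, wordDeriv_nil, wordDeriv_nil, tupleDegree_cons,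
    ← polySign_polySign]
  simp only [cochain_sub_smul, smul_add, smul_smul]
  abel

theorem dH_polyOp_mem {r : ℕ} (hr : r ≤ 1) {n : ℕ} (w : Fin n → List (Σ p : ℤ, 𝒱 p))
    (hw : ∀ i, r ≤ (w i).length) :
    dH 𝒱 n (polyOp 𝒱 1 w) ∈ constDiff 𝒱 r r (n + 1) (tupleDegree 𝒱 w) := by
  induction n with
  | zero => rw [dH_zero]; exact zero_mem _
  | succ n ih =>
    obtain ⟨w₀, w, rfl⟩ : ∃ w₀ w', w = Fin.cons w₀ w' := ⟨_, _, (Fin.cons_self_tail w).symm⟩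
    have hw₀ : r ≤ w₀.length := by simpa using hw 0
    have hw' : ∀ i, r ≤ (w i).length := fun i => by simpa using hw i.succ
    obtain ⟨φ, hφ, e⟩ := exists_evalHead_eq 𝒱 hw₀ (ih w hw')
    obtain ⟨φ', hφ', e'⟩ := exists_evalHead_evalHead_eq 𝒱 (leibnizDefect_mem 𝒱 hr hw₀) hw'
    have : dH 𝒱 (n + 1) (polyOp 𝒱 1 (Fin.cons w₀ w : Fin (n + 1) → _)) = -φ' - φ := by
      apply cochain_ext
      intro a
      apply cochain_ext
      intro b
      rw [evalHead_evalHead_dH_polyOp, map_sub, map_neg, map_sub, map_neg, e, e',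
        evalHead_smul_apply]
    rw [this, tupleDegree_cons]
    exact sub_mem (neg_mem hφ') hφ

theorem dH_polyOp_singleton {n : ℕ} (f : Poly 𝒱) (v : Fin n → Σ p : ℤ, 𝒱 p) :
    dH 𝒱 n (polyOp 𝒱 f fun i => [v i]) = 0 := by
  rw [polyOp_eq_smul, dH_smul]
  suffices dH 𝒱 n (polyOp 𝒱 1 fun i => [v i]) = 0 by rw [this, smul_zero]
  induction n with
  | zero => exact dH_zero 𝒱 _
  | succ n ih =>
    have : (fun i => [v i]) = (Fin.cons [v 0] (fun i => [v i.succ]) : Fin (n + 1) → _) := by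
      ext i
      induction i using Fin.cases <;> rfl
    rw [this]
    apply cochain_ext
    intro a
    apply cochain_ext
    intro b
    rw [evalHead_evalHead_dH_polyOp, ih, leibnizDefect_singleton]
    simp

theorem leftFace_mem_constDiff {r n : ℕ} {q : ℤ} {χ : Cochain K (Poly 𝒱) n}
    (hχ : χ ∈ constDiff 𝒱 r r n q) :
    leftFace (polySign 𝒱 1) n χ ∈ constDiff 𝒱 0 r (n + 1) q := by
  induction hχ using Submodule.span_induction with
  | mem χ h =>
    obtain ⟨w, rfl, hw, rfl⟩ := h
    rw [leftFace_polyOp]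
    exact polyOp_cons_mem_constDiff 𝒱 (Nat.zero_le _) (fun i => by simpa using hw i) (by simp)
  | zero => rw [map_zero]; exact zero_mem _
  | add χ χ' _ _ h h' => rw [map_add]; exact add_mem h h'
  | smul c χ _ h => rw [map_smul]; exact Submodule.smul_mem _ c h

omit [FiniteDimensional K V] [CharZero K] in
theorem constDiff_mono {r n : ℕ} {q : ℤ} : constDiff 𝒱 r r n q ≤ constDiff 𝒱 0 r n q := by
  apply Submodule.span_mono
  rintro φ ⟨w, hq, hw, rfl⟩
  refine ⟨w, hq, fun i => le_trans ?_ (hw i), rfl⟩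
  split_ifs <;> simp

/-- Since `barD = dH - leftFace`, closure under `dH` settles the case of a sufficiently long first
word. Otherwise the operator is a left face, for which `barD` is minus the left face of a
differential. -/
theorem barD_polyOp_mem {r : ℕ} (hr : r ≤ 1) {n : ℕ} (w₀ : List (Σ p : ℤ, 𝒱 p))
    (w : Fin n → List (Σ p : ℤ, 𝒱 p)) (hw : ∀ i, r ≤ (w i).length) :
    barD (n + 1) (polyOp 𝒱 1 (Fin.cons w₀ w : Fin (n + 1) → _)) ∈
      constDiff 𝒱 0 r (n + 2) (wordDegree 𝒱 w₀ + tupleDegree 𝒱 w) := by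
  by_cases h : r ≤ w₀.length
  · have hw' : ∀ i, r ≤ ((Fin.cons w₀ w : Fin (n + 1) → List (Σ p : ℤ, 𝒱 p)) i).length := by
      intro i
      induction i using Fin.cases with
      | zero => simpa using h
      | succ i => simpa using hw i
    have e : barD (n + 1) (polyOp 𝒱 1 (Fin.cons w₀ w : Fin (n + 1) → _)) =
        dH 𝒱 (n + 1) (polyOp 𝒱 1 (Fin.cons w₀ w : Fin (n + 1) → _)) -
          leftFace (polySign 𝒱 1) _ (polyOp 𝒱 1 (Fin.cons w₀ w : Fin (n + 1) → _)) := by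
      rw [dH, hochschildD_eq, LinearMap.add_apply, add_sub_cancel_left]
    rw [e, ← tupleDegree_cons]
    refine sub_mem (constDiff_mono 𝒱 (dH_polyOp_mem 𝒱 hr _ hw')) (leftFace_mem_constDiff 𝒱
      (Submodule.subset_span ⟨_, rfl, fun i => by simpa using hw' i, rfl⟩))
  -- A first word shorter than `r ≤ 1` is empty.
  · obtain rfl : w₀ = [] := by
      rw [← List.length_eq_zero_iff]
      omega
    have e : barD (n + 1) (polyOp 𝒱 1 (Fin.cons [] w : Fin (n + 1) → _)) =
        -leftFace (polySign 𝒱 1) (n + 1) (dH 𝒱 n (polyOp 𝒱 1 w)) := by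
      rw [← leftFace_polyOp, barD_leftFace (polySign_one_polySign_one 𝒱), dH, hochschildD_eq,
        LinearMap.add_apply, map_add]
      abel
    rw [e, wordDegree_nil, zero_add]
    exact neg_mem (leftFace_mem_constDiff 𝒱 (dH_polyOp_mem 𝒱 hr w hw))

/-- The polydifferential cochains all of whose tensor factors, except possibly the first one, have
order at least `r`. -/
def headDiff (r n : ℕ) : Submodule K (Cochain K (Poly 𝒱) n) :=
  Submodule.span K {φ | ∃ (g : Poly 𝒱) (w : Fin n → List (Σ p : ℤ, 𝒱 p)),
    (∀ i : Fin n, (i : ℕ) ≠ 0 → r ≤ (w i).length) ∧ φ = polyOp 𝒱 g w}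

omit [FiniteDimensional K V] [CharZero K] in
theorem polyOp_cons_mem_headDiff {r n : ℕ} (g : Poly 𝒱) (w₀ : List (Σ p : ℤ, 𝒱 p))
    {w : Fin n → List (Σ p : ℤ, 𝒱 p)} (hw : ∀ i, r ≤ (w i).length) :
    polyOp 𝒱 g (Fin.cons w₀ w : Fin (n + 1) → _) ∈ headDiff 𝒱 r (n + 1) := by
  refine Submodule.subset_span ⟨_, _, fun i hi => ?_, rfl⟩
  induction i using Fin.cases with
  | zero => simp at hi
  | succ i => simpa using hw i

omit [FiniteDimensional K V] [CharZero K] in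
theorem headDiff_induction {r n : ℕ} {p : Cochain K (Poly 𝒱) (n + 1) → Prop}
    (hop : ∀ g w₀ (w : Fin n → List (Σ p : ℤ, 𝒱 p)), (∀ i, r ≤ (w i).length) →
      p (polyOp 𝒱 g (Fin.cons w₀ w : Fin (n + 1) → _)))
    (hzero : p 0) (hadd : ∀ φ ψ, p φ → p ψ → p (φ + ψ)) (hsmul : ∀ (c : K) φ, p φ → p (c • φ))
    {φ : Cochain K (Poly 𝒱) (n + 1)} (hφ : φ ∈ headDiff 𝒱 r (n + 1)) : p φ := by
  induction hφ using Submodule.span_induction with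
  | mem φ h =>
    obtain ⟨g, w, hw, rfl⟩ := h
    rw [← Fin.cons_self_tail w]
    exact hop _ _ _ fun i => hw i.succ (by simp)
  | zero => exact hzero
  | add φ ψ _ _ h h' => exact hadd _ _ h h'
  | smul c φ _ h => exact hsmul _ _ h

omit [FiniteDimensional K V] [CharZero K] in
theorem polyDiff_le_headDiff (r n : ℕ) : polyDiff 𝒱 r n ≤ headDiff 𝒱 r n := by
  apply Submodule.span_mono
  rintro φ ⟨g, w, hw, rfl⟩
  exact ⟨g, w, fun i _ => hw i, rfl⟩

omit [FiniteDimensional K V] [CharZero K] in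
theorem smul_mem_of_constDiff {r₀ r n : ℕ} {q : ℤ} {S : Submodule K (Cochain K (Poly 𝒱) n)}
    (hS : ∀ (g : Poly 𝒱) (w : Fin n → List (Σ p : ℤ, 𝒱 p)),
      (∀ i : Fin n, (if (i : ℕ) = 0 then r₀ else r) ≤ (w i).length) → polyOp 𝒱 g w ∈ S)
    (g : Poly 𝒱) {φ : Cochain K (Poly 𝒱) n} (hφ : φ ∈ constDiff 𝒱 r₀ r n q) : g • φ ∈ S := by
  induction hφ using Submodule.span_induction with
  | mem φ h =>
    obtain ⟨w, -, hw, rfl⟩ := h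
    rw [← polyOp_eq_smul]
    exact hS g w hw
  | zero => rw [smul_zero]; exact zero_mem _
  | add φ ψ _ _ h h' => rw [smul_add]; exact add_mem h h'
  | smul c φ _ h => rw [cochain_smul_comm]; exact Submodule.smul_mem _ c h

theorem dH_mem_polyDiff {r : ℕ} (hr : r ≤ 1) {n : ℕ} {φ : Cochain K (Poly 𝒱) n}
    (hφ : φ ∈ polyDiff 𝒱 r n) : dH 𝒱 n φ ∈ polyDiff 𝒱 r (n + 1) := by
  induction hφ using Submodule.span_induction with
  | mem φ h =>
    obtain ⟨g, w, hw, rfl⟩ := h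
    rw [polyOp_eq_smul, dH_smul]
    exact smul_mem_of_constDiff 𝒱
      (S := polyDiff 𝒱 r (n + 1))
      (fun g w hw => Submodule.subset_span ⟨g, w, fun i => by simpa using hw i, rfl⟩) g
      (dH_polyOp_mem 𝒱 hr w hw)
  | zero => rw [map_zero]; exact zero_mem _
  | add φ ψ _ _ h h' => rw [map_add]; exact add_mem h h'
  | smul c φ _ h => rw [map_smul]; exact Submodule.smul_mem _ c h

theorem barD_mem_headDiff {r : ℕ} (hr : r ≤ 1) {n : ℕ} {φ : Cochain K (Poly 𝒱) (n + 1)}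
    (hφ : φ ∈ headDiff 𝒱 r (n + 1)) : barD (n + 1) φ ∈ headDiff 𝒱 r (n + 2) := by
  refine headDiff_induction 𝒱 (p := fun φ => barD (n + 1) φ ∈ headDiff 𝒱 r (n + 2))
    (fun g w₀ w hw => ?_) ?_ (fun φ ψ h h' => ?_) (fun c φ h => ?_) hφ
  · rw [polyOp_eq_smul, barD_smul]
    refine smul_mem_of_constDiff 𝒱 (S := headDiff 𝒱 r (n + 2)) (fun g w hw => Submodule.subset_span
      ⟨g, w, fun i hi => ?_, rfl⟩) g (barD_polyOp_mem 𝒱 hr w₀ w hw)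
    simpa [hi] using hw i
  · rw [map_zero]; exact zero_mem _
  · rw [map_add]; exact add_mem h h'
  · rw [map_smul]; exact Submodule.smul_mem _ c h

omit [CharZero K] [FiniteDimensional K V] in
theorem wordDeriv_one {w : List (Σ p : ℤ, 𝒱 p)} (hw : w ≠ []) : wordDeriv 𝒱 w 1 = 0 := by
  induction w with
  | nil => exact absurd rfl hw
  | cons v w ih =>
    cases w with
    | nil => exact partialDeriv_one 𝒱 v.1 v.2
    | cons u w => rw [wordDeriv_cons, ih (by simp), map_zero]

omit [CharZero K] [FiniteDimensional K V] in
theorem evalHead_one_polyOp {n : ℕ} {w₀ : List (Σ p : ℤ, 𝒱 p)} (hw₀ : w₀ ≠ []) (g : Poly 𝒱)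
    (w : Fin n → List (Σ p : ℤ, 𝒱 p)) :
    evalHead 1 (polyOp 𝒱 g (Fin.cons w₀ w : Fin (n + 1) → _)) = 0 := by
  rw [evalHead_polyOp, map_one, wordDeriv_one 𝒱 hw₀, mul_zero, zero_smul]

omit [FiniteDimensional K V] [CharZero K] in
theorem evalHead_one_polyOp_nil {n : ℕ} (g : Poly 𝒱) (w : Fin n → List (Σ p : ℤ, 𝒱 p)) :
    evalHead 1 (polyOp 𝒱 g (Fin.cons [] w : Fin (n + 1) → _)) = polyOp 𝒱 g w := by
  rw [evalHead_polyOp, map_one, wordDeriv_nil, mul_one, ← polyOp_eq_smul]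

omit [CharZero K] [FiniteDimensional K V] in
-- Derivatives kill `1`, so only terms with empty first word survive, and the unrestricted factor
-- disappears.
theorem evalHead_one_mem_polyDiff {r n : ℕ} {φ : Cochain K (Poly 𝒱) (n + 1)}
    (hφ : φ ∈ headDiff 𝒱 r (n + 1)) : evalHead 1 φ ∈ polyDiff 𝒱 r n := by
  refine headDiff_induction 𝒱 (p := fun φ => evalHead 1 φ ∈ polyDiff 𝒱 r n)
    (fun g w₀ w hw => ?_) ?_ (fun φ ψ h h' => ?_) (fun c φ h => ?_) hφ
  · by_cases h : w₀ = []
    · subst h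
      rw [evalHead_one_polyOp_nil]
      exact Submodule.subset_span ⟨g, w, hw, rfl⟩
    · rw [evalHead_one_polyOp 𝒱 h]
      exact zero_mem _
  · rw [map_zero]; exact zero_mem _
  · rw [map_add]; exact add_mem h h'
  · rw [map_smul]; exact Submodule.smul_mem _ c h

/-- Removing the part of order zero in the first argument. -/
theorem sub_leftFace_mem_polyDiff {r : ℕ} (hr : r ≤ 1) {n : ℕ}
    {φ : Cochain K (Poly 𝒱) (n + 1)} (hφ : φ ∈ headDiff 𝒱 r (n + 1)) :
    φ - leftFace (polySign 𝒱 1) n (evalHead 1 φ) ∈ polyDiff 𝒱 r (n + 1) := by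
  refine headDiff_induction 𝒱
    (p := fun φ => φ - leftFace (polySign 𝒱 1) n (evalHead 1 φ) ∈ polyDiff 𝒱 r (n + 1))
    (fun g w₀ w hw => ?_) ?_ (fun φ ψ h h' => ?_) (fun c φ h => ?_) hφ
  · by_cases h : w₀ = []
    · subst h
      rw [evalHead_one_polyOp_nil, polyOp_eq_smul, polyOp_eq_smul 𝒱 g w, leftFace_smul,
        leftFace_polyOp, sub_self]
      exact zero_mem _
    · rw [evalHead_one_polyOp 𝒱 h, map_zero, sub_zero]
      refine Submodule.subset_span ⟨g, _, fun i => ?_, rfl⟩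
      induction i using Fin.cases with
      | zero => exact hr.trans (by simpa [Nat.one_le_iff_ne_zero] using h)
      | succ i => simpa using hw i
  · simp
  · have : φ + ψ - leftFace (polySign 𝒱 1) n (evalHead 1 (φ + ψ)) =
        (φ - leftFace (polySign 𝒱 1) n (evalHead 1 φ)) +
          (ψ - leftFace (polySign 𝒱 1) n (evalHead 1 ψ)) := by
      rw [map_add, map_add]; abel
    rw [this]; exact add_mem h h'
  · rw [map_smul, map_smul, ← cochain_smul_sub]; exact Submodule.smul_mem _ c h

omit [CharZero K] in
theorem preHead_mem_headDiff {r n : ℕ} (v : Σ p : ℤ, 𝒱 p) {φ : Cochain K (Poly 𝒱) (n + 1)}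
    (hφ : φ ∈ headDiff 𝒱 r (n + 1)) :
    preHead (partialDeriv 𝒱 v.1 v.2) φ ∈ headDiff 𝒱 r (n + 1) := by
  refine headDiff_induction 𝒱
    (p := fun φ => preHead (partialDeriv 𝒱 v.1 v.2) φ ∈ headDiff 𝒱 r (n + 1))
    (fun g w₀ w hw => ?_) ?_ (fun φ ψ h h' => ?_) (fun c φ h => ?_) hφ
  · rw [preHead_polyOp]
    exact Submodule.smul_mem _ _ (polyOp_cons_mem_headDiff 𝒱 g _ hw)
  · rw [map_zero]; exact zero_mem _
  · rw [map_add]; exact add_mem h h'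
  · rw [map_smul]; exact Submodule.smul_mem _ c h

omit [CharZero K] in
/-- A word in the first argument, as an iterated precomposition. -/
theorem polyOp_concat {n : ℕ} (v : Σ p : ℤ, 𝒱 p) (g : Poly 𝒱) (w₀ : List (Σ p : ℤ, 𝒱 p))
    (w : Fin n → List (Σ p : ℤ, 𝒱 p)) :
    polyOp 𝒱 g (Fin.cons (w₀ ++ [v]) w : Fin (n + 1) → _) =
      (-1 : K) ^ (tupleDegree 𝒱 w * v.1) •
        preHead (partialDeriv 𝒱 v.1 v.2) (polyOp 𝒱 g (Fin.cons w₀ w : Fin (n + 1) → _)) := by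
  rw [preHead_polyOp, smul_smul, neg_one_zpow_mul_self, one_smul]

/-- The canonical commutation relation, applied to the last letter of the first word, reduces to
shorter words; on the empty word the commutator vanishes. -/
theorem commHead_mem_headDiff {r n : ℕ} {m : ℤ} {x : Module.Dual K V}
    (hx : x ∈ dualGrading 𝒱 m) {φ : Cochain K (Poly 𝒱) (n + 1)}
    (hφ : φ ∈ headDiff 𝒱 r (n + 1)) : commHead 𝒱 (coord 𝒱 x) φ ∈ headDiff 𝒱 r (n + 1) := by
  refine headDiff_induction 𝒱
    (p := fun φ => commHead 𝒱 (coord 𝒱 x) φ ∈ headDiff 𝒱 r (n + 1))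
    (fun g w₀ w hw => ?_) ?_ (fun φ ψ h h' => ?_) (fun c φ h => ?_) hφ
  · induction w₀ using List.reverseRecOn with
    | nil => rw [commHead_polyOp_nil]; exact zero_mem _
    | append_singleton w₀ v ih =>
      rw [polyOp_concat, map_smul, commHead_preHead_partialDeriv 𝒱 hx]
      exact Submodule.smul_mem _ _ (add_mem
        (Submodule.smul_mem _ _ (polyOp_cons_mem_headDiff 𝒱 g _ hw))
        (Submodule.smul_mem _ _ (preHead_mem_headDiff 𝒱 v ih)))
  · rw [map_zero]; exact zero_mem _
  · rw [map_add]; exact add_mem h h'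
  · rw [map_smul]; exact Submodule.smul_mem _ c h

variable {ι : Type*} [Fintype ι] (b : Module.Basis ι K V) {d : ι → ℤ} (hb : ∀ i, b i ∈ 𝒱 (d i))

/-- The Euler operator in the first argument multiplies by the order of the first word. -/
theorem sum_preHead_commHead {n : ℕ} (g : Poly 𝒱) (w₀ : List (Σ p : ℤ, 𝒱 p))
    (w : Fin n → List (Σ p : ℤ, 𝒱 p)) :
    ∑ i, preHead (partialDeriv 𝒱 (d i) ⟨b i, hb i⟩) (commHead 𝒱 (coord 𝒱 (b.coord i))
        (polyOp 𝒱 g (Fin.cons w₀ w : Fin (n + 1) → _))) =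
      (w₀.length : K) • polyOp 𝒱 g (Fin.cons w₀ w : Fin (n + 1) → _) := by
  have hx := coord_mem_dualGrading b hb
  induction w₀ using List.reverseRecOn with
  | nil => simp [commHead_polyOp_nil]
  | append_singleton w₀ v ih =>
    rw [polyOp_concat]
    set φ := polyOp 𝒱 g (Fin.cons w₀ w : Fin (n + 1) → _)
    -- Since `x_i` and `∂_i` have opposite degrees, the signs from passing both across `∂_v` cancel.
    have h1 : ∀ i, preHead (partialDeriv 𝒱 (d i) ⟨b i, hb i⟩) (commHead 𝒱 (coord 𝒱 (b.coord i))
        (preHead (partialDeriv 𝒱 v.1 v.2) φ)) =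
        b.coord i v.2 • preHead (partialDeriv 𝒱 (d i) ⟨b i, hb i⟩) φ +
          preHead (partialDeriv 𝒱 v.1 v.2) (preHead (partialDeriv 𝒱 (d i) ⟨b i, hb i⟩)
            (commHead 𝒱 (coord 𝒱 (b.coord i)) φ)) := by
      intro i
      rw [commHead_preHead_partialDeriv 𝒱 (hx i), map_add, map_smul, map_smul,
        preHead_partialDeriv_comm, smul_smul, neg_mul, neg_one_zpow_neg, neg_one_zpow_mul_self,
        one_smul]
    have h2 : ∑ i, b.coord i v.2 • preHead (partialDeriv 𝒱 (d i) ⟨b i, hb i⟩) φ =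
        preHead (partialDeriv 𝒱 v.1 v.2) φ := by
      apply cochain_ext
      intro a
      simp only [map_sum, map_smul, evalHead_preHead]
      rw [← sum_smul_partialDeriv 𝒱 b hb v.2 a]
      change _ = φ.curryLeft _
      rw [map_sum]
      exact Finset.sum_congr rfl fun i _ => (map_smul φ.curryLeft _ _).symm
    simp only [map_smul, ← Finset.smul_sum, h1, Finset.sum_add_distrib, h2, ← map_sum, ih]
    rw [List.length_append, List.length_singleton, Nat.cast_succ, smul_comm, add_smul, one_smul]
    congr 1
    exact add_comm _ _

end Closure

/-! ### An abstract zigzag in a double complex -/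

section Zigzag

variable {K : Type*} [Field K] {X : ℕ → Type*} [∀ n, AddCommGroup (X n)] [∀ n, Module K (X n)]
  (D : ∀ n, X n →ₗ[K] X (n + 1)) (s : ∀ n, X (n + 1) →ₗ[K] X n)
  (κ : ∀ n, X (n + 1) →ₗ[K] X (n + 1))

/-- The iterate of `s ∘ κ`. -/
def descend : ∀ n, X n →ₗ[K] X 0
  | 0 => LinearMap.id
  | n + 1 => descend n ∘ₗ s n ∘ₗ κ n

theorem descend_succ (n : ℕ) (z : X (n + 1)) :
    descend s κ (n + 1) z = descend s κ n (s n (κ n z)) := rfl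

variable {D s κ} (hκκ : ∀ n z, κ n (κ n z) = 0) (hκD : ∀ n z, κ (n + 1) (D (n + 1) z) =
    D (n + 1) (κ n z)) (hκD0 : ∀ z, κ 0 (D 0 z) = 0)
  (hsD : ∀ n z, s (n + 1) (D (n + 1) z) = -z - D n (s n z))
  (hDD : ∀ n z, D (n + 1) (D n z) = 0)

include hκκ hκD hκD0 hsD in
-- Moving `D` out past `κ` and `s` leaves a differential one arity lower, covered by induction, and
-- a term of the form `-κ z`, killed by the next `κ`.
theorem descend_differential (n : ℕ) (z : X n) : descend s κ (n + 1) (D n z) = 0 := by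
  induction n with
  | zero => rw [descend_succ, hκD0, map_zero, map_zero]
  | succ n ih =>
    rw [descend_succ, hκD, hsD, map_sub, map_neg, ih, descend_succ, hκκ, map_zero, map_zero,
      neg_zero, sub_zero]

variable {Y : ∀ n : ℕ, ℕ → Submodule K (X n)}
  (hκY : ∀ n j, ∀ z ∈ Y (n + 1) j, κ n z ∈ Y (n + 1) (j + 1))
  (hsY : ∀ n j, ∀ z ∈ Y (n + 1) j, s n z ∈ Y n j)
  (hDY : ∀ n j, ∀ z ∈ Y (n + 1) j, D (n + 1) z ∈ Y (n + 2) j)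
  (hex : ∀ n j, ∀ z ∈ Y (n + 1) (j + 1), κ n z = 0 → ∃ y ∈ Y (n + 1) j, κ n y = z)

include hsD in
theorem eq_zero_of_descend_eq_zero (z : X 1) (hz : D 1 z = 0) (h0 : s 0 z = 0) : z = 0 := by
  have := hsD 0 z
  rw [hz, h0, map_zero, map_zero, sub_zero] at this
  exact neg_eq_zero.1 this.symm

include hκκ hκD hsD hDD hκY hsY hDY hex in
/-- A zigzag through a double complex with exact rows and columns. -/
theorem exists_primitive (n j : ℕ) (z : X (n + 2)) (hzY : z ∈ Y (n + 2) (j + 1))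
    (hDz : D (n + 2) z = 0) (hκz : κ (n + 1) z = 0)
    (hPz : descend s κ (n + 1) (s (n + 1) z) = 0) :
    ∃ y ∈ Y (n + 1) j, D (n + 1) (κ n y) = z := by
  have hz : D (n + 1) (s (n + 1) z) = -z := by
    have := hsD (n + 1) z
    rw [hDz, map_zero, eq_comm, sub_eq_zero] at this
    exact this.symm
  have hsz := hsY _ _ _ hzY
  have hD' : D (n + 1) (κ n (s (n + 1) z)) = 0 := by
    rw [← hκD, hz, map_neg, hκz, neg_zero]
  induction n generalizing j with
  | zero =>
    -- At the bottom `κ (s z)` is `D`-closed and has zero evaluation, so the contraction makes it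
    -- vanish.
    have h0 := eq_zero_of_descend_eq_zero hsD _ hD' hPz
    obtain ⟨y, hy, e⟩ := hex _ _ _ hsz h0
    exact ⟨-y, neg_mem hy, by rw [map_neg, e, map_neg, hz, neg_neg]⟩
  | succ n ih =>
    -- The element `κ (s z)` satisfies the same hypotheses as `z`, one arity lower and one exterior
    -- degree higher.
    have hz' : κ (n + 1) (s (n + 2) z) ∈ Y (n + 2) (j + 2) := hκY _ _ _ hsz
    have hw : D (n + 1) (s (n + 1) (κ (n + 1) (s (n + 2) z))) =
        -κ (n + 1) (s (n + 2) z) := by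
      have := hsD (n + 1) (κ (n + 1) (s (n + 2) z))
      rw [hD', map_zero, eq_comm, sub_eq_zero] at this
      exact this.symm
    obtain ⟨y', hy', e'⟩ := ih (j + 1) _ hz' hD' (hκκ _ _) hPz hw (hsY _ _ _ hz') (by
      rw [← hκD, hw, map_neg, hκκ, neg_zero])
    -- Subtracting `D y'` makes `s z` closed for `κ` without changing its image under `D`.
    obtain ⟨y, hy, e⟩ := hex _ _ _ (sub_mem hsz (hDY _ _ _ hy')) (by
      rw [map_sub, hκD, e', sub_self])
    exact ⟨-y, neg_mem hy, by rw [map_neg, e, map_neg, map_sub, hz, hDD, sub_zero, neg_neg]⟩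

end Zigzag

/-! ### Two facts of linear algebra -/

section LinearAlgebra

variable {K M : Type*} [Field K] [AddCommGroup M] [Module K M]

variable (K) in
theorem sum_sum_eq_zero_of_antisymm [CharZero K] {ι : Type*} [Fintype ι] {F : ι → ι → M}
    (hF : ∀ i j, F i j = -F j i) : ∑ i, ∑ j, F i j = 0 := by
  have h : ∑ i, ∑ j, F i j = -∑ i, ∑ j, F i j := by
    conv_lhs => rw [Finset.sum_comm]
    rw [← Finset.sum_neg_distrib]
    refine Finset.sum_congr rfl fun i _ => ?_
    rw [← Finset.sum_neg_distrib]
    exact Finset.sum_congr rfl fun j _ => hF j i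
  have h2 : (2 : K) • ∑ i, ∑ j, F i j = 0 := by
    rw [two_smul]
    nth_rw 1 [h]
    exact neg_add_cancel _
  exact (smul_eq_zero.1 h2).resolve_left two_ne_zero

/-- A linear map is injective on the span of eigenvectors with nonzero eigenvalues. -/
theorem eq_zero_of_mem_span_eigenvectors (T : M →ₗ[K] M) {z : M}
    (hz : z ∈ Submodule.span K {x | ∃ μ : K, μ ≠ 0 ∧ T x = μ • x}) (h : T z = 0) : z = 0 := by
  have hle : Submodule.span K {x | ∃ μ : K, μ ≠ 0 ∧ T x = μ • x} ≤
      ⨆ μ, ⨆ (_ : μ ≠ (0 : K)), Module.End.eigenspace T μ := by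
    rw [Submodule.span_le]
    rintro x ⟨μ, hμ, hx⟩
    exact Submodule.mem_iSup_of_mem _ (Submodule.mem_iSup_of_mem hμ
      (Module.End.mem_eigenspace_iff.2 hx))
  -- The kernel of `T` is the eigenspace for `0`, which is independent of the others.
  have hd := Module.End.eigenspaces_iSupIndep T (0 : K)
  refine Submodule.disjoint_def.1 hd z ?_ (hle hz)
  rw [Module.End.mem_eigenspace_iff, h, zero_smul]

end LinearAlgebra

/-! ### The Koszul differential and the polynomial Poincaré lemma -/

section Tensor

variable {K V : Type*} [Field K] [AddCommGroup V] [Module K V] (𝒱 : ℤ → Submodule K V)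
variable [DirectSum.Decomposition 𝒱]

/-- Polydifferential cochains with values in the graded exterior algebra. -/
abbrev KoszulCochain (n : ℕ) : Type _ := Cochain K (Poly 𝒱) n ⊗[K] Ext 𝒱

/-- The differential `barD` on `KoszulCochain`. -/
def tensorD (n : ℕ) : KoszulCochain 𝒱 n →ₗ[K] KoszulCochain 𝒱 (n + 1) :=
  LinearMap.rTensor _ (barD n)

/-- Evaluation at `1` in the first argument, on `KoszulCochain`. -/
def tensorEval (n : ℕ) : KoszulCochain 𝒱 (n + 1) →ₗ[K] KoszulCochain 𝒱 n :=
  LinearMap.rTensor _ (evalHead 1)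

omit [DirectSum.Decomposition 𝒱] in
@[simp]
theorem tensorD_tmul {n : ℕ} (φ : Cochain K (Poly 𝒱) n) (ω : Ext 𝒱) :
    tensorD 𝒱 n (φ ⊗ₜ[K] ω) = barD n φ ⊗ₜ[K] ω := rfl

omit [DirectSum.Decomposition 𝒱] in
@[simp]
theorem tensorEval_tmul {n : ℕ} (φ : Cochain K (Poly 𝒱) (n + 1)) (ω : Ext 𝒱) :
    tensorEval 𝒱 n (φ ⊗ₜ[K] ω) = evalHead 1 φ ⊗ₜ[K] ω := rfl

variable {ι : Type*} [Fintype ι] (b : Module.Basis ι K V) {d : ι → ℤ} (hb : ∀ i, b i ∈ 𝒱 (d i))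

/-- The Koszul differential. -/
def koszulD (n : ℕ) : KoszulCochain 𝒱 (n + 1) →ₗ[K] KoszulCochain 𝒱 (n + 1) :=
  ∑ i, TensorProduct.map (commHead 𝒱 (coord 𝒱 (b.coord i))) (LinearMap.mulLeft K (extι 𝒱 (b i)))

/-- The adjoint of the Koszul differential. -/
def koszulH (n : ℕ) : KoszulCochain 𝒱 (n + 1) →ₗ[K] KoszulCochain 𝒱 (n + 1) :=
  ∑ i, TensorProduct.map (preHead (partialDeriv 𝒱 (d i) ⟨b i, hb i⟩))
    (contract 𝒱 _ (dualCoord 𝒱 b hb i))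

theorem koszulD_tmul {n : ℕ} (φ : Cochain K (Poly 𝒱) (n + 1)) (ω : Ext 𝒱) :
    koszulD 𝒱 b n (φ ⊗ₜ[K] ω) =
      ∑ i, commHead 𝒱 (coord 𝒱 (b.coord i)) φ ⊗ₜ[K] (extι 𝒱 (b i) * ω) := by
  simp [koszulD]

theorem koszulH_tmul {n : ℕ} (φ : Cochain K (Poly 𝒱) (n + 1)) (ω : Ext 𝒱) :
    koszulH 𝒱 b hb n (φ ⊗ₜ[K] ω) =
      ∑ i, preHead (partialDeriv 𝒱 (d i) ⟨b i, hb i⟩) φ ⊗ₜ[K]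
        contract 𝒱 _ (dualCoord 𝒱 b hb i) ω := by
  simp [koszulH]

variable [FiniteDimensional K V]

theorem koszulD_tensorD {n : ℕ} (z : KoszulCochain 𝒱 (n + 1)) :
    koszulD 𝒱 b (n + 1) (tensorD 𝒱 (n + 1) z) = tensorD 𝒱 (n + 1) (koszulD 𝒱 b n z) := by
  induction z using TensorProduct.induction_on with
  | zero => simp
  | tmul φ ω => simp [koszulD_tmul, barD_commHead]
  | add y z hy hz => simp only [map_add, hy, hz]

omit [FiniteDimensional K V] [DirectSum.Decomposition 𝒱] in
theorem tensorEval_tensorD {n : ℕ} (z : KoszulCochain 𝒱 (n + 1)) :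
    tensorEval 𝒱 (n + 1) (tensorD 𝒱 (n + 1) z) = -z - tensorD 𝒱 n (tensorEval 𝒱 n z) := by
  induction z using TensorProduct.induction_on with
  | zero => simp only [map_zero]; abel
  | tmul φ ω =>
    rw [tensorD_tmul, tensorEval_tmul, evalHead_one_barD, TensorProduct.sub_tmul,
      TensorProduct.neg_tmul, tensorEval_tmul, tensorD_tmul]
  | add y z hy hz => simp only [map_add, hy, hz]; abel

omit [FiniteDimensional K V] [DirectSum.Decomposition 𝒱] in
theorem tensorD_tensorD {n : ℕ} (z : KoszulCochain 𝒱 n) :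
    tensorD 𝒱 (n + 1) (tensorD 𝒱 n z) = 0 := by
  induction z using TensorProduct.induction_on with
  | zero => simp
  | tmul φ ω => rw [tensorD_tmul, tensorD_tmul, barD_barD, TensorProduct.zero_tmul]
  | add y z hy hz => simp only [map_add, hy, hz, add_zero]

variable [CharZero K]

theorem koszulD_tensorD_zero (z : KoszulCochain 𝒱 0) :
    koszulD 𝒱 b 0 (tensorD 𝒱 0 z) = 0 := by
  induction z using TensorProduct.induction_on with
  | zero => simp
  | tmul φ ω => simp [koszulD_tmul, commHead_barD_zero]
  | add y z hy hz => simp only [map_add, hy, hz, add_zero]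

include hb in
theorem koszulD_koszulD {n : ℕ} (z : KoszulCochain 𝒱 (n + 1)) :
    koszulD 𝒱 b n (koszulD 𝒱 b n z) = 0 := by
  have hx := coord_mem_dualGrading b hb
  induction z using TensorProduct.induction_on with
  | zero => simp
  | add y z hy hz => simp only [map_add, hy, hz, add_zero]
  | tmul φ ω =>
    simp only [koszulD_tmul, map_sum]
    let F : ι → ι → KoszulCochain 𝒱 (n + 1) := fun i j =>
      commHead 𝒱 (coord 𝒱 (b.coord j)) (commHead 𝒱 (coord 𝒱 (b.coord i)) φ) ⊗ₜ[K]
        (extι 𝒱 (b j) * (extι 𝒱 (b i) * ω))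
    have hF : ∀ i j, F i j = -F j i := by
      intro i j
      change _ ⊗ₜ[K] _ = -(_ ⊗ₜ[K] _)
      rw [commHead_commHead 𝒱 (hx j) (hx i), ← mul_assoc, extι_mul_comm 𝒱 (hb j) (hb i),
        neg_mul (_ • _) ω, TensorProduct.tmul_neg, smul_mul_assoc, TensorProduct.smul_tmul_smul,
        neg_mul_neg, neg_one_zpow_mul_self, one_smul, mul_assoc]
    exact sum_sum_eq_zero_of_antisymm K (M := KoszulCochain 𝒱 (n + 1)) hF

/-- The commutation relations of `[·, x_j]` with `∂_i` and of `e_j` with the contraction by `x_i`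
carry opposite signs, so all mixed terms cancel. The constants `x_j(b_i)` leave the Euler operators
of the two factors. -/
theorem koszul_laplacian {n : ℕ} (φ : Cochain K (Poly 𝒱) (n + 1)) (ω : Ext 𝒱) :
    koszulD 𝒱 b n (koszulH 𝒱 b hb n (φ ⊗ₜ[K] ω)) + koszulH 𝒱 b hb n (koszulD 𝒱 b n (φ ⊗ₜ[K] ω)) =
      (∑ i, preHead (partialDeriv 𝒱 (d i) ⟨b i, hb i⟩)
        (commHead 𝒱 (coord 𝒱 (b.coord i)) φ)) ⊗ₜ[K] ω +
      φ ⊗ₜ[K] ∑ i, extι 𝒱 (b i) * contract 𝒱 _ (dualCoord 𝒱 b hb i) ω := by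
  classical
  have hx := coord_mem_dualGrading b hb
  simp only [koszulD_tmul, koszulH_tmul, map_sum]
  rw [Finset.sum_comm, ← Finset.sum_add_distrib, TensorProduct.sum_tmul, TensorProduct.tmul_sum,
    ← Finset.sum_add_distrib]
  refine Finset.sum_congr rfl fun j _ => ?_
  rw [← Finset.sum_add_distrib]
  have h : ∀ i, commHead 𝒱 (coord 𝒱 (b.coord j)) (preHead (partialDeriv 𝒱 (d i) ⟨b i, hb i⟩) φ)
        ⊗ₜ[K] (extι 𝒱 (b j) * contract 𝒱 _ (dualCoord 𝒱 b hb i) ω) +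
      preHead (partialDeriv 𝒱 (d i) ⟨b i, hb i⟩) (commHead 𝒱 (coord 𝒱 (b.coord j)) φ)
        ⊗ₜ[K] contract 𝒱 _ (dualCoord 𝒱 b hb i) (extι 𝒱 (b j) * ω) =
      if i = j then preHead (partialDeriv 𝒱 (d i) ⟨b i, hb i⟩)
        (commHead 𝒱 (coord 𝒱 (b.coord j)) φ) ⊗ₜ[K] ω +
        φ ⊗ₜ[K] (extι 𝒱 (b j) * contract 𝒱 _ (dualCoord 𝒱 b hb i) ω) else 0 := by
    intro i
    have e1 : b.coord j (b i) = if i = j then 1 else 0 := by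
      simp [Finsupp.single_apply]
    have e2 : (dualCoord 𝒱 b hb i).1 (b j) = if i = j then 1 else 0 := by
      simp [dualCoord, Finsupp.single_apply, eq_comm]
    rw [commHead_preHead_partialDeriv 𝒱 (hx j), contract_ι_mul_of_mem 𝒱 _ _ (hb j), e1, e2,
      TensorProduct.add_tmul, TensorProduct.tmul_sub, TensorProduct.smul_tmul,
      show -d j * d i = -d i * d j by ring]
    split_ifs
    · rw [one_smul, one_smul, ← TensorProduct.smul_tmul]
      abel
    · rw [zero_smul, zero_smul, TensorProduct.tmul_zero, TensorProduct.tmul_zero,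
        TensorProduct.smul_tmul]
      abel
  rw [Finset.sum_congr rfl fun i _ => h i, Finset.sum_ite_eq' Finset.univ j,
    if_pos (Finset.mem_univ j)]

/-- The polydifferential part of `KoszulCochain` in exterior degree `j`. -/
def koszulPart (r n j : ℕ) : Submodule K (KoszulCochain 𝒱 n) :=
  Submodule.map₂ (TensorProduct.mk K _ _) (headDiff 𝒱 r n) (ExtPower 𝒱 j)

omit [FiniteDimensional K V] [CharZero K] in
theorem tmul_mem_koszulPart {r n j : ℕ} {φ : Cochain K (Poly 𝒱) n} {ω : Ext 𝒱}
    (hφ : φ ∈ headDiff 𝒱 r n) (hω : ω ∈ ExtPower 𝒱 j) : φ ⊗ₜ[K] ω ∈ koszulPart 𝒱 r n j :=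
  Submodule.apply_mem_map₂ _ hφ hω

omit [FiniteDimensional K V] [CharZero K] in
theorem koszulPart_le {r n j : ℕ} {S : Submodule K (KoszulCochain 𝒱 n)}
    (h : ∀ φ ∈ headDiff 𝒱 r n, ∀ ω ∈ ExtPower 𝒱 j, φ ⊗ₜ[K] ω ∈ S) : koszulPart 𝒱 r n j ≤ S :=
  Submodule.map₂_le.2 h

omit [FiniteDimensional K V] [CharZero K] in
theorem koszulPart_succ_le {r n j : ℕ} {S : Submodule K (KoszulCochain 𝒱 (n + 1))}
    (h : ∀ g w₀ (w : Fin n → List (Σ p : ℤ, 𝒱 p)), (∀ i, r ≤ (w i).length) →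
      ∀ ω ∈ ExtPower 𝒱 j, polyOp 𝒱 g (Fin.cons w₀ w : Fin (n + 1) → _) ⊗ₜ[K] ω ∈ S) :
    koszulPart 𝒱 r (n + 1) j ≤ S := by
  refine koszulPart_le 𝒱 fun φ hφ ω hω => ?_
  refine headDiff_induction 𝒱 (p := fun φ => φ ⊗ₜ[K] ω ∈ S)
    (fun g w₀ w hw => h g w₀ w hw ω hω) ?_ (fun φ ψ h h' => ?_) (fun c φ h => ?_) hφ
  · rw [TensorProduct.zero_tmul]; exact zero_mem _
  · rw [TensorProduct.add_tmul]; exact add_mem h h'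
  · rw [← TensorProduct.smul_tmul']; exact Submodule.smul_mem _ c h

include hb in
theorem koszulD_mem {r n j : ℕ} {z : KoszulCochain 𝒱 (n + 1)}
    (hz : z ∈ koszulPart 𝒱 r (n + 1) j) :
    koszulD 𝒱 b n z ∈ koszulPart 𝒱 r (n + 1) (j + 1) := by
  refine koszulPart_le 𝒱 (S := (koszulPart 𝒱 r (n + 1) (j + 1)).comap (koszulD 𝒱 b n))
    (fun φ hφ ω hω => ?_) hz
  rw [Submodule.mem_comap, koszulD_tmul]
  exact Submodule.sum_mem _ fun i _ => tmul_mem_koszulPart 𝒱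
    (commHead_mem_headDiff 𝒱 (coord_mem_dualGrading b hb i) hφ) (ι_mul_mem_extPower 𝒱 _ hω)

omit [CharZero K] in
theorem koszulH_mem {r n j : ℕ} {z : KoszulCochain 𝒱 (n + 1)}
    (hz : z ∈ koszulPart 𝒱 r (n + 1) (j + 1)) :
    koszulH 𝒱 b hb n z ∈ koszulPart 𝒱 r (n + 1) j := by
  refine koszulPart_le 𝒱 (S := (koszulPart 𝒱 r (n + 1) j).comap (koszulH 𝒱 b hb n))
    (fun φ hφ ω hω => ?_) hz
  rw [Submodule.mem_comap, koszulH_tmul]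
  exact Submodule.sum_mem _ fun i _ => tmul_mem_koszulPart 𝒱
    (preHead_mem_headDiff 𝒱 ⟨d i, b i, hb i⟩ hφ) (contract_mem_extPower 𝒱 _ _ _ hω)

theorem tensorD_mem {r : ℕ} (hr : r ≤ 1) {n j : ℕ} {z : KoszulCochain 𝒱 (n + 1)}
    (hz : z ∈ koszulPart 𝒱 r (n + 1) j) :
    tensorD 𝒱 (n + 1) z ∈ koszulPart 𝒱 r (n + 2) j :=
  koszulPart_le 𝒱 (S := (koszulPart 𝒱 r (n + 2) j).comap (tensorD 𝒱 (n + 1)))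
    (fun _ hφ _ hω => tmul_mem_koszulPart 𝒱 (barD_mem_headDiff 𝒱 hr hφ) hω) hz

omit [CharZero K] [FiniteDimensional K V] in
theorem tensorEval_mem {r n j : ℕ} {z : KoszulCochain 𝒱 (n + 1)}
    (hz : z ∈ koszulPart 𝒱 r (n + 1) j) :
    tensorEval 𝒱 n z ∈ koszulPart 𝒱 r n j :=
  koszulPart_le 𝒱 (S := (koszulPart 𝒱 r n j).comap (tensorEval 𝒱 n))
    (fun _ hφ _ hω => tmul_mem_koszulPart 𝒱
      (polyDiff_le_headDiff 𝒱 r n (evalHead_one_mem_polyDiff 𝒱 hφ)) hω) hz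

/-- The Laplacian of the Koszul differential. -/
def koszulT (n : ℕ) : KoszulCochain 𝒱 (n + 1) →ₗ[K] KoszulCochain 𝒱 (n + 1) :=
  koszulD 𝒱 b n ∘ₗ koszulH 𝒱 b hb n + koszulH 𝒱 b hb n ∘ₗ koszulD 𝒱 b n

theorem koszulT_tmul {n j : ℕ} (g : Poly 𝒱) (w₀ : List (Σ p : ℤ, 𝒱 p))
    (w : Fin n → List (Σ p : ℤ, 𝒱 p)) {ω : Ext 𝒱} (hω : ω ∈ ExtPower 𝒱 j) :
    koszulT 𝒱 b hb n (polyOp 𝒱 g (Fin.cons w₀ w : Fin (n + 1) → _) ⊗ₜ[K] ω) =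
      ((w₀.length + j : ℕ) : K) • (polyOp 𝒱 g (Fin.cons w₀ w : Fin (n + 1) → _) ⊗ₜ[K] ω) := by
  rw [koszulT, LinearMap.add_apply, LinearMap.comp_apply, LinearMap.comp_apply, koszul_laplacian,
    sum_preHead_commHead, sum_contract 𝒱 b hb j hω, TensorProduct.tmul_smul, Nat.cast_add,
    add_smul, TensorProduct.smul_tmul', TensorProduct.smul_tmul']

/-- In positive exterior degree the weight is a positive integer, hence invertible in characteristic
zero. -/
theorem koszulPart_le_map_koszulT (r n j : ℕ) : koszulPart 𝒱 r (n + 1) (j + 1) ≤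
    (koszulPart 𝒱 r (n + 1) (j + 1)).map (koszulT 𝒱 b hb n) := by
  refine koszulPart_succ_le 𝒱 fun g w₀ w hw ω hω => ?_
  have h : ((w₀.length + (j + 1) : ℕ) : K) ≠ 0 := Nat.cast_ne_zero.2 (by omega)
  refine ⟨((w₀.length + (j + 1) : ℕ) : K)⁻¹ •
    (polyOp 𝒱 g (Fin.cons w₀ w : Fin (n + 1) → _) ⊗ₜ[K] ω), Submodule.smul_mem _ _
      (tmul_mem_koszulPart 𝒱 (polyOp_cons_mem_headDiff 𝒱 g w₀ hw) hω), ?_⟩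
  rw [map_smul, koszulT_tmul 𝒱 b hb g w₀ w hω, smul_smul, inv_mul_cancel₀ h, one_smul]

/-- Independence of the eigenspaces gives injectivity without a basis of the space of operators,
whose spanning words satisfy linear relations. -/
theorem eq_zero_of_koszulT_eq_zero {r n j : ℕ} {z : KoszulCochain 𝒱 (n + 1)}
    (hz : z ∈ koszulPart 𝒱 r (n + 1) (j + 1)) (h : koszulT 𝒱 b hb n z = 0) : z = 0 := by
  have hle : koszulPart 𝒱 r (n + 1) (j + 1) ≤
      Submodule.span K {x | ∃ μ : K, μ ≠ 0 ∧ koszulT 𝒱 b hb n x = μ • x} := by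
    refine koszulPart_succ_le 𝒱 fun g w₀ w hw ω hω => ?_
    refine Submodule.subset_span ⟨_, ?_, koszulT_tmul 𝒱 b hb g w₀ w hω⟩
    exact Nat.cast_ne_zero.2 (by omega)
  refine eq_zero_of_mem_span_eigenvectors (M := KoszulCochain 𝒱 (n + 1)) (koszulT 𝒱 b hb n) ?_ h
  exact hle hz

include hb in
/-- The polynomial Poincaré lemma. -/
theorem exists_koszulD_eq {r n j : ℕ} {z : KoszulCochain 𝒱 (n + 1)}
    (hz : z ∈ koszulPart 𝒱 r (n + 1) (j + 1)) (h : koszulD 𝒱 b n z = 0) :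
    ∃ y ∈ koszulPart 𝒱 r (n + 1) j, koszulD 𝒱 b n y = z := by
  obtain ⟨z', hz', rfl⟩ := koszulPart_le_map_koszulT 𝒱 b hb r n j hz
  have e : koszulT 𝒱 b hb n z' = koszulD 𝒱 b n (koszulH 𝒱 b hb n z') +
    koszulH 𝒱 b hb n (koszulD 𝒱 b n z') := rfl
  -- The Laplacian commutes with `κ`, so it kills `κ z'`. Its injectivity one exterior degree higher
  -- gives `κ z' = 0`, and the Laplacian of `z'` reduces to `κ` of `koszulH z'`.
  have h1 : koszulT 𝒱 b hb n (koszulD 𝒱 b n z') = 0 := by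
    rw [e, map_add, koszulD_koszulD 𝒱 b hb, zero_add] at h
    change koszulD 𝒱 b n (koszulH 𝒱 b hb n (koszulD 𝒱 b n z')) +
      koszulH 𝒱 b hb n (koszulD 𝒱 b n (koszulD 𝒱 b n z')) = 0
    rw [h, koszulD_koszulD 𝒱 b hb, map_zero, add_zero]
  have h2 := eq_zero_of_koszulT_eq_zero 𝒱 b hb (koszulD_mem 𝒱 b hb hz') h1
  refine ⟨koszulH 𝒱 b hb n z', koszulH_mem 𝒱 b hb hz', ?_⟩
  rw [e, h2, map_zero, add_zero]

end Tensor

/-! ### An isomorphism with a subquotient -/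

section Subquotient

variable {K M N W : Type*} [Field K] [AddCommGroup M] [Module K M] [AddCommGroup N] [Module K N]
  [AddCommGroup W] [Module K W]

/-- The equivalence is the inverse of the map induced by `P`; its value at `w` can be read off from
any representative whose image under `P` is `J w`. -/
theorem exists_equiv_subquotient {Z B : Submodule K M} (P : M →ₗ[K] N) (J : W →ₗ[K] N)
    (hJ : Function.Injective J) (hP : ∀ z ∈ Z, P z ∈ LinearMap.range J)
    (hsurj : ∀ w, ∃ z ∈ Z, P z = J w) (hker : ∀ z ∈ Z, P z = 0 ↔ z ∈ B) :
    ∃ Φ : W ≃ₗ[K] Subquotient Z B, ∀ (w : W) (z : Z), P z = J w → Φ w = Subquotient.mk Z B z := by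
  let Q : Z →ₗ[K] W := (LinearEquiv.ofInjective J hJ).symm.toLinearMap ∘ₗ
    (P ∘ₗ Z.subtype).codRestrict (LinearMap.range J) fun z => hP z z.2
  have hQ : ∀ z, J (Q z) = P z := fun z =>
    congrArg Subtype.val ((LinearEquiv.ofInjective J hJ).apply_symm_apply _)
  have hQs : Function.Surjective Q := by
    intro w
    obtain ⟨z, hz, e⟩ := hsurj w
    exact ⟨⟨z, hz⟩, hJ ((hQ _).trans e)⟩
  have hQk : B.submoduleOf Z = LinearMap.ker Q := by
    ext z
    change (z : M) ∈ B ↔ Q z = 0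
    rw [← hker z z.2, ← hQ, map_eq_zero_iff J hJ]
  let Φ : (Z ⧸ B.submoduleOf Z) ≃ₗ[K] W :=
    (Submodule.quotEquivOfEq _ _ hQk).trans (Q.quotKerEquivOfSurjective hQs)
  have hΦ : ∀ z : Z, Φ ((B.submoduleOf Z).mkQ z) = Q z := fun z => rfl
  refine ⟨Φ.symm, fun w z h => ?_⟩
  change Φ.symm w = (B.submoduleOf Z).mkQ z
  rw [LinearEquiv.symm_apply_eq, hΦ]
  exact hJ (by rw [hQ, h])

end Subquotient

/-! ### Internal degrees -/

section Degree

variable {K V : Type*} [Field K] [AddCommGroup V] [Module K V] (𝒱 : ℤ → Submodule K V)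

theorem one_mem_polyDegree : (1 : Poly 𝒱) ∈ polyDegree 𝒱 0 :=
  Submodule.subset_span ⟨0, Fin.elim0, Fin.elim0, fun i => i.elim0, by simp, by simp⟩

theorem coord_mul_mem_polyDegree {e n : ℤ} {x : Module.Dual K V} (hx : x ∈ dualGrading 𝒱 e)
    {f : Poly 𝒱} (hf : f ∈ polyDegree 𝒱 n) : coord 𝒱 x * f ∈ polyDegree 𝒱 (e + n) := by
  induction hf using Submodule.span_induction with
  | mem f h =>
    obtain ⟨m, y, d, hy, rfl, rfl⟩ := h
    refine Submodule.subset_span ⟨m + 1, Fin.cons x y, Fin.cons e d, fun i => ?_, ?_, ?_⟩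
    · induction i using Fin.cases with
      | zero => exact hx
      | succ i => exact hy i
    · simp [Fin.sum_univ_succ]
    · simp [List.ofFn_succ]
  | zero => rw [mul_zero]; exact zero_mem _
  | add f g _ _ hf hg => rw [mul_add]; exact add_mem hf hg
  | smul c f _ hf => rw [mul_smul_comm]; exact Submodule.smul_mem _ c hf

theorem polyDegree_induction {p : ℤ → Poly 𝒱 → Prop} (hone : p 0 1)
    (hmul : ∀ e n x f, x ∈ dualGrading 𝒱 e → f ∈ polyDegree 𝒱 n → p n f →
      p (e + n) (coord 𝒱 x * f))
    (hzero : ∀ n, p n 0) (hadd : ∀ n f g, p n f → p n g → p n (f + g))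
    (hsmul : ∀ n (c : K) f, p n f → p n (c • f)) {n : ℤ} {f : Poly 𝒱}
    (hf : f ∈ polyDegree 𝒱 n) : p n f := by
  induction hf using Submodule.span_induction with
  | mem f h =>
    obtain ⟨m, y, d, hy, rfl, rfl⟩ := h
    induction m with
    | zero => simpa using hone
    | succ m ih =>
      rw [List.ofFn_succ, List.prod_cons, Fin.sum_univ_succ]
      exact hmul _ _ _ _ (hy 0)
        (Submodule.subset_span ⟨m, _, _, fun i => hy i.succ, rfl, rfl⟩)
        (ih _ _ fun i => hy i.succ)
  | zero => exact hzero n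
  | add f g _ _ hf hg => exact hadd n f g hf hg
  | smul c f _ hf => exact hsmul n c f hf

theorem mul_mem_polyDegree {m n : ℤ} {f g : Poly 𝒱} (hf : f ∈ polyDegree 𝒱 m)
    (hg : g ∈ polyDegree 𝒱 n) : f * g ∈ polyDegree 𝒱 (m + n) := by
  refine polyDegree_induction 𝒱 (p := fun m f => f * g ∈ polyDegree 𝒱 (m + n)) ?_
    (fun e m x f hx _ h => ?_) (fun m => ?_) (fun m f f' h h' => ?_) (fun m c f h => ?_) hf
  · rwa [one_mul, zero_add]
  · rw [mul_assoc, add_assoc]; exact coord_mul_mem_polyDegree 𝒱 hx h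
  · rw [zero_mul]; exact zero_mem _
  · rw [add_mul]; exact add_mem h h'
  · rw [smul_mul_assoc]; exact Submodule.smul_mem _ c h

variable [DirectSum.Decomposition 𝒱] [FiniteDimensional K V]

omit [FiniteDimensional K V] in
theorem polySign_mem_polyDegree (p : ℤ) {n : ℤ} {f : Poly 𝒱} (hf : f ∈ polyDegree 𝒱 n) :
    polySign 𝒱 p f ∈ polyDegree 𝒱 n := by
  refine polyDegree_induction 𝒱 (p := fun n f => polySign 𝒱 p f ∈ polyDegree 𝒱 n) ?_
    (fun e m x f hx _ h => ?_) (fun m => ?_) (fun m f f' h h' => ?_) (fun m c f h => ?_) hf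
  · rw [map_one]; exact one_mem_polyDegree 𝒱
  · rw [map_mul, polySign_coord 𝒱 p hx, smul_mul_assoc]
    exact Submodule.smul_mem _ _ (coord_mul_mem_polyDegree 𝒱 hx h)
  · rw [map_zero]; exact zero_mem _
  · rw [map_add]; exact add_mem h h'
  · rw [map_smul]; exact Submodule.smul_mem _ c h

omit [FiniteDimensional K V] in
theorem partialDeriv_mem_polyDegree (p : ℤ) (v : 𝒱 p) {n : ℤ} {f : Poly 𝒱}
    (hf : f ∈ polyDegree 𝒱 n) : partialDeriv 𝒱 p v f ∈ polyDegree 𝒱 (p + n) := by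
  refine polyDegree_induction 𝒱 (p := fun n f => partialDeriv 𝒱 p v f ∈ polyDegree 𝒱 (p + n)) ?_
    (fun e m x f hx hf h => ?_) (fun m => ?_) (fun m f f' h h' => ?_) (fun m c f h => ?_) hf
  · rw [partialDeriv_one]; exact zero_mem _
  · rw [partialDeriv_mul, partialDeriv_coord, polySign_coord 𝒱 p hx, ← Algebra.smul_def,
      smul_mul_assoc]
    refine add_mem ?_ (Submodule.smul_mem _ _ ?_)
    · by_cases hp : p = -e
      · rw [show p + (e + m) = m by omega]
        exact Submodule.smul_mem _ _ hf
      · rw [hx p hp v v.2, zero_smul]; exact zero_mem _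
    · rw [add_left_comm]; exact coord_mul_mem_polyDegree 𝒱 hx h
  · rw [map_zero]; exact zero_mem _
  · rw [map_add]; exact add_mem h h'
  · rw [map_smul]; exact Submodule.smul_mem _ c h

omit [FiniteDimensional K V] in
theorem wordDeriv_mem_polyDegree (w : List (Σ p : ℤ, 𝒱 p)) {n : ℤ} {f : Poly 𝒱}
    (hf : f ∈ polyDegree 𝒱 n) : wordDeriv 𝒱 w f ∈ polyDegree 𝒱 (wordDegree 𝒱 w + n) := by
  induction w with
  | nil => simpa using hf
  | cons v w ih =>
    rw [wordDeriv_cons, wordDegree_cons, add_assoc]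
    exact partialDeriv_mem_polyDegree 𝒱 _ _ ih

omit [DirectSum.Decomposition 𝒱] [FiniteDimensional K V] in
theorem cochainDegree_zero_iff {n : ℤ} {φ : Cochain K (Poly 𝒱) 0} :
    φ ∈ cochainDegree 𝒱 0 n ↔ φ ![] ∈ polyDegree 𝒱 n := by
  constructor
  · intro h
    simpa using h Fin.elim0 ![] fun i => i.elim0
  · intro h e f _
    rw [Subsingleton.elim f ![]]
    simpa using h

omit [DirectSum.Decomposition 𝒱] [FiniteDimensional K V] in
theorem cochainDegree_succ_iff {k : ℕ} {n : ℤ} {φ : Cochain K (Poly 𝒱) (k + 1)} :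
    φ ∈ cochainDegree 𝒱 (k + 1) n ↔
      ∀ m, ∀ a ∈ polyDegree 𝒱 m, evalHead a φ ∈ cochainDegree 𝒱 k (n + m) := by
  constructor
  · intro h m a ha e f hf
    have := h (Fin.cons m e) (Fin.cons a f) fun i => by
      induction i using Fin.cases with
      | zero => exact ha
      | succ i => exact hf i
    simpa [Fin.sum_univ_succ, add_assoc] using this
  · intro h e f hf
    have := h _ _ (hf 0) (Fin.tail e) (Fin.tail f) fun i => hf i.succ
    rw [evalHead_apply, Fin.cons_self_tail, add_assoc] at this
    rw [Fin.sum_univ_succ]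
    exact this

omit [DirectSum.Decomposition 𝒱] [FiniteDimensional K V] in
theorem smul_mem_cochainDegree {k : ℕ} {m n : ℤ} {g : Poly 𝒱} {φ : Cochain K (Poly 𝒱) k}
    (hg : g ∈ polyDegree 𝒱 m) (hφ : φ ∈ cochainDegree 𝒱 k n) :
    g • φ ∈ cochainDegree 𝒱 k (m + n) := by
  intro e f hf
  rw [add_assoc]
  exact mul_mem_polyDegree 𝒱 hg (hφ e f hf)

omit [FiniteDimensional K V] in
theorem conj_mem_cochainDegree {k : ℕ} {n : ℤ} {φ : Cochain K (Poly 𝒱) k}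
    (hφ : φ ∈ cochainDegree 𝒱 k n) : conj (polySign 𝒱 1) φ ∈ cochainDegree 𝒱 k n :=
  fun e _ hf => polySign_mem_polyDegree 𝒱 1
    (hφ e _ fun i => polySign_mem_polyDegree 𝒱 1 (hf i))

omit [DirectSum.Decomposition 𝒱] [FiniteDimensional K V] in
theorem evalHead_one_mem_cochainDegree {k : ℕ} {n : ℤ} {φ : Cochain K (Poly 𝒱) (k + 1)}
    (hφ : φ ∈ cochainDegree 𝒱 (k + 1) n) : evalHead 1 φ ∈ cochainDegree 𝒱 k n := by
  simpa using (cochainDegree_succ_iff 𝒱).1 hφ 0 1 (one_mem_polyDegree 𝒱)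

omit [FiniteDimensional K V] in
theorem polyOp_mem_cochainDegree {k : ℕ} {m : ℤ} {g : Poly 𝒱} (hg : g ∈ polyDegree 𝒱 m)
    (w : Fin k → List (Σ p : ℤ, 𝒱 p)) :
    polyOp 𝒱 g w ∈ cochainDegree 𝒱 k (m + tupleDegree 𝒱 w) := by
  rw [polyOp_eq_smul]
  refine smul_mem_cochainDegree 𝒱 hg ?_
  induction k with
  | zero =>
    rw [cochainDegree_zero_iff, polyOp_nil]
    simpa [tupleDegree] using one_mem_polyDegree 𝒱
  | succ k ih =>
    obtain ⟨w₀, w, rfl⟩ : ∃ w₀ w', w = Fin.cons w₀ w' := ⟨_, _, (Fin.cons_self_tail w).symm⟩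
    rw [cochainDegree_succ_iff]
    intro l a ha
    rw [evalHead_polyOp, one_mul, tupleDegree_cons, add_right_comm]
    exact smul_mem_cochainDegree 𝒱
      (wordDeriv_mem_polyDegree 𝒱 w₀ (polySign_mem_polyDegree 𝒱 _ ha)) (ih w)

variable [CharZero K]

omit [FiniteDimensional K V] in
theorem commHead_mem_cochainDegree {k : ℕ} {m n : ℤ} {x : Module.Dual K V}
    (hx : x ∈ dualGrading 𝒱 m) {φ : Cochain K (Poly 𝒱) (k + 1)}
    (hφ : φ ∈ cochainDegree 𝒱 (k + 1) n) :
    commHead 𝒱 (coord 𝒱 x) φ ∈ cochainDegree 𝒱 (k + 1) (m + n) := by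
  have hc : coord 𝒱 x ∈ polyDegree 𝒱 m := by
    simpa using coord_mul_mem_polyDegree 𝒱 hx (one_mem_polyDegree 𝒱)
  have h1 : koszulMul (polySign 𝒱 1) (coord 𝒱 x) φ ∈ cochainDegree 𝒱 (k + 1) (m + n) := by
    rcases Int.even_or_odd m with hm | hm
    · rw [koszulMul_coord_even 𝒱 hm hx]
      exact smul_mem_cochainDegree 𝒱 hc hφ
    · rw [koszulMul_coord_odd 𝒱 hm hx]
      exact smul_mem_cochainDegree 𝒱 hc (conj_mem_cochainDegree 𝒱 hφ)
  have h2 : preHead (LinearMap.mulLeft K (coord 𝒱 x)) φ ∈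
      cochainDegree 𝒱 (k + 1) (m + n) := by
    rw [cochainDegree_succ_iff]
    intro l a ha
    rw [evalHead_preHead, LinearMap.mulLeft_apply, show m + n + l = n + (m + l) by ring]
    exact (cochainDegree_succ_iff 𝒱).1 hφ _ _ (coord_mul_mem_polyDegree 𝒱 hx ha)
  rw [commHead_apply, sub_eq_add_neg, ← neg_one_smul K]
  exact add_mem h2 (Submodule.smul_mem _ _ h1)

end Degree

/-! ### Wedge products of homogeneous vectors -/

section Wedge

variable {K V : Type*} [Field K] [AddCommGroup V] [Module K V] (𝒱 : ℤ → Submodule K V)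

theorem coe_wedge_cons {k : ℕ} (v : Σ p : ℤ, 𝒱 p) (w : Fin k → Σ p : ℤ, 𝒱 p) :
    (wedge 𝒱 (fun i => (((Fin.cons v w : Fin (k + 1) → Σ p : ℤ, 𝒱 p) i).2 : V)) : Ext 𝒱) =
      extι 𝒱 v.2 * wedge 𝒱 (fun i => ((w i).2 : V)) := by
  simp only [wedge, List.ofFn_succ, List.prod_cons]
  rfl

theorem extPower_le_span_wedge [DirectSum.Decomposition 𝒱] (k : ℕ) :
    ExtPower 𝒱 k ≤ Submodule.span K {ω | ∃ v : Fin k → Σ p : ℤ, 𝒱 p,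
      ω = (wedge 𝒱 (fun i => ((v i).2 : V)) : Ext 𝒱)} := by
  induction k with
  | zero =>
    change LinearMap.range _ ^ 0 ≤ _
    rw [pow_zero, Submodule.one_le]
    exact Submodule.subset_span ⟨Fin.elim0, by simp [wedge]⟩
  | succ k ih =>
    intro ω hω
    refine extPower_induction 𝒱 (fun a b ha hb => add_mem ha hb) (fun v ω hω => ?_) hω
    have hs := ih hω
    clear hω
    induction hs using Submodule.span_induction with
    | mem ω h =>
      obtain ⟨w, rfl⟩ := h
      induction v using DirectSum.Decomposition.inductionOn 𝒱 with
      | zero => rw [map_zero, zero_mul]; exact zero_mem _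
      | @homogeneous p v =>
        exact Submodule.subset_span ⟨Fin.cons ⟨p, v⟩ w, (coe_wedge_cons 𝒱 ⟨p, v⟩ w).symm⟩
      | add v v' h h' => rw [map_add, add_mul]; exact add_mem h h'
    | zero => rw [mul_zero]; exact zero_mem _
    | add a b _ _ ha hb => rw [mul_add]; exact add_mem ha hb
    | smul c a _ ha => rw [mul_smul_comm]; exact Submodule.smul_mem _ c ha

theorem wedge_mul_ι {k : ℕ} (w : Fin k → Σ p : ℤ, 𝒱 p) {p : ℤ} (v : 𝒱 p) :
    (wedge 𝒱 (fun i => ((w i).2 : V)) : Ext 𝒱) * extι 𝒱 v =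
      ((-1 : K) ^ k * (-1) ^ ((∑ i, (w i).1) * p)) •
        (extι 𝒱 (v : V) * wedge 𝒱 (fun i => ((w i).2 : V))) := by
  induction k with
  | zero => simp [wedge]
  | succ k ih =>
    obtain ⟨u, w, rfl⟩ : ∃ u w', w = Fin.cons u w' := ⟨_, _, (Fin.cons_self_tail w).symm⟩
    rw [coe_wedge_cons, mul_assoc, ih, mul_smul_comm, ← mul_assoc, KoszulAlgebra.ι_mul_ι _ _ u.2.2
      v.2, smul_mul_assoc, smul_smul]
    rw [Fin.sum_univ_succ, Fin.cons_zero, add_mul, zpow_add₀ (by simp), pow_succ]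
    simp only [Fin.cons_succ]
    refine congrArg₂ (fun (c : K) (x : Ext 𝒱) => c • x) (by ring) (mul_assoc _ _ _)

end Wedge

/-! ### The symbol map and its kernel on cocycles -/

section Symbol

variable {K V : Type*} [Field K] [AddCommGroup V] [Module K V] (𝒱 : ℤ → Submodule K V)

/-- The inclusion of `∧^k V ⊗ 𝒪_V` into the cochains of arity zero with values in `∧V`. -/
def polyvectorIncl (k : ℕ) : ExtPower 𝒱 k ⊗[K] Poly 𝒱 →ₗ[K] KoszulCochain 𝒱 0 :=
  TensorProduct.map (MultilinearMap.constLinearEquivOfIsEmpty (R := K) (S := K)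
    (M₁ := fun _ : Fin 0 => Poly 𝒱) (M₂ := Poly 𝒱)).toLinearMap (ExtPower 𝒱 k).subtype ∘ₗ
      (TensorProduct.comm K _ _).toLinearMap

theorem polyvectorIncl_tmul {k : ℕ} (ω : ExtPower 𝒱 k) (φ : Cochain K (Poly 𝒱) 0) :
    polyvectorIncl 𝒱 k (ω ⊗ₜ[K] φ ![]) = φ ⊗ₜ[K] (ω : Ext 𝒱) := by
  have : MultilinearMap.constLinearEquivOfIsEmpty (R := K) (S := K)
      (M₁ := fun _ : Fin 0 => Poly 𝒱) (M₂ := Poly 𝒱) (φ ![]) = φ := by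
    ext x
    rw [Subsingleton.elim x ![]]
    rfl
  change _ ⊗ₜ[K] _ = _
  rw [Submodule.subtype_apply]
  exact congrArg (fun χ => χ ⊗ₜ[K] (ω : Ext 𝒱)) this

theorem polyvectorIncl_injective (k : ℕ) : Function.Injective (polyvectorIncl 𝒱 k) := by
  rw [polyvectorIncl, LinearMap.coe_comp]
  refine Function.Injective.comp ?_ (LinearEquiv.injective _)
  exact TensorProduct.map_injective_of_flat_flat _ _ (LinearEquiv.injective _)
    (Submodule.subtype_injective _)

variable [DirectSum.Decomposition 𝒱]
variable {ι : Type*} [Fintype ι] (b : Module.Basis ι K V) {d : ι → ℤ} (hb : ∀ i, b i ∈ 𝒱 (d i))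

/-- The symbol map, which inverts the Hochschild–Kostant–Rosenberg map up to sign. -/
def symbol (n : ℕ) : KoszulCochain 𝒱 n →ₗ[K] KoszulCochain 𝒱 0 :=
  descend (X := KoszulCochain 𝒱) (tensorEval 𝒱) (koszulD 𝒱 b) n

theorem symbol_succ (n : ℕ) (z : KoszulCochain 𝒱 (n + 1)) :
    symbol 𝒱 b (n + 1) z = symbol 𝒱 b n (tensorEval 𝒱 n (koszulD 𝒱 b n z)) := rfl

variable [FiniteDimensional K V] [CharZero K]

omit [FiniteDimensional K V] [CharZero K] in
theorem koszulPart_zero_le_range (r k : ℕ) :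
    koszulPart 𝒱 r 0 k ≤ LinearMap.range (polyvectorIncl 𝒱 k) :=
  koszulPart_le 𝒱 fun φ _ ω hω => ⟨⟨ω, hω⟩ ⊗ₜ φ ![], polyvectorIncl_tmul 𝒱 ⟨ω, hω⟩ φ⟩

include hb in
theorem symbol_mem_koszulPart {r n j : ℕ} {z : KoszulCochain 𝒱 n} (hz : z ∈ koszulPart 𝒱 r n j) :
    symbol 𝒱 b n z ∈ koszulPart 𝒱 r 0 (j + n) := by
  induction n generalizing j with
  | zero => exact hz
  | succ n ih =>
    rw [symbol_succ, ← add_assoc, add_right_comm]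
    exact ih (tensorEval_mem 𝒱 (koszulD_mem 𝒱 b hb hz))

include hb in
theorem symbol_barD (n : ℕ) (z : KoszulCochain 𝒱 n) :
    symbol 𝒱 b (n + 1) (tensorD 𝒱 n z) = 0 :=
  descend_differential (X := KoszulCochain 𝒱) (D := tensorD 𝒱) (fun _ => koszulD_koszulD 𝒱 b hb)
    (fun _ => koszulD_tensorD 𝒱 b) (koszulD_tensorD_zero 𝒱 b) (fun _ => tensorEval_tensorD 𝒱) n z

theorem koszulD_leftFace {n : ℕ} (φ : Cochain K (Poly 𝒱) n) (ω : Ext 𝒱) :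
    koszulD 𝒱 b n (leftFace (polySign 𝒱 1) n φ ⊗ₜ[K] ω) = 0 := by
  simp [koszulD_tmul, commHead_leftFace]

include hb in
-- The left face is killed by the first application of `κ`, the bar part by `descend_differential`.
theorem symbol_dH {n : ℕ} (φ : Cochain K (Poly 𝒱) n) (ω : Ext 𝒱) :
    symbol 𝒱 b (n + 1) (dH 𝒱 n φ ⊗ₜ[K] ω) = 0 := by
  have h : dH 𝒱 n φ = leftFace (polySign 𝒱 1) n φ + barD n φ := by
    rw [dH, hochschildD_eq, LinearMap.add_apply]
  rw [h, TensorProduct.add_tmul, map_add, symbol_succ,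
    koszulD_leftFace, map_zero, map_zero, zero_add, ← tensorD_tmul, symbol_barD 𝒱 b hb]

/-- The sign of the order reversing permutation of `k` letters. -/
def reversalSign : ℕ → K
  | 0 => 1
  | k + 1 => (-1) ^ k * reversalSign k

omit [CharZero K] in
theorem reversalSign_mul_self (k : ℕ) : (reversalSign k : K) * reversalSign k = 1 := by
  induction k with
  | zero => exact one_mul 1
  | succ k ih =>
    rw [reversalSign, mul_mul_mul_comm, ih, mul_one, ← mul_pow]
    simp

omit [CharZero K] in
-- Each step extracts the first vector and puts it to the left of those extracted before, so they
-- come out in reverse order. Restoring the order costs `reversalSign`, and the degree dependent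
-- signs cancel against the Koszul signs of the operator.
theorem symbol_polyOp {n : ℕ} (f : Poly 𝒱) (v : Fin n → Σ p : ℤ, 𝒱 p) (ω : Ext 𝒱) :
    symbol 𝒱 b n (polyOp 𝒱 f (fun i => [v i]) ⊗ₜ[K] ω) = (reversalSign n : K) •
      (polyOp 𝒱 f (Fin.elim0 : Fin 0 → List (Σ p : ℤ, 𝒱 p)) ⊗ₜ[K]
        ((wedge 𝒱 (fun i => ((v i).2 : V)) : Ext 𝒱) * ω)) := by
  induction n generalizing ω with
  | zero =>
    have h : (fun i => [v i]) = (Fin.elim0 : Fin 0 → List (Σ p : ℤ, 𝒱 p)) :=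
      Subsingleton.elim _ _
    simp [symbol, descend, reversalSign, wedge, h]
  | succ n ih =>
    obtain ⟨u, w, rfl⟩ : ∃ u w', v = Fin.cons u w' := ⟨_, _, (Fin.cons_self_tail v).symm⟩
    have hw : (fun i => [(Fin.cons u w : Fin (n + 1) → Σ p : ℤ, 𝒱 p) i]) =
        (Fin.cons [u] (fun i => [w i]) : Fin (n + 1) → _) := by
      ext i
      induction i using Fin.cases <;> rfl
    have hq : tupleDegree 𝒱 (fun i => [w i]) = ∑ i, (w i).1 := by simp [tupleDegree]
    -- A derivation kills `1`, so at `1` only the term of the commutator with `x_i` inside the first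
    -- argument survives.
    have h1 : ∀ i, evalHead 1 (commHead 𝒱 (coord 𝒱 (b.coord i))
        (polyOp 𝒱 f (Fin.cons [u] (fun i => [w i]) : Fin (n + 1) → _))) =
        b.coord i u.2 • (-1 : K) ^ ((∑ i, (w i).1) * u.1) • polyOp 𝒱 f (fun i => [w i]) := by
      intro i
      rw [commHead_apply, map_sub, evalHead_preHead, LinearMap.mulLeft_apply, mul_one, koszulMul,
        map_add, evalHead_smul_apply, evalHead_smul_apply, evalHead_conj, map_one,
        evalHead_one_polyOp 𝒱 (by simp), map_zero, smul_zero, smul_zero, add_zero, sub_zero,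
        evalHead_polyOp, hq, wordDeriv_cons, wordDeriv_nil, partialDeriv_polySign,
        partialDeriv_coord, AlgHom.commutes, mul_smul_comm, ← Algebra.commutes, ← Algebra.smul_def,
        cochain_smul_assoc, cochain_smul_assoc, ← polyOp_eq_smul, smul_comm]
    have h2 : tensorEval 𝒱 n (koszulD 𝒱 b n
        (polyOp 𝒱 f (Fin.cons [u] (fun i => [w i]) : Fin (n + 1) → _) ⊗ₜ[K] ω)) =
        (-1 : K) ^ ((∑ i, (w i).1) * u.1) •
          (polyOp 𝒱 f (fun i => [w i]) ⊗ₜ[K] (extι 𝒱 u.2 * ω)) := by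
      have hu : extι 𝒱 (u.2 : V) * ω =
          ∑ i, b.coord i u.2 • (extι 𝒱 (b i) * ω) := by
        conv_lhs => rw [← b.sum_repr (u.2 : V), map_sum, Finset.sum_mul]
        refine Finset.sum_congr rfl fun i _ => ?_
        rw [map_smul, smul_mul_assoc]
        rfl
      rw [koszulD_tmul, map_sum, hu, TensorProduct.tmul_sum, Finset.smul_sum]
      refine Finset.sum_congr rfl fun i _ => ?_
      rw [tensorEval_tmul, h1, TensorProduct.tmul_smul, smul_comm, TensorProduct.smul_tmul',
        TensorProduct.smul_tmul']
    rw [hw, symbol_succ, h2, map_smul, ih, ← mul_assoc, wedge_mul_ι, coe_wedge_cons,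
      smul_mul_assoc, TensorProduct.tmul_smul, smul_smul, smul_smul, reversalSign]
    congr 1
    have := neg_one_zpow_mul_self (K := K) ((∑ i, (w i).1) * u.1)
    linear_combination (reversalSign n * (-1) ^ n : K) * this

include hb in
omit [FiniteDimensional K V] [CharZero K] in
-- Contraction with the `i`-th coordinate followed by the augmentation of `∧V` extracts the
-- coefficient of `e_i`.
theorem commHead_eq_zero_of_koszulD_eq_zero {n : ℕ} {φ : Cochain K (Poly 𝒱) (n + 1)}
    (h : koszulD 𝒱 b n (φ ⊗ₜ[K] 1) = 0) (i : ι) :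
    commHead 𝒱 (coord 𝒱 (b.coord i)) φ = 0 := by
  classical
  let ε : Ext 𝒱 →ₐ[K] K := KoszulAlgebra.lift 0 (by simp)
  let L : KoszulCochain 𝒱 (n + 1) →ₗ[K] Cochain K (Poly 𝒱) (n + 1) :=
    (TensorProduct.rid K _).toLinearMap ∘ₗ
      LinearMap.lTensor _ (ε.toLinearMap ∘ₗ contract 𝒱 _ (dualCoord 𝒱 b hb i))
  have hL := congrArg L h
  have e : ∀ l, ε (contract 𝒱 _ (dualCoord 𝒱 b hb i) (extι 𝒱 (b l) * 1)) =
      if l = i then 1 else 0 := by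
    intro l
    rw [contract_ι_mul, contract_one, mul_zero, add_zero, map_smul, map_one]
    simp [dualCoord, Finsupp.single_apply]
  rw [koszulD_tmul, map_sum, map_zero] at hL
  simpa [L, -mul_one, e] using hL

include hb in
theorem eq_leftFace_of_koszulD_eq_zero {n : ℕ} {φ : Cochain K (Poly 𝒱) (n + 1)}
    (h : koszulD 𝒱 b n (φ ⊗ₜ[K] 1) = 0) :
    φ = leftFace (polySign 𝒱 1) n (evalHead 1 φ) := by
  refine eq_leftFace_of_commHead_eq_zero 𝒱 fun m x _ => ?_
  let L : Module.Dual K V →ₗ[K] Cochain K (Poly 𝒱) (n + 1) :=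
    { toFun := fun x => commHead 𝒱 (coord 𝒱 x) φ
      map_add' := fun x y => by rw [map_add, commHead_add]
      map_smul' := fun c x => by rw [map_smul, commHead_smul_left, RingHom.id_apply] }
  have hx : x = ∑ i, x (b i) • b.coord i := by
    apply b.ext
    intro l
    simp
  change L x = 0
  rw [hx, map_sum]
  refine Finset.sum_eq_zero fun i _ => ?_
  rw [map_smul]
  change _ • commHead 𝒱 (coord 𝒱 (b.coord i)) φ = 0
  rw [commHead_eq_zero_of_koszulD_eq_zero 𝒱 b hb h, smul_zero]

omit [FiniteDimensional K V] [CharZero K] in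
theorem exists_eq_tmul_one {r n : ℕ} {z : KoszulCochain 𝒱 n} (hz : z ∈ koszulPart 𝒱 r n 0) :
    ∃ φ ∈ headDiff 𝒱 r n, z = φ ⊗ₜ[K] 1 := by
  have : koszulPart 𝒱 r n 0 ≤
      (headDiff 𝒱 r n).map ((TensorProduct.mk K (Cochain K (Poly 𝒱) n) (Ext 𝒱)).flip 1) := by
    refine koszulPart_le 𝒱 fun φ hφ ω hω => ?_
    rw [ExtPower, pow_zero, Submodule.mem_one] at hω
    obtain ⟨c, rfl⟩ := hω
    refine ⟨c • φ, Submodule.smul_mem _ c hφ, ?_⟩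
    rw [Algebra.algebraMap_eq_smul_one, TensorProduct.tmul_smul]
    rfl
  obtain ⟨φ, hφ, e⟩ := this hz
  exact ⟨φ, hφ, e.symm⟩

/-- The left face is injective, since evaluation at `1` undoes it. -/
theorem evalHead_eq_zero_of_hochschildD {n : ℕ} {ρ : Cochain K (Poly 𝒱) n}
    (h : dH 𝒱 (n + 1) (leftFace (polySign 𝒱 1) n ρ) = 0) : barD n ρ = 0 := by
  rw [dH, hochschildD_leftFace (polySign_one_polySign_one 𝒱)] at h
  have := congrArg (evalHead 1) h
  rw [map_neg, evalHead_one_leftFace, map_zero] at this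
  exact neg_eq_zero.1 this

/-- For a cocycle `barD φ` is minus a left face, which `κ` kills; and `κ` commutes with `tensorD`.
-/
theorem tensorD_koszulD_of_cocycle {n : ℕ} {φ : Cochain K (Poly 𝒱) n.succ}
    (hφ : dH 𝒱 (n + 1) φ = 0) :
    tensorD 𝒱 (n + 1) (koszulD 𝒱 b n (φ ⊗ₜ[K] 1)) = 0 := by
  have : barD (n + 1) φ = (-1 : K) • leftFace (polySign 𝒱 1) (n + 1) φ := by
    rw [dH, hochschildD_eq, LinearMap.add_apply] at hφ
    exact (eq_neg_of_add_eq_zero_right hφ).trans (neg_one_smul K _).symm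
  rw [← koszulD_tensorD, tensorD_tmul, this, ← TensorProduct.smul_tmul', map_smul,
    koszulD_leftFace, smul_zero]

include hb in
-- In arity one the contraction turns a vanishing symbol into `κ (φ ⊗ 1) = 0`. So `φ` is the left
-- face of a cochain of arity zero that `barD` kills, and `barD` is injective there.
theorem eq_zero_of_symbol_eq_zero {φ : Cochain K (Poly 𝒱) 1} (hφ : dH 𝒱 1 φ = 0)
    (h : symbol 𝒱 b 1 (φ ⊗ₜ[K] 1) = 0) : φ = 0 := by
  have hz := eq_zero_of_descend_eq_zero (X := KoszulCochain 𝒱) (s := tensorEval 𝒱)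
    (fun _ => tensorEval_tensorD 𝒱) _ (tensorD_koszulD_of_cocycle 𝒱 b hφ) h
  have h1 := eq_leftFace_of_koszulD_eq_zero 𝒱 b hb hz
  rw [h1] at hφ
  have h2 := congrArg (evalHead 1) (evalHead_eq_zero_of_hochschildD 𝒱 hφ)
  rw [evalHead_one_barD_zero, map_zero] at h2
  rw [h1, neg_eq_zero.1 h2, map_zero]

include hb in
-- The zigzag started at `κ (φ ⊗ 1)` yields `ψ` such that `φ - barD ψ` is a left face. After
-- normalizing `ψ`, the cocycle differs from a coboundary by a left face, which is a coboundary by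
-- the contraction.
theorem exists_dH_eq_of_symbol_eq_zero {r : ℕ} (hr : r ≤ 1) {n : ℕ}
    {φ : Cochain K (Poly 𝒱) (n + 2)} (hφr : φ ∈ polyDiff 𝒱 r (n + 2))
    (hφ : dH 𝒱 (n + 2) φ = 0) (h : symbol 𝒱 b (n + 2) (φ ⊗ₜ[K] 1) = 0) :
    ∃ ψ ∈ polyDiff 𝒱 r (n + 1), dH 𝒱 (n + 1) ψ = φ := by
  have hφh := polyDiff_le_headDiff 𝒱 r _ hφr
  have hσ := polySign_one_polySign_one 𝒱
  have hone : (1 : Ext 𝒱) ∈ ExtPower 𝒱 0 := by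
    rw [ExtPower, pow_zero]; exact Submodule.one_le.1 le_rfl
  obtain ⟨Ψ, hΨ, eΨ⟩ := exists_primitive (X := KoszulCochain 𝒱) (D := tensorD 𝒱)
    (s := tensorEval 𝒱) (κ := koszulD 𝒱 b) (Y := koszulPart 𝒱 r) (fun _ => koszulD_koszulD 𝒱 b hb) (fun _ => koszulD_tensorD 𝒱 b)
    (fun _ => tensorEval_tensorD 𝒱)
    (fun _ => tensorD_tensorD 𝒱) (fun _ _ _ => koszulD_mem 𝒱 b hb)
    (fun _ _ _ => tensorEval_mem 𝒱) (fun _ _ _ => tensorD_mem 𝒱 hr)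
    (fun _ _ _ => exists_koszulD_eq 𝒱 b hb) n 0 (koszulD 𝒱 b (n + 1) (φ ⊗ₜ[K] 1))
    (koszulD_mem 𝒱 b hb (tmul_mem_koszulPart 𝒱 hφh hone))
    (tensorD_koszulD_of_cocycle 𝒱 b hφ) (koszulD_koszulD 𝒱 b hb _) h
  obtain ⟨ψ, hψ, rfl⟩ := exists_eq_tmul_one 𝒱 hΨ
  -- Removing the part of order zero in the first argument returns `ψ` to `polyDiff`; `κ` does not
  -- see the change.
  have hψ' := sub_leftFace_mem_polyDiff 𝒱 hr hψ
  obtain ⟨ψ', hψ'_def⟩ : ∃ ψ', ψ' = ψ - leftFace (polySign 𝒱 1) n (evalHead 1 ψ) := ⟨_, rfl⟩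
  rw [← hψ'_def] at hψ'
  have e0 : evalHead 1 ψ' = 0 := by
    rw [hψ'_def, map_sub, evalHead_one_leftFace, sub_self]
  have e1 : koszulD 𝒱 b n (ψ' ⊗ₜ[K] 1) = koszulD 𝒱 b n (ψ ⊗ₜ[K] 1) := by
    rw [hψ'_def, TensorProduct.sub_tmul, map_sub, koszulD_leftFace]
    exact sub_zero (G := KoszulCochain 𝒱 (n + 1)) _
  have e2 : koszulD 𝒱 b (n + 1) ((φ - barD (n + 1) ψ') ⊗ₜ[K] 1) = 0 := by
    rw [TensorProduct.sub_tmul, map_sub, ← tensorD_tmul, koszulD_tensorD, e1, eΨ, sub_self]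
  have e3 := eq_leftFace_of_koszulD_eq_zero 𝒱 b hb e2
  rw [map_sub, evalHead_one_barD, e0, map_zero, sub_zero, sub_neg_eq_add, map_add] at e3
  -- As `ψ'` vanishes at `1`, evaluating `φ - barD ψ'` at `1` contributes an extra `ψ'`, whose left
  -- face completes `barD ψ'` to `dH ψ'`.
  have e4 : φ = dH 𝒱 (n + 1) ψ' + leftFace (polySign 𝒱 1) (n + 1) (evalHead 1 φ) := by
    rw [dH, hochschildD_eq, LinearMap.add_apply]
    rw [sub_eq_iff_eq_add] at e3
    conv_lhs => rw [e3]
    abel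
  have e5 : dH 𝒱 (n + 2) (leftFace (polySign 𝒱 1) (n + 1) (evalHead 1 φ)) = 0 := by
    rw [e4, map_add] at hφ
    have hdd := congrArg (fun F => F ψ') (hochschildD_hochschildD hσ (n + 1))
    rw [LinearMap.comp_apply, LinearMap.zero_apply] at hdd
    rwa [hdd, zero_add] at hφ
  -- With `χ` the value of `φ` at `1` in the first argument, `barD χ = 0` and the contraction gives
  -- `χ = -barD (evalHead 1 χ)`. Hence the left face of `evalHead 1 χ` is a primitive of the left
  -- face of `χ`.
  have e6 := congrArg (evalHead 1) (evalHead_eq_zero_of_hochschildD 𝒱 e5)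
  rw [evalHead_one_barD, map_zero, sub_eq_zero] at e6
  have hχ := evalHead_one_mem_polyDiff 𝒱 hφh
  set χ := evalHead 1 φ
  refine ⟨ψ' + leftFace (polySign 𝒱 1) n (evalHead 1 χ), add_mem hψ' ?_, ?_⟩
  · have := Submodule.sub_mem _ hχ
      (sub_leftFace_mem_polyDiff 𝒱 hr (polyDiff_le_headDiff 𝒱 r _ hχ))
    rwa [sub_sub_cancel] at this
  · have : dH 𝒱 (n + 1) (leftFace (polySign 𝒱 1) n (evalHead 1 χ)) =
        leftFace (polySign 𝒱 1) (n + 1) χ := by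
      rw [dH, hochschildD_leftFace hσ, ← e6, map_neg, neg_neg]
    rw [map_add, this, ← e4]

/-- The part of total degree `m` of the cochains of arity `n` with values in `∧^j V`. -/
def koszulDegree (n j : ℕ) (m : ℤ) : Submodule K (KoszulCochain 𝒱 n) :=
  Submodule.span K {t | ∃ (p : ℤ) (φ : Cochain K (Poly 𝒱) n) (v : Fin j → Σ p : ℤ, 𝒱 p),
    φ ∈ cochainDegree 𝒱 n p ∧ ∑ i, (v i).1 + p = m ∧
      t = φ ⊗ₜ[K] (wedge 𝒱 (fun i => ((v i).2 : V)) : Ext 𝒱)}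

include hb in
omit [FiniteDimensional K V] in
-- The commutator with `x_i` changes the internal degree by `-d i`, which the factor `e_i` of degree
-- `d i` restores.
theorem symbol_mem_koszulDegree {n j : ℕ} {m : ℤ} {z : KoszulCochain 𝒱 n}
    (hz : z ∈ koszulDegree 𝒱 n j m) : symbol 𝒱 b n z ∈ koszulDegree 𝒱 0 (j + n) m := by
  induction n generalizing j with
  | zero => exact hz
  | succ n ih =>
    rw [symbol_succ, ← add_assoc, add_right_comm]
    refine ih ?_
    induction hz using Submodule.span_induction with
    | mem z h =>
      obtain ⟨p, φ, v, hφ, rfl, rfl⟩ := h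
      rw [koszulD_tmul, map_sum]
      refine Submodule.sum_mem _ fun i _ => Submodule.subset_span ⟨-d i + p, _,
        Fin.cons ⟨d i, b i, hb i⟩ v, evalHead_one_mem_cochainDegree 𝒱
          (commHead_mem_cochainDegree 𝒱 (coord_mem_dualGrading b hb i) hφ), ?_, ?_⟩
      · simp only [Fin.sum_univ_succ, Fin.cons_zero, Fin.cons_succ]
        ring
      · rw [coe_wedge_cons, tensorEval_tmul]
    | zero => rw [map_zero, map_zero]; exact zero_mem _
    | add a b _ _ ha hb => rw [map_add, map_add]; exact add_mem ha hb
    | smul c a _ ha => rw [map_smul, map_smul]; exact Submodule.smul_mem _ c ha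

omit [CharZero K] [DirectSum.Decomposition 𝒱] [FiniteDimensional K V] in
theorem koszulDegree_zero_le (k : ℕ) (m : ℤ) :
    koszulDegree 𝒱 0 k m ≤ (polyvectorDegree 𝒱 k m).map (polyvectorIncl 𝒱 k) := by
  refine Submodule.span_le.2 ?_
  rintro _ ⟨p, φ, v, hφ, hm, rfl⟩
  exact ⟨_, Submodule.subset_span ⟨v, p, φ ![], (cochainDegree_zero_iff 𝒱).1 hφ, hm, rfl⟩,
    polyvectorIncl_tmul 𝒱 _ φ⟩

end Symbol

end PolyHKR

end

/-! ### The Hochschild–Kostant–Rosenberg isomorphism -/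

theorem corollary3p3p3 {K V : Type*} [Field K] [CharZero K] [AddCommGroup V] [Module K V]
    [FiniteDimensional K V] (𝒱 : ℤ → Submodule K V) [DirectSum.Decomposition 𝒱]
    (r : ℕ) (hr : r ≤ 1) :
    (∀ k : ℕ, PolyHKR.dH 𝒱 (k + 1) ∘ₗ PolyHKR.dH 𝒱 k = 0) ∧
    (∀ k : ℕ, (PolyHKR.polyDiff 𝒱 r k).map (PolyHKR.dH 𝒱 k) ≤ PolyHKR.polyDiff 𝒱 r (k + 1)) ∧
    ∀ k : ℕ, 1 ≤ k →
      ∃ Φ : (PolyHKR.ExtPower 𝒱 k ⊗[K] PolyHKR.Poly 𝒱) ≃ₗ[K] PolyHKR.Cohomology 𝒱 r k,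
        (∀ (v : Fin k → Σ p : ℤ, 𝒱 p) (f : PolyHKR.Poly 𝒱),
          ∃ h : PolyHKR.polyOp 𝒱 f (fun i => [v i]) ∈ PolyHKR.cocycles 𝒱 r k,
            Φ (PolyHKR.wedge 𝒱 (fun i => ((v i).2 : V)) ⊗ₜ[K] f) =
              PolyHKR.cohomologyClass 𝒱 r k ⟨PolyHKR.polyOp 𝒱 f (fun i => [v i]), h⟩) ∧
        ∀ n : ℤ, (PolyHKR.polyvectorDegree 𝒱 k n).map Φ.toLinearMap =
          PolyHKR.cohomologyDegree 𝒱 r k n := by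
  open PolyHKR in
  refine ⟨fun k => hochschildD_hochschildD (polySign_one_polySign_one 𝒱) k, fun k => ?_,
    fun k hk => ?_⟩
  · rintro _ ⟨φ, hφ, rfl⟩
    exact dH_mem_polyDiff 𝒱 hr hφ
  obtain ⟨N, b, d, hb⟩ := exists_homogeneous_basis 𝒱
  have hone : (1 : Ext 𝒱) ∈ ExtPower 𝒱 0 := by
    rw [ExtPower, pow_zero]; exact Submodule.one_le.1 le_rfl
  -- The symbol is rescaled by the reversal sign, so that `f ∂_{v₁} ⊗ ⋯ ⊗ ∂_{v_k}` goes to `v₁ ∧ ⋯ ∧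
  -- v_k ⊗ f` exactly.
  let P : Cochain K (Poly 𝒱) k →ₗ[K] KoszulCochain 𝒱 0 :=
    (reversalSign k : K) • (symbol 𝒱 b k ∘ₗ (TensorProduct.mk K _ (Ext 𝒱)).flip 1)
  have hP : ∀ φ, P φ = (reversalSign k : K) • symbol 𝒱 b k (φ ⊗ₜ[K] 1) := fun _ => rfl
  have hsign : (reversalSign k : K) ≠ 0 := fun h => by
    simpa [h] using reversalSign_mul_self (K := K) k
  have hcoc : ∀ (v : Fin k → Σ p : ℤ, 𝒱 p) (f : Poly 𝒱),
      polyOp 𝒱 f (fun i => [v i]) ∈ cocycles 𝒱 r k := fun v f =>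
    ⟨Submodule.subset_span ⟨f, _, fun i => by simpa using hr, rfl⟩,
      LinearMap.mem_ker.2 (dH_polyOp_singleton 𝒱 f v)⟩
  have hPv : ∀ (v : Fin k → Σ p : ℤ, 𝒱 p) (f : Poly 𝒱),
      P (polyOp 𝒱 f fun i => [v i]) =
        polyvectorIncl 𝒱 k (wedge 𝒱 (fun i => ((v i).2 : V)) ⊗ₜ[K] f) := by
    intro v f
    rw [hP, symbol_polyOp 𝒱 b, smul_smul, reversalSign_mul_self, one_smul, mul_one,
      ← polyvectorIncl_tmul, polyOp_nil]
  have hrange : ∀ φ ∈ cocycles 𝒱 r k, P φ ∈ LinearMap.range (polyvectorIncl 𝒱 k) := by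
    intro φ hφ
    rw [hP]
    have := symbol_mem_koszulPart 𝒱 b hb
      (tmul_mem_koszulPart 𝒱 (polyDiff_le_headDiff 𝒱 r k hφ.1) hone)
    rw [zero_add] at this
    exact Submodule.smul_mem _ _ (koszulPart_zero_le_range 𝒱 r k this)
  have hsurj : ∀ w, ∃ φ ∈ cocycles 𝒱 r k, P φ = polyvectorIncl 𝒱 k w := by
    intro w
    suffices polyvectorIncl 𝒱 k w ∈ (cocycles 𝒱 r k).map P from this
    induction w using TensorProduct.induction_on with
    | zero => rw [map_zero]; exact zero_mem _
    | add w w' h h' => rw [map_add]; exact add_mem h h'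
    | tmul ω f =>
      obtain ⟨ω, hω⟩ := ω
      let c := polyOp 𝒱 f (Fin.elim0 : Fin 0 → List (Σ p : ℤ, 𝒱 p))
      have hc : ∀ ω : ExtPower 𝒱 k, polyvectorIncl 𝒱 k (ω ⊗ₜ[K] f) = c ⊗ₜ[K] (ω : Ext 𝒱) := by
        intro ω
        rw [← polyvectorIncl_tmul, polyOp_nil]
      rw [hc]
      have hle := extPower_le_span_wedge 𝒱 k hω
      change c ⊗ₜ[K] ω ∈ _
      clear hω
      induction hle using Submodule.span_induction with
      | mem ω h =>
        obtain ⟨v, rfl⟩ := h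
        exact ⟨_, hcoc v f, by rw [hPv, hc]⟩
      | zero => rw [TensorProduct.tmul_zero]; exact zero_mem _
      | add a a' _ _ h h' => rw [TensorProduct.tmul_add]; exact add_mem h h'
      | smul a ω _ h => rw [TensorProduct.tmul_smul]; exact Submodule.smul_mem _ a h
  have hker : ∀ φ ∈ cocycles 𝒱 r k, P φ = 0 ↔ φ ∈ coboundaries 𝒱 r k := by
    rintro φ ⟨hφr, hφ⟩
    replace hφ : dH 𝒱 k φ = 0 := hφ
    rw [hP, smul_eq_zero_iff_right hsign]
    -- Arity one is separate: the truncated complex has no coboundaries there.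
    obtain _ | _ | n := k
    · omega
    · rw [coboundaries, Submodule.mem_bot]
      exact ⟨eq_zero_of_symbol_eq_zero 𝒱 b hb hφ, by rintro rfl; simp⟩
    · constructor
      · intro h
        obtain ⟨ψ, hψ, e⟩ := exists_dH_eq_of_symbol_eq_zero 𝒱 b hb hr hφr hφ h
        exact ⟨ψ, hψ, e⟩
      · rintro ⟨ψ, -, rfl⟩
        exact symbol_dH 𝒱 b hb ψ 1
  obtain ⟨Φ, hΦ⟩ : ∃ Φ : (ExtPower 𝒱 k ⊗[K] Poly 𝒱) ≃ₗ[K] Cohomology 𝒱 r k,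
      ∀ w (φ : cocycles 𝒱 r k), P φ = polyvectorIncl 𝒱 k w → Φ w = cohomologyClass 𝒱 r k φ :=
    exists_equiv_subquotient (N := KoszulCochain 𝒱 0) (W := ExtPower 𝒱 k ⊗[K] Poly 𝒱)
      (Z := cocycles 𝒱 r k) (B := coboundaries 𝒱 r k) P (polyvectorIncl 𝒱 k)
      (polyvectorIncl_injective 𝒱 k) hrange hsurj hker
  refine ⟨Φ, fun v f => ⟨hcoc v f, hΦ _ ⟨_, hcoc v f⟩ (hPv v f)⟩, fun n => le_antisymm ?_ ?_⟩
  · rw [Submodule.map_le_iff_le_comap, polyvectorDegree, Submodule.span_le]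
    rintro _ ⟨v, m, f, hf, hn, rfl⟩
    refine ⟨⟨_, hcoc v f⟩, ?_, (hΦ _ ⟨_, hcoc v f⟩ (hPv v f)).symm⟩
    have := polyOp_mem_cochainDegree 𝒱 hf fun i => [v i]
    rw [← hn, add_comm]
    change polyOp 𝒱 f (fun i => [v i]) ∈ cochainDegree 𝒱 k _
    simpa [tupleDegree] using this
  -- The symbol preserves total degree, so a class represented in degree `n` comes from a polyvector
  -- of degree `n`.
  · rintro _ ⟨φ, hφ, rfl⟩
    obtain ⟨w, hw⟩ := hrange φ.1 φ.2
    have h1 : P φ.1 ∈ (polyvectorDegree 𝒱 k n).map (polyvectorIncl 𝒱 k) := by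
      rw [hP]
      refine Submodule.smul_mem _ _ (koszulDegree_zero_le 𝒱 k n ?_)
      have := symbol_mem_koszulDegree 𝒱 b hb (n := k) (j := 0) (m := n) (z := φ.1 ⊗ₜ[K] 1)
        (Submodule.subset_span ⟨n, φ.1, Fin.elim0, hφ, by simp, by simp [wedge]⟩)
      rwa [zero_add] at this
    obtain ⟨w, hw, e⟩ := h1
    exact ⟨w, hw, hΦ w φ e.symm⟩
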